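/- Notation. Let $n\ge1$, write $x=(x',x_n)\in\mathbb{R}^{n-1}\times\mathbb{R}$, $\xi=(\xi',\xi_n)$, $\langle x\rangle=(1+|x|^2)^{1/2}$, $D_{x_n}=-i\partial_{x_n}$, $\mathbb N_0=\{0,1,2,\dots\}$, $\hat u(\xi)=\int e^{-ix\xi}u(x)\,dx$. Fix real numbers $\mu>1$, $\nu>1$. For $m_1,m_2\in\mathbb{R}$ and $d\ge0$, $S_{\mu\nu}^{m_1,m_2}(\mathbb{R}^d\times\mathbb{R}^d)$ is the set of $a\in C^\infty(\mathbb{R}^d\times\mathbb{R}^d;\mathbb C)$ for which there are $C,D>0$ such that for all $\alpha,\beta\in\mathbb{N}_0^d$ and all $(x,\xi)$ $$|\partial_x^\beta\partial_\xi^\alpha a(x,\xi)|\le CD^{|\alpha|+|\beta|}(\alpha!)^\mu(\beta!)^\nu\langle\xi\rangle^{m_1-|\alpha|}\langle x\rangle^{m_2-|\beta|}.$$ For $u\in\mathcal S(\mathbb{R}^d)$ put $op(a)u(x)=(2\pi)^{-d}\int e^{ix\xi}a(x,\xi)\hat u(\xi)\,d\xi$; $op(a)$ is extended to $\mathcal S'(\mathbb{R}^d)$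 by duality, $\langle op(a)v,\varphi\rangle=\langle v,op(a)^t\varphi\rangle$ with $op(a)^t\varphi(y)=(2\pi)^{-d}\int e^{-iy\xi}\left(\int e^{ix\xi}a(x,\xi)\varphi(x)\,dx\right)d\xi\in\mathcal S(\mathbb{R}^d)$. Assumption (A). Let $m_1\in\mathbb{Z}$, $m_2\in\mathbb{R}$. A symbol $a\in S_{\mu\nu}^{m_1,m_2}(\mathbb{R}^n\times\mathbb{R}^n)$ satisfies (A) if there are functions $a_{m_1-j,m_2-j}(x,\xi)$, $j\in\mathbb{N}_0$, rational in $\xi$ for each $x$ (and such that $z\mapsto a_{m_1-j,m_2-j}(x,\xi',z)$ is a rational function of $z\in\mathbb{C}$ for all $(x,\xi')$), and constants $C,D>0$, $B>r>0$, such that for all $j$ and all $\alpha,\beta\in\mathbb{N}_0^n$ (the functions being $C^\infty$ near the points where derivatives are estimated): 1) whenever $|(x,\xi)|\ge B$, $$|\partial_x^\beta\partial_\xi^\alpha a_{m_1-j,m_2-j}(x,\xi)|\le CD^{|\alpha|+|\beta|+2j}(j!\beta!)^\nu\alpha!\langle x\rangle^{m_2-j-|\beta|}\langle\xi\rangle^{m_1-j-|\alpha|};$$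 2) every pole $z_0$ of $z\in\mathbb{C}\mapsto a_{m_1-j,m_2-j}(x,\xi',z)$ satisfies $|z_0|\le r\langle\xi'\rangle$, and if $z_0\in\mathbb{R}$ then $|(x,\xi',z_0)|\le B$; moreover for all $(x,\xi')\in\mathbb{R}^n\times\mathbb{R}^{n-1}$ and $\theta\in\mathbb{R}$ $$|(\partial_x^\beta\partial_\xi^\alpha a_{m_1-j,m_2-j})(x,\xi',B\langle\xi'\rangle e^{i\theta})|\le CD^{|\alpha|+|\beta|+2j}(j!\beta!)^\nu\alpha!\langle x\rangle^{m_2-j-|\beta|}\langle\xi'\rangle^{m_1-j-|\alpha|};$$ 3) for each $M\in\mathbb{N}_0$ and all $(x,\xi)$ with $\max\{\langle x\rangle,\langle\xi\rangle\}\ge BM^{\mu+\nu-1}$, the remainder $r_M=a-\sum_{j=0}^{M-1}a_{m_1-j,m_2-j}$ satisfies $$|\partial_x^\beta\partial_\xi^\alpha r_M(x,\xi)|\le CD^{|\alpha|+|\beta|+2M}(\alpha!)^\mu(\beta!)^\nu(M!)^{\mu+\nu-1}\langle x\rangle^{m_2-M-|\beta|}\langle\xi\rangle^{m_1-M-|\alpha|}.$$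 Proposition. Let $m_1\in\mathbb{Z}$, $m_2\in\mathbb{R}$, let $a\in S_{\mu\nu}^{m_1,m_2}(\mathbb{R}^n\times\mathbb{R}^n)$ satisfy (A), and let $k,j\in\mathbb{N}_0$. Then for every $u\in\mathcal S(\mathbb{R}^{n-1})$ the boundary value $$A^{kj}u(x')=\lim_{x_n\to0^+}D_{x_n}^k\,op(a)(u\otimes\delta^{(j)})(x',x_n),\qquad x'\in\mathbb{R}^{n-1},$$ is well defined: the tempered distribution $op(a)(u\otimes\delta^{(j)})$, where $\delta$ is the delta distribution in $x_n$, is a $C^\infty$ function in the half-space $\{x_n>0\}$, and the limit exists for every $x'$. Moreover, there is a symbol $a^{kj}\in S_{\mu\nu}^{m_1+j+k+1,m_2}(\mathbb{R}^{n-1}\times\mathbb{R}^{n-1})$, independent of $u$, such that $A^{kj}u=op(a^{kj})u$ for all $u\in\mathcal S(\mathbb{R}^{n-1})$. -/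

import Mathlib

open scoped SchwartzMap ContDiff Topology LineDeriv

noncomputable section

namespace SGBoundary

/-- Euclidean space `ℝⁿ`. -/
abbrev E (n : ℕ) : Type := EuclideanSpace ℝ (Fin n)

/-! ### Coordinates, multi-indices and brackets -/

/-- The `i`-th standard unit vector of `ℝⁿ`. -/
def unitVec {n : ℕ} (i : Fin n) : E n := EuclideanSpace.single i (1 : ℝ)

/-- The point `(x', t)` of `ℝ^d × ℝ = ℝ^(d+1)`. -/
def glue {d : ℕ} (x' : E d) (t : ℝ) : E (d + 1) :=
  WithLp.toLp 2 (Fin.snoc (α := fun _ => ℝ) (fun i => x' i) t)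

/-- The tangential part `ξ'` of `ξ = (ξ', ξ_n)`. -/
def tang {d : ℕ} (ξ : E (d + 1)) : E d := WithLp.toLp 2 (fun i => ξ i.castSucc)

/-- `⟨x⟩ = (1 + |x|²)^(1/2)`. -/
def bracket {n : ℕ} (x : E n) : ℝ := Real.sqrt (1 + ‖x‖ ^ 2)

/-- The Euclidean length `|(x, ξ)|`. -/
def pairLen {m n : ℕ} (x : E m) (ξ : E n) : ℝ := Real.sqrt (‖x‖ ^ 2 + ‖ξ‖ ^ 2)

/-- `|α| = α₁ + ⋯ + αₙ`. -/
def mlen {n : ℕ} (α : Fin n → ℕ) : ℕ := ∑ i, α i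

/-- `α! = α₁! ⋯ αₙ!`. -/
def mfac {n : ℕ} (α : Fin n → ℕ) : ℕ := ∏ i, (α i).factorial

/-! ### Partial derivatives -/

section Derivatives

variable {V : Type} [NormedAddCommGroup V] [NormedSpace ℝ V]

/-- The derivative of `f` in the (real) direction `v`. -/
def dDir (v : V) (f : V → ℂ) : V → ℂ := fun p => fderiv ℝ f p v

/-- `∂_{e₁}^{α₁} ⋯ ∂_{eₙ}^{αₙ} f`. -/
def dMulti {n : ℕ} (e : Fin n → V) (α : Fin n → ℕ) (f : V → ℂ) : V → ℂ :=
  (List.finRange n).foldr (fun i g => (dDir (e i))^[α i] g) f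

end Derivatives

/-- `∂_x^β ∂_ξ^α a` for a function `a` of `(x, ξ) ∈ ℝⁿ × ℝⁿ`. -/
def dXXi {n : ℕ} (β α : Fin n → ℕ) (a : E n × E n → ℂ) : E n × E n → ℂ :=
  dMulti (fun i => (unitVec i, 0)) β (dMulti (fun i => (0, unitVec i)) α a)

/-! ### SG symbols of Gevrey type -/

/-- `a ∈ S_{μν}^{m₁,m₂}(ℝⁿ × ℝⁿ)`. -/
def IsSGSymbol {n : ℕ} (μ ν m₁ m₂ : ℝ) (a : E n × E n → ℂ) : Prop :=
  ContDiff ℝ ∞ a ∧ ∃ C > (0 : ℝ), ∃ D > (0 : ℝ), ∀ (α β : Fin n → ℕ) (x ξ : E n),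
    ‖dXXi β α a (x, ξ)‖ ≤
      C * D ^ (mlen α + mlen β) * (mfac α : ℝ) ^ μ * (mfac β : ℝ) ^ ν *
        bracket ξ ^ (m₁ - mlen α) * bracket x ^ (m₂ - mlen β)

/-! ### Assumption (A)

Functions of `(x, ξ', z)` with `x ∈ ℝ^(d+1)`, `ξ' ∈ ℝ^d` and `z ∈ ℂ`, where `z` is the
complexified last component `ξ_n` of the covariable. -/

/-- For every `x`, `b(x, ·)` is a rational function of `ξ = (ξ', z)`, whose restriction to each
line `ξ' = const` is a rational function of `z`. -/
def IsRationalInXi {d : ℕ} (b : E (d + 1) × E d × ℂ → ℂ) : Prop :=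
  ∀ x : E (d + 1), ∃ P Q : MvPolynomial (Fin (d + 1)) ℂ, ∀ ξ' : E d,
    let pt : ℂ → Fin (d + 1) → ℂ := fun z => Fin.snoc (α := fun _ => ℂ) (fun i => (ξ' i : ℂ)) z
    (∃ z : ℂ, MvPolynomial.eval (pt z) Q ≠ 0) ∧
    ∀ z : ℂ, MvPolynomial.eval (pt z) Q ≠ 0 →
      b (x, ξ', z) = MvPolynomial.eval (pt z) P / MvPolynomial.eval (pt z) Q

/-- The restriction of `b` to real covariables `ξ`. -/
def realRestrict {d : ℕ} (b : E (d + 1) × E d × ℂ → ℂ) : E (d + 1) × E (d + 1) → ℂ :=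
  fun p => b (p.1, tang p.2, ((p.2 (Fin.last d) : ℝ) : ℂ))

/-- The direction of the `i`-th component of `ξ = (ξ', z)`. For the last one this is the
direction `1 ∈ ℂ`; for a function holomorphic in `z` the derivative in this direction is the
complex derivative `∂/∂z`. -/
def xiDir {d : ℕ} (i : Fin (d + 1)) : E (d + 1) × E d × ℂ :=
  Fin.lastCases (motive := fun _ => E (d + 1) × E d × ℂ)
    (0, 0, 1) (fun i' => (0, unitVec i', 0)) i

/-- `∂_x^β ∂_ξ^α b` for a function `b` of `(x, ξ', z)`. -/
def dXXiC {d : ℕ} (β α : Fin (d + 1) → ℕ) (b : E (d + 1) × E d × ℂ → ℂ) :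
    E (d + 1) × E d × ℂ → ℂ :=
  dMulti (fun i => (unitVec i, 0, 0)) β (dMulti xiDir α b)

/-- Assumption (A) for a symbol `a` of order `(m₁, m₂)`, `m₁ ∈ ℤ`; the function `b j` is
`a_{m₁-j, m₂-j}`. A pole of `z ↦ b j (x, ξ', z)` is a point where this rational function is not
analytic. -/
def AssumptionA {d : ℕ} (μ ν : ℝ) (m₁ : ℤ) (m₂ : ℝ) (a : E (d + 1) × E (d + 1) → ℂ) : Prop :=
  ∃ b : ℕ → E (d + 1) × E d × ℂ → ℂ, ∃ C > (0 : ℝ), ∃ D > (0 : ℝ), ∃ B > (0 : ℝ), ∃ r > (0 : ℝ),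
    r < B ∧
    (∀ j, IsRationalInXi (b j)) ∧
    -- (1) estimates at real points
    (∀ (j : ℕ) (x ξ : E (d + 1)), B ≤ pairLen x ξ →
      ContDiffAt ℝ ∞ (realRestrict (b j)) (x, ξ) ∧
      ∀ α β : Fin (d + 1) → ℕ,
        ‖dXXi β α (realRestrict (b j)) (x, ξ)‖ ≤
          C * D ^ (mlen α + mlen β + 2 * j) * ((j.factorial * mfac β : ℕ) : ℝ) ^ ν * mfac α *
            bracket x ^ (m₂ - j - mlen β) * bracket ξ ^ ((m₁ : ℝ) - j - mlen α)) ∧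
    -- (2) location of the poles
    (∀ (j : ℕ) (x : E (d + 1)) (ξ' : E d) (z₀ : ℂ),
      ¬ AnalyticAt ℂ (fun z : ℂ => b j (x, ξ', z)) z₀ →
        ‖z₀‖ ≤ r * bracket ξ' ∧ (z₀.im = 0 → pairLen x (glue ξ' z₀.re) ≤ B)) ∧
    -- (2) estimates on the circles `|z| = B⟨ξ'⟩`
    (∀ (j : ℕ) (x : E (d + 1)) (ξ' : E d) (θ : ℝ),
      let z : ℂ := ((B * bracket ξ' : ℝ) : ℂ) * Complex.exp (Complex.I * (θ : ℂ))
      ContDiffAt ℝ ∞ (b j) (x, ξ', z) ∧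
      ∀ α β : Fin (d + 1) → ℕ,
        ‖dXXiC β α (b j) (x, ξ', z)‖ ≤
          C * D ^ (mlen α + mlen β + 2 * j) * ((j.factorial * mfac β : ℕ) : ℝ) ^ ν * mfac α *
            bracket x ^ (m₂ - j - mlen β) * bracket ξ' ^ ((m₁ : ℝ) - j - mlen α)) ∧
    -- (3) estimates of the remainders
    (∀ (M : ℕ) (x ξ : E (d + 1)), B * (M : ℝ) ^ (μ + ν - 1) ≤ max (bracket x) (bracket ξ) →
      let rem : E (d + 1) × E (d + 1) → ℂ :=
        fun p => a p - ∑ j ∈ Finset.range M, realRestrict (b j) p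
      ContDiffAt ℝ ∞ rem (x, ξ) ∧
      ∀ α β : Fin (d + 1) → ℕ,
        ‖dXXi β α rem (x, ξ)‖ ≤
          C * D ^ (mlen α + mlen β + 2 * M) * (mfac α : ℝ) ^ μ * (mfac β : ℝ) ^ ν *
            (M.factorial : ℝ) ^ (μ + ν - 1) *
            bracket x ^ (m₂ - M - mlen β) * bracket ξ ^ ((m₁ : ℝ) - M - mlen α))

/-! ### Pseudo-differential operators -/

/-- `e^{i x·ξ}`. -/
def expI {n : ℕ} (x ξ : E n) : ℂ := Complex.exp (Complex.I * ((inner ℝ x ξ : ℝ) : ℂ))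

/-- `û(ξ) = ∫ e^{-ix·ξ} u(x) dx`. -/
def hat {n : ℕ} (u : 𝓢(E n, ℂ)) (ξ : E n) : ℂ := ∫ x : E n, expI x (-ξ) * u x

/-- `(2π)^{-n}`. -/
def fourierConst (n : ℕ) : ℂ := ((((2 * Real.pi) ^ n)⁻¹ : ℝ) : ℂ)

/-- `op(a)u(x) = (2π)^{-n} ∫ e^{ix·ξ} a(x, ξ) û(ξ) dξ` for a Schwartz function `u`. -/
def op {n : ℕ} (a : E n × E n → ℂ) (u : 𝓢(E n, ℂ)) (x : E n) : ℂ :=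
  fourierConst n * ∫ ξ : E n, expI x ξ * a (x, ξ) * hat u ξ

/-- The transpose `op(a)ᵗφ(y) = (2π)^{-n} ∫ e^{-iy·ξ} (∫ e^{ix·ξ} a(x, ξ) φ(x) dx) dξ`,
characterised by `∫ (op(a)u) φ = ∫ u (op(a)ᵗφ)`. -/
def opTranspose {n : ℕ} (a : E n × E n → ℂ) (φ : 𝓢(E n, ℂ)) (y : E n) : ℂ :=
  fourierConst n * ∫ ξ : E n, expI y (-ξ) * ∫ x : E n, expI x ξ * a (x, ξ) * φ x

/-- `T = op(a)v` for tempered distributions `v` and `T`: for each Schwartz function `φ`, the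
function `op(a)ᵗφ` is a Schwartz function and `⟨T, φ⟩ = ⟨v, op(a)ᵗφ⟩`. -/
def IsOpOfDistribution {n : ℕ} (a : E n × E n → ℂ) (v T : 𝓢'(E n, ℂ)) : Prop :=
  ∀ φ : 𝓢(E n, ℂ), ∃ ψ : 𝓢(E n, ℂ), (∀ y, ψ y = opTranspose a φ y) ∧ T φ = v ψ

/-! ### Layers `u ⊗ δ^{(j)}` and boundary values -/

/-- The inclusion `x' ↦ (x', 0)` of the boundary hyperplane. -/
def bdryIncl (d : ℕ) : E d →ₗᵢ[ℝ] E (d + 1) where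
  toFun x' := glue x' 0
  map_add' x y := by
    ext i
    refine Fin.lastCases ?_ (fun i => ?_) i <;> simp [glue]
  map_smul' c x := by
    ext i
    refine Fin.lastCases ?_ (fun i => ?_) i <;> simp [glue]
  norm_map' x := by
    simp [glue, EuclideanSpace.norm_eq, Fin.sum_univ_castSucc]

/-- The restriction `φ ↦ φ(·, 0)` of Schwartz functions to the boundary hyperplane. -/
def bdryRestrict (d : ℕ) : 𝓢(E (d + 1), ℂ) →L[ℂ] 𝓢(E d, ℂ) :=
  SchwartzMap.compCLMOfAntilipschitz ℂ
    ((bdryIncl d).toContinuousLinearMap.hasTemperateGrowth) (bdryIncl d).antilipschitz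

/-- `u ⊗ δ`, i.e. `φ ↦ ∫ u(x') φ(x', 0) dx'`. -/
def layer {d : ℕ} (u : 𝓢(E d, ℂ)) : 𝓢'(E (d + 1), ℂ) :=
  PointwiseConvergenceCLM.precomp ℂ (bdryRestrict d)
    (SchwartzMap.toTemperedDistributionCLM (E d) ℂ MeasureTheory.volume u)

/-- `u ⊗ δ^{(j)} = ∂_{x_n}^j (u ⊗ δ)`. -/
def layerDeriv {d : ℕ} (u : 𝓢(E d, ℂ)) (j : ℕ) : 𝓢'(E (d + 1), ℂ) :=
  (fun T : 𝓢'(E (d + 1), ℂ) => ∂_{unitVec (Fin.last d)} T)^[j] (layer u)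

theorem layer_apply {d : ℕ} (u : 𝓢(E d, ℂ)) (φ : 𝓢(E (d + 1), ℂ)) :
    layer u φ = ∫ x' : E d, φ (glue x' 0) * u x' := by
  exact SchwartzMap.toTemperedDistributionCLM_apply_apply MeasureTheory.volume u
    (bdryRestrict d φ)

/-- The open half-space `x_n > 0`. -/
def upperHalf (d : ℕ) : Set (E (d + 1)) := {x | 0 < x (Fin.last d)}

/-- `lim_{x_n → 0⁺} D_{x_n}^k T = g`, where `D_{x_n} = -i ∂_{x_n}`: in the half-space `x_n > 0`
the distribution `T` is a smooth function `w`, and `D_{x_n}^k w(x', x_n) → g(x')` as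
`x_n → 0⁺`, for every `x'`. -/
def HasBoundaryLimit {d : ℕ} (k : ℕ) (T : 𝓢'(E (d + 1), ℂ)) (g : E d → ℂ) : Prop :=
  ∃ w : E (d + 1) → ℂ, ContDiffOn ℝ ∞ w (upperHalf d) ∧
    (∀ φ : 𝓢(E (d + 1), ℂ), HasCompactSupport φ → tsupport φ ⊆ upperHalf d →
      T φ = ∫ x, w x * φ x) ∧
    ∀ x' : E d, Filter.Tendsto
      (fun t : ℝ => (-Complex.I) ^ k * ((dDir (unitVec (Fin.last d)))^[k] w) (glue x' t))
      (𝓝[>] 0) (𝓝 (g x'))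

end SGBoundary

end

open SGBoundary

noncomputable section

namespace SGBoundary

open Filter MeasureTheory

/-! ### Words -/

section WordCombinatorics

variable {V W : Type}

/-! Formally, `op(a)(u ⊗ δ^(j))` is the function `(2π)^(-n) ∫ e^{ix·ξ} (iξ_n)^j a(x, ξ) û(ξ') dξ`.
The integral converges rapidly in `ξ'`, but in general it diverges in `ξ_n`, because `û` does not
depend on `ξ_n`. For `x_n > 0` it is rescued by moving the contour. Write `a = b + (a - b)`, where
`b` is the sum of the first `M` terms of the expansion. For fixed `(x, ξ')`, `b` is rational in `z =
ξ_n` and holomorphic for `|z| > r⟨ξ'⟩`, while `a - b` decays like `⟨ξ⟩^(m₁-M)`. Cut the real line at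
`|ξ_n| = B⟨ξ'⟩` with `B > r`. The inner part is a bounded interval and carries `a` itself. On the
outer part the remainder is absolutely integrable once `M` is large, and since `e^{ix_n z}` is
bounded for `Im z ≥ 0`, the integral of `b` can be replaced by the integral over the upper half of
the circle `|z| = B⟨ξ'⟩`. All three pieces (`halfSpaceFun`) converge absolutely up to `x_n = 0`.

The contour is moved legitimately by inserting the factor `(1 - iεz)^(-N)`, which is holomorphic and
bounded by one in the closed upper half-plane and decays like `|z|^(-N)` (`regularized_contour`,
`BdryData.regInt_eq`). This requires polynomial growth of `b` in complex directions. It follows from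
the growth on the real axis, because `b` is rational (`isBigO_cobounded_of_rational`). Letting `ε →
0` identifies the distribution with `halfSpaceFun` (`BdryData.integral_halfSpaceFun`). The
regularized integrals do not contain `b`, so their limit does not depend on `M`. A larger `M` gives
more derivatives, hence the function is smooth.

A normal derivative turns the amplitude `f` into `(∂_{x_n} + iz) f`, and each `δ`-derivative
contributes a factor `iz`. Both operations preserve all the properties that are used and raise the
order in `ξ` by one (`BdryData.mul`, `BdryData.tw`). So every `A^{kj}` is, up to a constant, the
operator whose symbol `bdrySym` is the contour integral at `x_n = 0` of an amplitude of order `m₁ +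
j + k`.

This boundary symbol has order one higher, because each piece contributes one more factor `⟨ξ'⟩`: as
the length of the interval, the length of the arc, or through `∫ (⟨ξ'⟩² + s²)^(-1) ds = π/⟨ξ'⟩`. Its
contour moves with `ξ'`, but by Cauchy's theorem the radius may be frozen while differentiating
(`bdrySym_eventuallyEq`). Derivatives therefore fall on the integrand only, and the Gevrey estimates
pass through the integral (`BdryData.isSGSymbol`). Since `M` is fixed, its factorials only enter the
overall constant.

That the distribution exists at all rests on `ψ ↦ ∫ e^{ix·ξ} a(x, ξ) ψ(x) dx` being continuous on
Schwartz functions, which is integration by parts (`ampCLM`). -/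

/-- The word in which each direction `e i` is repeated `α i` times. -/
def word {n : ℕ} (e : Fin n → V) (α : Fin n → ℕ) : List V :=
  (List.finRange n).flatMap fun i => List.replicate (α i) (e i)

theorem map_word {n : ℕ} (l : V → W) (e : Fin n → V) (α : Fin n → ℕ) :
    (word e α).map l = word (fun i => l (e i)) α := by
  simp [word, List.map_flatMap]

theorem word_id_count {n : ℕ} (α : Fin n → ℕ) (i : Fin n) :
    ((List.finRange n).flatMap fun i => List.replicate (α i) i).count i = α i := by
  rw [List.count_flatMap, ← List.ofFn_eq_map, List.sum_ofFn]
  simp [List.count_replicate]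

/-- Symbol estimates are indexed by multi-indices, while differentiation under the integral proceeds
by induction on lists of directions. A list differs from the word of its multi-index only in order,
which `dList_perm` shows to be irrelevant for smooth functions. -/
theorem word_count_perm {n : ℕ} (e : Fin n → V) (L : List (Fin n)) :
    (L.map e).Perm (word e fun i => L.count i) := by
  have h : L.Perm ((List.finRange n).flatMap fun i => List.replicate (L.count i) i) :=
    List.perm_iff_count.2 fun i => (word_id_count (fun i => L.count i) i).symm
  have := h.map e
  rwa [List.map_flatMap, show (fun a => List.map e (List.replicate (List.count a L) a)) =
    fun i => List.replicate (L.count i) (e i) from by ext1; simp] at this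

theorem word_add_single_perm {n : ℕ} (e : Fin n → V) (α : Fin n → ℕ) (i : Fin n) :
    (word e (α + Pi.single i 1)).Perm (e i :: word e α) := by
  have h : ((List.finRange n).flatMap fun k => List.replicate ((α + Pi.single i 1 : Fin n → ℕ) k) k).Perm
      (i :: (List.finRange n).flatMap fun k => List.replicate (α k) k) := by
    refine List.perm_iff_count.2 fun k => ?_
    rw [word_id_count, List.count_cons, word_id_count]
    by_cases hk : i = k
    · subst hk; simp
    · simp [hk, Ne.symm hk]
  have := h.map e
  rw [List.map_cons, List.map_flatMap, List.map_flatMap] at this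
  simpa [word] using this

theorem word_snoc {n : ℕ} (e : Fin (n + 1) → V) (α : Fin n → ℕ) (k : ℕ) :
    word e (Fin.snoc (α := fun _ => ℕ) α k) =
      word (fun i => e i.castSucc) α ++ List.replicate k (e (Fin.last n)) := by
  simp [word, List.finRange_succ_last, List.flatMap_append, List.flatMap_map]

theorem word_zero {n : ℕ} (e : Fin n → V) : word e 0 = [] := by
  simp [word]

end WordCombinatorics

/-! ### Iterated directional derivatives along words of directions -/

section Words

variable {V W : Type} [NormedAddCommGroup V] [NormedSpace ℝ V]
  [NormedAddCommGroup W] [NormedSpace ℝ W]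

/-- `∂_{v₁} ⋯ ∂_{v_k} f` for the word `L = [v₁, …, v_k]`. -/
def dList (L : List V) (f : V → ℂ) : V → ℂ := L.foldr dDir f

@[simp] theorem dList_nil (f : V → ℂ) : dList [] f = f := rfl

@[simp] theorem dList_cons (v : V) (L : List V) (f : V → ℂ) :
    dList (v :: L) f = dDir v (dList L f) := rfl

theorem dList_append (L₁ L₂ : List V) (f : V → ℂ) :
    dList (L₁ ++ L₂) f = dList L₁ (dList L₂ f) := by
  simp [dList, List.foldr_append]

theorem dList_replicate (n : ℕ) (v : V) (f : V → ℂ) :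
    dList (List.replicate n v) f = (dDir v)^[n] f := by
  induction n with
  | zero => rfl
  | succ n ih => rw [List.replicate_succ, dList_cons, ih, Function.iterate_succ_apply']

theorem contDiffAt_dDir {f : V → ℂ} {p : V} {n : ℕ} (v : V)
    (hf : ContDiffAt ℝ ((n + 1 : ℕ) : ℕ∞) f p) : ContDiffAt ℝ (n : ℕ∞) (dDir v f) p := by
  have h := hf.fderiv_right (m := ((n : ℕ∞) : WithTop ℕ∞)) (by norm_cast)
  exact h.clm_apply contDiffAt_const

theorem contDiffAt_dList {f : V → ℂ} {p : V} (L : List V) {n : ℕ}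
    (hf : ContDiffAt ℝ ((n + L.length : ℕ) : ℕ∞) f p) : ContDiffAt ℝ (n : ℕ∞) (dList L f) p := by
  induction L generalizing n with
  | nil => simpa using hf
  | cons v L ih =>
    refine contDiffAt_dDir v (ih (hf.of_le ?_))
    simp only [List.length_cons]
    norm_cast
    omega

theorem contDiffAt_dList_infty {f : V → ℂ} {p : V} (L : List V)
    (hf : ContDiffAt ℝ ∞ f p) : ContDiffAt ℝ ∞ (dList L f) p :=
  contDiffAt_infty.2 fun _ => contDiffAt_dList L (contDiffAt_infty.1 hf _)

theorem contDiffAt_dDir_infty {f : V → ℂ} {p : V} (v : V)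
    (hf : ContDiffAt ℝ ∞ f p) : ContDiffAt ℝ ∞ (dDir v f) p :=
  contDiffAt_dList_infty [v] hf

theorem dDir_congr {f g : V → ℂ} {p : V} (v : V) (h : f =ᶠ[𝓝 p] g) :
    dDir v f =ᶠ[𝓝 p] dDir v g := by
  filter_upwards [h.fderiv (𝕜 := ℝ)] with q hq
  simp [dDir, hq]

theorem dList_congr {f g : V → ℂ} {p : V} (L : List V) (h : f =ᶠ[𝓝 p] g) :
    dList L f =ᶠ[𝓝 p] dList L g := by
  induction L with
  | nil => exact h
  | cons v L ih => exact dDir_congr v ih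

theorem eventually_contDiffAt {f : V → ℂ} {p : V} {n : ℕ}
    (hf : ContDiffAt ℝ (n : ℕ∞) f p) : ∀ᶠ q in 𝓝 p, ContDiffAt ℝ (n : ℕ∞) f q :=
  hf.eventually (by simp)

theorem dDir_const_mul (c : ℂ) (v : V) (f : V → ℂ) :
    dDir v (fun p => c * f p) = fun p => c * dDir v f p := by
  ext p
  have : fderiv ℝ (fun p => c * f p) p = c • fderiv ℝ f p := by
    simpa using! congrFun (fderiv_const_smul_field (𝕜 := ℝ) (f := f) c) p
  simp [dDir, this]

theorem dList_const_mul (c : ℂ) (L : List V) (f : V → ℂ) :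
    dList L (fun p => c * f p) = fun p => c * dList L f p := by
  induction L with
  | nil => rfl
  | cons v L ih => rw [dList_cons, ih, dDir_const_mul]; rfl

theorem differentiableAt_of_contDiffAt_succ {f : V → ℂ} {p : V} {n : ℕ}
    (hf : ContDiffAt ℝ ((n + 1 : ℕ) : ℕ∞) f p) : DifferentiableAt ℝ f p :=
  hf.differentiableAt (by simp)

theorem differentiableAt_dList {f : V → ℂ} {p : V} (L : List V) {n : ℕ} (hL : L.length < n)
    (hf : ContDiffAt ℝ (n : ℕ∞) f p) : DifferentiableAt ℝ (dList L f) p := by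
  refine differentiableAt_of_contDiffAt_succ (n := 0) (contDiffAt_dList L (hf.of_le ?_))
  norm_cast
  omega

theorem dList_add {f g : V → ℂ} {p : V} (L : List V)
    (hf : ContDiffAt ℝ (L.length : ℕ∞) f p) (hg : ContDiffAt ℝ (L.length : ℕ∞) g p) :
    dList L (fun q => f q + g q) p = dList L f p + dList L g p := by
  induction L generalizing p with
  | nil => rfl
  | cons v L ih =>
    have h : dList L (fun q => f q + g q) =ᶠ[𝓝 p] fun q => dList L f q + dList L g q := by
      filter_upwards [eventually_contDiffAt hf, eventually_contDiffAt hg] with q h₁ h₂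
      exact ih (h₁.of_le (by norm_cast; simp)) (h₂.of_le (by norm_cast; simp))
    have hf' := differentiableAt_dList L (by simp) hf
    have hg' := differentiableAt_dList L (by simp) hg
    rw [dList_cons, (dDir_congr v h).eq_of_nhds]
    simp [dDir, fderiv_fun_add hf' hg']

theorem dList_neg (L : List V) (f : V → ℂ) :
    dList L (fun p => -f p) = fun p => -dList L f p := by
  simpa using dList_const_mul (-1) L f

theorem dList_sub {f g : V → ℂ} {p : V} (L : List V)
    (hf : ContDiffAt ℝ (L.length : ℕ∞) f p) (hg : ContDiffAt ℝ (L.length : ℕ∞) g p) :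
    dList L (fun q => f q - g q) p = dList L f p - dList L g p := by
  simp only [sub_eq_add_neg]
  rw [dList_add L hf hg.neg, dList_neg]

theorem dDir_zero_fun (v : V) : dDir v (fun _ : V => (0 : ℂ)) = fun _ => 0 := by
  ext p; simp [dDir]

theorem dList_zero_fun (L : List V) : dList L (fun _ : V => (0 : ℂ)) = fun _ => 0 := by
  induction L with
  | nil => rfl
  | cons v L ih => rw [dList_cons, ih, dDir_zero_fun]

theorem dList_sum {ι : Type*} (s : Finset ι) {f : ι → V → ℂ} {p : V} (L : List V)
    (hf : ∀ i ∈ s, ContDiffAt ℝ (L.length : ℕ∞) (f i) p) :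
    dList L (fun q => ∑ i ∈ s, f i q) p = ∑ i ∈ s, dList L (f i) p := by
  classical
  induction s using Finset.induction_on with
  | empty => simp [dList_zero_fun]
  | insert i s his ih =>
    simp only [Finset.sum_insert his]
    rw [dList_add L (hf i (by simp)) (ContDiffAt.sum fun k hk => hf k (by simp [hk])),
      ih fun k hk => hf k (by simp [hk])]

theorem dDir_comp_affine (l : V →L[ℝ] W) (c : W) {g : W → ℂ} {p : V} (v : V)
    (hg : DifferentiableAt ℝ g (l p + c)) :
    dDir v (fun q => g (l q + c)) p = dDir (l v) g (l p + c) := by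
  have h : HasFDerivAt (fun q => l q + c) l p := l.hasFDerivAt.add_const c
  have := (hg.hasFDerivAt.comp p h).fderiv
  simp only [dDir]
  rw [show (fun q => g (l q + c)) = g ∘ fun q => l q + c from rfl, this]
  rfl

theorem dList_comp_affine (l : V →L[ℝ] W) (c : W) {g : W → ℂ} {p : V} (L : List V)
    (hg : ContDiffAt ℝ (L.length : ℕ∞) g (l p + c)) :
    dList L (fun q => g (l q + c)) p = dList (L.map l) g (l p + c) := by
  induction L generalizing p with
  | nil => rfl
  | cons v L ih =>
    have hc : ContinuousAt (fun q => l q + c) p := by fun_prop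
    have h : dList L (fun q => g (l q + c)) =ᶠ[𝓝 p]
        fun q => dList (L.map l) g (l q + c) := by
      filter_upwards [hc.eventually (eventually_contDiffAt hg)] with q hq
      exact ih (hq.of_le (by norm_cast; simp))
    rw [dList_cons, (dDir_congr v h).eq_of_nhds, List.map_cons, dList_cons,
      dDir_comp_affine l c v (differentiableAt_dList _ (by simp) hg)]

theorem dDir_comm {f : V → ℂ} {p : V} (v w : V) (hf : ContDiffAt ℝ (2 : ℕ∞) f p) :
    dDir v (dDir w f) p = dDir w (dDir v f) p := by
  have hd : DifferentiableAt ℝ (fderiv ℝ f) p :=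
    (hf.fderiv_right (m := 1) (by norm_num)).differentiableAt (by simp)
  have hs : IsSymmSndFDerivAt ℝ f p := hf.isSymmSndFDerivAt (by simp)
  have key : ∀ a b : V, dDir a (dDir b f) p = fderiv ℝ (fderiv ℝ f) p a b := by
    intro a b
    have : HasFDerivAt (fun q => fderiv ℝ f q b)
        ((ContinuousLinearMap.apply ℝ ℂ b).comp (fderiv ℝ (fderiv ℝ f) p)) p :=
      (ContinuousLinearMap.apply ℝ ℂ b).hasFDerivAt.comp p hd.hasFDerivAt
    rw [show dDir a (dDir b f) p = fderiv ℝ (fun q => fderiv ℝ f q b) p a from rfl, this.fderiv]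
    rfl
  rw [key, key]
  exact hs.eq v w

theorem dList_perm {L₁ L₂ : List V} (h : L₁.Perm L₂) {f : V → ℂ} {p : V}
    (hf : ContDiffAt ℝ (L₁.length : ℕ∞) f p) : dList L₁ f p = dList L₂ f p := by
  induction h generalizing p with
  | nil => rfl
  | cons v h ih =>
    rename_i M₁ M₂
    have : dList M₁ f =ᶠ[𝓝 p] dList M₂ f := by
      filter_upwards [eventually_contDiffAt hf] with q hq
      exact ih (hq.of_le (by norm_cast; simp))
    exact (dDir_congr v this).eq_of_nhds
  | swap v w L =>
    simp only [dList_cons]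
    refine dDir_comm _ _ (contDiffAt_dList (n := 2) L (hf.of_le ?_))
    simp only [List.length_cons]
    norm_cast
    omega
  | trans h₁ h₂ ih₁ ih₂ =>
    rw [ih₁ hf, ih₂ (by rwa [← h₁.length_eq])]

theorem dMulti_eq_dList {n : ℕ} (e : Fin n → V) (α : Fin n → ℕ) (f : V → ℂ) :
    dMulti e α f = dList (word e α) f := by
  unfold dMulti word
  induction List.finRange n with
  | nil => rfl
  | cons i l ih =>
    rw [List.foldr_cons, List.flatMap_cons, dList_append, dList_replicate, ih]

end Words

/-! ### Differentiation under the integral sign -/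

section ParametricIntegrals

variable {V : Type} [NormedAddCommGroup V] [NormedSpace ℝ V] {ι : Type} [Fintype ι]
  {Ω : Type*} [MeasurableSpace Ω] {ρ : Measure Ω}

theorem clm_eq_sum_coord [FiniteDimensional ℝ V] (b : Module.Basis ι ℝ V) (g : V →L[ℝ] ℂ) :
    g = ∑ i, (LinearMap.toContinuousLinearMap (b.coord i)).smulRight (g (b i)) := by
  ext v
  conv_lhs => rw [← b.sum_repr v]
  simp [-Module.Basis.sum_repr]

/-- The derivative is the a.e. limit of difference quotients along a sequence of steps, so
measurability of derivatives of the integrand never has to be assumed. -/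
theorem aestronglyMeasurable_dDir {f : V → Ω → ℂ} {U : Set V} (hU : IsOpen U)
    (hm : ∀ p ∈ U, AEStronglyMeasurable (f p) ρ)
    (hd : ∀ᵐ σ ∂ρ, ∀ p ∈ U, DifferentiableAt ℝ (fun q => f q σ) p) (v : V) :
    ∀ p ∈ U, AEStronglyMeasurable (fun σ => dDir v (fun q => f q σ) p) ρ := by
  intro p hp
  have hc : Tendsto (fun n : ℕ => p + ((n : ℝ) + 1)⁻¹ • v) atTop (𝓝 p) := by
    have : Tendsto (fun n : ℕ => ((n : ℝ) + 1)⁻¹) atTop (𝓝 0) := by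
      simpa using tendsto_one_div_add_atTop_nhds_zero_nat (𝕜 := ℝ)
    simpa using tendsto_const_nhds.add (this.smul_const v)
  have hev : ∀ᶠ n : ℕ in atTop, p + ((n : ℝ) + 1)⁻¹ • v ∈ U := hc.eventually (hU.mem_nhds hp)
  -- Starting the sequence of steps `1/(n + 1)` at `n = N` keeps all the shifted points inside `U`,
  -- where measurability is known.
  obtain ⟨N, hN⟩ := eventually_atTop.1 hev
  refine aestronglyMeasurable_of_tendsto_ae atTop (f := fun (n : ℕ) σ =>
    ((((n + N : ℕ) : ℝ) + 1)) • (f (p + (((n + N : ℕ) : ℝ) + 1)⁻¹ • v) σ - f p σ)) ?_ ?_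
  · intro n
    have h := (hm _ (hN (n + N) (Nat.le_add_left N n))).sub (hm p hp)
    exact h.const_smul (((n + N : ℕ) : ℝ) + 1)
  · filter_upwards [hd] with σ hσ
    have h := (hσ p hp).hasFDerivAt
    refine h.lim v (c := fun n : ℕ => (((n + N : ℕ) : ℝ) + 1)) (l := atTop) ?_
    refine tendsto_norm_atTop_atTop.comp (tendsto_atTop_add_const_right _ 1 ?_)
    exact tendsto_natCast_atTop_atTop.comp (tendsto_add_atTop_nat N)

/-- Domination is required only along basis directions, since the full derivative is a fixed linear
combination of them (`clm_eq_sum_coord`). -/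
theorem hasFDerivAt_integral_of_words [FiniteDimensional ℝ V] (b : Module.Basis ι ℝ V)
    {f : V → Ω → ℂ} {U : Set V} (hU : IsOpen U)
    (hm : ∀ p ∈ U, AEStronglyMeasurable (f p) ρ)
    (hd : ∀ᵐ σ ∂ρ, ∀ p ∈ U, DifferentiableAt ℝ (fun q => f q σ) p)
    {G : Ω → ℝ} (hG : Integrable G ρ) (hfG : ∀ᵐ σ ∂ρ, ∀ p ∈ U, ‖f p σ‖ ≤ G σ)
    {H : ι → Ω → ℝ} (hH : ∀ i, Integrable (H i) ρ)
    (hfH : ∀ i, ∀ᵐ σ ∂ρ, ∀ p ∈ U, ‖dDir (b i) (fun q => f q σ) p‖ ≤ H i σ) {p : V} (hp : p ∈ U) :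
    DifferentiableAt ℝ (fun q => ∫ σ, f q σ ∂ρ) p ∧
      ∀ v, dDir v (fun q => ∫ σ, f q σ ∂ρ) p = ∫ σ, dDir v (fun q => f q σ) p ∂ρ := by
  have hmd := fun v => aestronglyMeasurable_dDir hU hm hd v p hp
  have hF' : AEStronglyMeasurable (fun σ => fderiv ℝ (fun q => f q σ) p) ρ := by
    have : (fun σ => fderiv ℝ (fun q => f q σ) p) = fun σ => ∑ i,
        (ContinuousLinearMap.smulRightL ℝ V ℂ (LinearMap.toContinuousLinearMap (b.coord i)))
          (dDir (b i) (fun q => f q σ) p) := by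
      ext1 σ
      exact clm_eq_sum_coord b _
    rw [this]
    exact Finset.aestronglyMeasurable_fun_sum _ fun i _ =>
      (ContinuousLinearMap.continuous _).comp_aestronglyMeasurable (hmd (b i))
  have hb : ∀ᵐ σ ∂ρ, ∀ q ∈ U, ‖fderiv ℝ (fun q => f q σ) q‖ ≤
      ∑ i, ‖LinearMap.toContinuousLinearMap (b.coord i)‖ * H i σ := by
    filter_upwards [ae_all_iff.2 hfH] with σ hσ q hq
    rw [clm_eq_sum_coord b (fderiv ℝ (fun q => f q σ) q)]
    refine (norm_sum_le _ _).trans (Finset.sum_le_sum fun i _ => ?_)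
    rw [ContinuousLinearMap.norm_smulRight_apply]
    exact mul_le_mul_of_nonneg_left (hσ i q hq) (norm_nonneg _)
  have hint : Integrable (f p) ρ := hG.mono' (hm p hp) (hfG.mono fun σ h => h p hp)
  have key := hasFDerivAt_integral_of_dominated_of_fderiv_le (𝕜 := ℝ) (μ := ρ) (F := f)
    (F' := fun q σ => fderiv ℝ (fun q => f q σ) q) (hU.mem_nhds hp)
    (eventually_of_mem (hU.mem_nhds hp) hm) hint hF' hb
    (integrable_finsetSum _ fun i _ => (hH i).const_mul _)
    (hd.mono fun σ h q hq => (h q hq).hasFDerivAt)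
  refine ⟨key.differentiableAt, fun v => ?_⟩
  have hi : Integrable (fun σ => fderiv ℝ (fun q => f q σ) p) ρ :=
    (integrable_finsetSum _ fun i _ => (hH i).const_mul _).mono' hF' (hb.mono fun σ h => h p hp)
  rw [dDir, key.fderiv, ContinuousLinearMap.integral_apply hi]
  rfl

theorem contDiffOn_integral_of_words [FiniteDimensional ℝ V] (b : Module.Basis ι ℝ V) (n : ℕ)
    {f : V → Ω → ℂ} {U : Set V} (hU : IsOpen U)
    (hm : ∀ p ∈ U, AEStronglyMeasurable (f p) ρ)
    (hd : ∀ᵐ σ ∂ρ, ∀ p ∈ U, ContDiffAt ℝ (n : ℕ∞) (fun q => f q σ) p)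
    (hb : ∀ L : List ι, L.length ≤ n → ∃ G : Ω → ℝ, Integrable G ρ ∧
      ∀ᵐ σ ∂ρ, ∀ p ∈ U, ‖dList (L.map b) (fun q => f q σ) p‖ ≤ G σ) :
    ContDiffOn ℝ (n : ℕ∞) (fun q => ∫ σ, f q σ ∂ρ) U ∧ ∀ L : List ι, L.length ≤ n → ∀ p ∈ U,
      dList (L.map b) (fun q => ∫ σ, f q σ ∂ρ) p =
        ∫ σ, dList (L.map b) (fun q => f q σ) p ∂ρ := by
  induction n generalizing f with
  | zero =>
    obtain ⟨G, hG, hfG⟩ := hb [] (by simp)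
    refine ⟨?_, ?_⟩
    · refine contDiffOn_zero.2 ?_
      intro p hp
      refine ContinuousAt.continuousWithinAt ?_
      refine continuousAt_of_dominated (eventually_of_mem (hU.mem_nhds hp) hm)
        (eventually_of_mem (hU.mem_nhds hp) fun q hq => hfG.mono fun σ h => h q hq) hG ?_
      filter_upwards [hd] with σ h
      exact (h p hp).continuousAt
    · intro L hL p _
      obtain rfl : L = [] := by simpa using hL
      rfl
  | succ n ih =>
    obtain ⟨G, hG, hfG⟩ := hb [] (by simp)
    choose H hH hfH using fun i => hb [i] (by simp)
    have hd1 : ∀ᵐ σ ∂ρ, ∀ p ∈ U, DifferentiableAt ℝ (fun q => f q σ) p :=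
      hd.mono fun σ h p hp => differentiableAt_of_contDiffAt_succ (h p hp)
    have key := fun p (hp : p ∈ U) =>
      hasFDerivAt_integral_of_words b hU hm hd1 hG hfG hH hfH hp
    have hstep := fun i => ih (f := fun p σ => dDir (b i) (fun q => f q σ) p)
      (aestronglyMeasurable_dDir hU hm hd1 (b i))
      (hd.mono fun σ h p hp => contDiffAt_dDir (b i) (h p hp))
      (fun L hL => by
        obtain ⟨K, hK, hfK⟩ := hb (L ++ [i]) (by simpa using hL)
        refine ⟨K, hK, hfK.mono fun σ h p hp => ?_⟩
        have := h p hp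
        rwa [List.map_append, dList_append] at this)
    refine ⟨?_, ?_⟩
    · rw [show (((n + 1 : ℕ) : ℕ∞) : WithTop ℕ∞) = ((n : ℕ∞) : WithTop ℕ∞) + 1 by norm_cast]
      refine contDiffOn_succ_of_fderiv_apply
        (fun p hp => (key p hp).1.differentiableWithinAt) (by simp) fun y => ?_
      have : ContDiffOn ℝ (n : ℕ∞) (fun p => ∑ i, b.repr y i •
          ∫ σ, dDir (b i) (fun q => f q σ) p ∂ρ) U :=
        ContDiffOn.sum fun i _ => (hstep i).1.const_smul (b.repr y i)
      refine this.congr fun p hp => ?_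
      rw [fderivWithin_of_isOpen hU hp]
      conv_lhs => rw [← b.sum_repr y]
      rw [map_sum]
      refine Finset.sum_congr rfl fun i _ => ?_
      rw [map_smul]
      congr 1
      exact (key p hp).2 (b i)
    · intro L hL p hp
      -- The last letter is the innermost derivative. It passes under the integral first, and the
      -- remaining word falls under the induction hypothesis for the differentiated integrand.
      rcases List.eq_nil_or_concat L with rfl | ⟨L', i, rfl⟩
      · rfl
      · rw [List.concat_eq_append] at hL ⊢
        simp only [List.map_append, dList_append, List.map_cons, List.map_nil, dList_cons, dList_nil]
        rw [← (hstep i).2 L' (by simpa using hL) p hp]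
        refine (dList_congr _ ?_).eq_of_nhds
        filter_upwards [hU.mem_nhds hp] with q hq
        exact (key q hq).2 (b i)

end ParametricIntegrals

/-! ### Contour integrals in the upper half-plane -/

section Contours

/-- The point `R e^{iθ}`. -/
def circ (R θ : ℝ) : ℂ := (R : ℂ) * Complex.exp (Complex.I * (θ : ℂ))

/-- The integral of `g` over the upper half of the circle `|z| = R`, from `R` to `-R`. -/
def arcInt (g : ℂ → ℂ) (R : ℝ) : ℂ :=
  ∫ θ in (0 : ℝ)..Real.pi, g (circ R θ) * (Complex.I * circ R θ)

/-- The real points of absolute value at least `R`. -/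
def outer (R : ℝ) : Set ℝ := {s | R ≤ |s|}

theorem mem_outer {R s : ℝ} : s ∈ outer R ↔ R ≤ |s| := Iff.rfl

theorem measurableSet_outer (R : ℝ) : MeasurableSet (outer R) :=
  measurableSet_le measurable_const measurable_norm

theorem continuous_circ (R : ℝ) : Continuous (circ R) := by
  unfold circ; fun_prop

theorem norm_circ {R : ℝ} (hR : 0 ≤ R) (θ : ℝ) : ‖circ R θ‖ = R := by
  rw [circ, norm_mul, mul_comm Complex.I, Complex.norm_exp_ofReal_mul_I, mul_one,
    Complex.norm_real, Real.norm_of_nonneg hR]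

theorem circ_im (R θ : ℝ) : (circ R θ).im = R * Real.sin θ := by
  simp [circ, mul_comm Complex.I, Complex.exp_ofReal_mul_I_im]

theorem circ_im_nonneg {R θ : ℝ} (hR : 0 ≤ R) (hθ : θ ∈ Set.Icc 0 Real.pi) :
    0 ≤ (circ R θ).im := by
  rw [circ_im]
  exact mul_nonneg hR (Real.sin_nonneg_of_mem_Icc hθ)

/-- The exponential maps the rectangle `[log R, log S] × [0, π]` onto the half annulus, so this is
Cauchy's theorem for the rectangle applied to `g(e^w) e^w`. -/
theorem integral_half_annulus {g : ℂ → ℂ} {R S : ℝ} (hR : 0 < R) (hRS : R ≤ S)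
    (hg : ∀ z : ℂ, R ≤ ‖z‖ → ‖z‖ ≤ S → 0 ≤ z.im → DifferentiableAt ℂ g z) :
    (∫ u in R..S, g u) + (∫ u in R..S, g (-u)) = arcInt g R - arcInt g S := by
  have hS : 0 < S := hR.trans_le hRS
  have hlog : Real.log R ≤ Real.log S := Real.log_le_log hR hRS
  have hH : DifferentiableOn ℂ (fun w : ℂ => g (Complex.exp w) * Complex.exp w)
      (Set.uIcc (Real.log R) (Real.log S) ×ℂ Set.uIcc 0 Real.pi) := by
    rintro w ⟨hw1, hw2⟩
    rw [Set.mem_preimage, Set.uIcc_of_le hlog] at hw1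
    rw [Set.mem_preimage, Set.uIcc_of_le Real.pi_pos.le] at hw2
    refine DifferentiableAt.differentiableWithinAt ?_
    have h1 : R ≤ ‖Complex.exp w‖ := by
      rw [Complex.norm_exp, ← Real.log_le_iff_le_exp hR]; exact hw1.1
    have h2 : ‖Complex.exp w‖ ≤ S := by
      rw [Complex.norm_exp, ← Real.le_log_iff_exp_le hS]; exact hw1.2
    have h3 : 0 ≤ (Complex.exp w).im := by
      rw [Complex.exp_im]
      exact mul_nonneg (Real.exp_pos _).le (Real.sin_nonneg_of_mem_Icc hw2)
    exact ((hg _ h1 h2 h3).comp w Complex.differentiable_exp.differentiableAt).mul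
      Complex.differentiable_exp.differentiableAt
  have key := Complex.integral_boundary_rect_eq_zero_of_differentiableOn
    (fun w : ℂ => g (Complex.exp w) * Complex.exp w) ((Real.log R : ℝ) : ℂ)
    ((Real.log S : ℝ) + (Real.pi : ℝ) * Complex.I) (by simpa using hH)
  -- The sides `Im w = 0` and `Im w = π` are mapped to the positive and the negative real axis,
  -- which are the cases `c = 1` and `c = -1`.
  have hsub : ∀ (c : ℂ), (c = 1 ∨ c = -1) →
      (∫ x in Real.log R..Real.log S, g (c * Complex.exp (x : ℂ)) * Complex.exp (x : ℂ)) =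
        ∫ u in R..S, g (c * u) := by
    intro c hc
    have := intervalIntegral.integral_deriv_smul_comp' (a := Real.log R) (b := Real.log S)
      (f := Real.exp) (f' := Real.exp) (g := fun u : ℝ => g (c * u))
      (fun x _ => Real.hasDerivAt_exp x) Real.continuous_exp.continuousOn ?_
    · rw [Real.exp_log hR, Real.exp_log hS] at this
      rw [← this]
      refine intervalIntegral.integral_congr fun x _ => ?_
      simp [mul_comm]
    · rintro u ⟨x, hx, rfl⟩
      rw [Set.uIcc_of_le hlog] at hx
      have hc' : ‖c‖ = 1 := by rcases hc with rfl | rfl <;> simp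
      have hn : ‖c * (Real.exp x : ℂ)‖ = Real.exp x := by
        rw [norm_mul, hc', one_mul, Complex.norm_real, Real.norm_of_nonneg (Real.exp_pos _).le]
      have him : (c * (Real.exp x : ℂ)).im = 0 := by
        rcases hc with rfl | rfl
        · rw [one_mul, Complex.ofReal_im]
        · rw [neg_one_mul, Complex.neg_im, Complex.ofReal_im, neg_zero]
      have hd : DifferentiableAt ℂ g (c * (Real.exp x : ℂ)) := by
        refine hg _ ?_ ?_ him.ge
        · rw [hn, ← Real.log_le_iff_le_exp hR]; exact hx.1
        · rw [hn, ← Real.le_log_iff_exp_le hS]; exact hx.2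
      have hcont : ContinuousAt (fun u : ℝ => c * (u : ℂ)) (Real.exp x) := by fun_prop
      exact (ContinuousAt.comp (f := fun u : ℝ => c * (u : ℂ)) hd.continuousAt
        hcont).continuousWithinAt
  have harc : ∀ T : ℝ, 0 < T → (∫ y in (0 : ℝ)..Real.pi,
      g (Complex.exp ((Real.log T : ℝ) + y * Complex.I)) *
        Complex.exp ((Real.log T : ℝ) + y * Complex.I)) * Complex.I = arcInt g T := by
    intro T hT
    rw [arcInt, ← intervalIntegral.integral_mul_const]
    refine intervalIntegral.integral_congr fun y _ => ?_
    have : Complex.exp ((Real.log T : ℝ) + y * Complex.I) = circ T y := by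
      rw [Complex.exp_add, ← Complex.ofReal_exp, Real.exp_log hT, circ, mul_comm Complex.I]
    simp only [this]
    ring
  have h1 := hsub 1 (Or.inl rfl)
  have h2 := hsub (-1) (Or.inr rfl)
  have e3 := harc R hR
  have e4 := harc S hS
  simp only [one_mul, neg_mul] at h1 h2
  simp only [Complex.ofReal_re, Complex.ofReal_im, Complex.add_re, Complex.add_im,
    Complex.mul_re, Complex.mul_im, Complex.I_re, Complex.I_im, mul_zero, mul_one, sub_zero,
    add_zero, zero_add, Complex.ofReal_zero, zero_mul, Complex.exp_add, Complex.exp_pi_mul_I,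
    mul_neg, smul_eq_mul, intervalIntegral.integral_neg] at key
  simp only [Complex.exp_add] at e3 e4
  rw [h1, h2] at key
  rw [← e3, ← e4]
  linear_combination key

theorem outer_eq {R : ℝ} : outer R = Set.Iic (-R) ∪ Set.Ici R := by
  ext s
  simp only [mem_outer, le_abs, Set.mem_union, Set.mem_Iic, Set.mem_Ici]
  constructor <;> rintro (h | h) <;> first | exact Or.inl (by linarith) | exact Or.inr (by linarith)

theorem setIntegral_outer {f : ℝ → ℂ} {R : ℝ} (hR : 0 < R) (hf : IntegrableOn f (outer R)) :
    ∫ s in outer R, f s = (∫ s in Set.Ioi R, f s) + ∫ s in Set.Ioi R, f (-s) := by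
  rw [outer_eq] at hf ⊢
  rw [setIntegral_union (by
      rw [Set.disjoint_left]
      intro s h1 h2
      simp only [Set.mem_Iic, Set.mem_Ici] at h1 h2
      linarith) measurableSet_Ici (hf.mono_set Set.subset_union_left)
      (hf.mono_set Set.subset_union_right), integral_Ici_eq_integral_Ioi,
      integral_comp_neg_Ioi, add_comm]

/-- Closing the contour in the upper half-plane. -/
theorem integral_outer_eq_arcInt {g : ℂ → ℂ} {R : ℝ} (hR : 0 < R)
    (hg : ∀ z : ℂ, R ≤ ‖z‖ → 0 ≤ z.im → DifferentiableAt ℂ g z)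
    (hi : IntegrableOn (fun s : ℝ => g s) (outer R))
    {C ρ : ℝ} (hC : ∀ z : ℂ, ρ ≤ ‖z‖ → 0 ≤ z.im → ‖g z‖ ≤ C / ‖z‖ ^ 2) :
    ∫ s in outer R, g (s : ℂ) = arcInt g R := by
  rw [setIntegral_outer hR hi]
  have hi1 : IntegrableOn (fun s : ℝ => g s) (Set.Ioi R) := hi.mono_set fun s hs => by
    rw [mem_outer]
    exact (le_of_lt hs).trans (le_abs_self s)
  have hi2 : IntegrableOn (fun s : ℝ => g (-s : ℝ)) (Set.Ioi R) := by
    have : IntegrableOn (fun s : ℝ => g s) (Set.Iio (-R)) := hi.mono_set fun s hs => by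
      rw [mem_outer]
      have : s < -R := hs
      exact (by linarith : R ≤ -s).trans (neg_le_abs s)
    exact this.comp_neg_Ioi
  have t1 := intervalIntegral_tendsto_integral_Ioi R hi1 tendsto_id
  have t2 := intervalIntegral_tendsto_integral_Ioi R hi2 tendsto_id
  -- The arc has length `πS` and the integrand is at most `|C|/S²` on it.
  have t3 : Tendsto (fun S : ℝ => arcInt g S) atTop (𝓝 0) := by
    have hlim : Tendsto (fun S : ℝ => |C| * Real.pi * S⁻¹) atTop (𝓝 0) := by
      simpa using tendsto_inv_atTop_zero.const_mul (|C| * Real.pi)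
    refine squeeze_zero_norm' ?_ hlim
    filter_upwards [eventually_ge_atTop ρ, eventually_gt_atTop 0] with S hS hS0
    have := intervalIntegral.norm_integral_le_of_norm_le_const (a := 0) (b := Real.pi)
      (f := fun θ => g (circ S θ) * (Complex.I * circ S θ)) (C := |C| * S⁻¹) ?_
    · rw [arcInt]
      refine this.trans (le_of_eq ?_)
      rw [sub_zero, abs_of_pos Real.pi_pos]
      ring
    · intro θ hθ
      rw [Set.uIoc_of_le Real.pi_pos.le] at hθ
      have hz := hC (circ S θ) (by rw [norm_circ hS0.le]; exact hS)
        (circ_im_nonneg hS0.le ⟨hθ.1.le, hθ.2⟩)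
      rw [norm_mul, norm_mul, Complex.norm_I, one_mul]
      rw [norm_circ hS0.le] at hz ⊢
      calc ‖g (circ S θ)‖ * S ≤ |C| / S ^ 2 * S :=
            mul_le_mul_of_nonneg_right (hz.trans (by gcongr; exact le_abs_self C)) hS0.le
        _ = |C| * S⁻¹ := by field_simp
  have t4 := (t1.add t2).add t3
  rw [add_zero] at t4
  refine tendsto_nhds_unique t4 (tendsto_const_nhds.congr' ?_)
  filter_upwards [eventually_ge_atTop R] with S hS
  have := integral_half_annulus hR hS fun z h1 _ h3 => hg z h1 h3
  simp only [id, Complex.ofReal_neg]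
  rw [this]
  ring

theorem setIntegral_outer_diff {g : ℂ → ℂ} {R S : ℝ} (hR : 0 < R) (hRS : R ≤ S)
    (hg : ∀ z : ℂ, R ≤ ‖z‖ → ‖z‖ ≤ S → 0 ≤ z.im → DifferentiableAt ℂ g z) :
    IntegrableOn (fun s : ℝ => g s) (outer R \ outer S) ∧
    ∫ s in outer R \ outer S, g (s : ℂ) = arcInt g R - arcInt g S := by
  rw [← integral_half_annulus hR hRS hg]
  have hset : outer R \ outer S = Set.Ioc (-S) (-R) ∪ Set.Ico R S := by
    ext s
    simp only [Set.mem_sdiff, mem_outer, Set.mem_union, Set.mem_Ioc, Set.mem_Ico, le_abs,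
      not_or, not_le]
    constructor
    · rintro ⟨h | h, h1, h2⟩
      · exact Or.inr ⟨h, h1⟩
      · exact Or.inl ⟨by linarith, by linarith⟩
    · rintro (⟨h1, h2⟩ | ⟨h1, h2⟩)
      · exact ⟨Or.inr (by linarith), by linarith, by linarith⟩
      · exact ⟨Or.inl h1, h2, by linarith⟩
  have hc : ∀ s : ℝ, R ≤ |s| → |s| ≤ S → ContinuousAt (fun s : ℝ => g s) s := fun s h1 h2 =>
    ContinuousAt.comp (f := fun u : ℝ => (u : ℂ))
      (hg (s : ℂ) (by simpa using h1) (by simpa using h2) (by simp)).continuousAt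
      Complex.continuous_ofReal.continuousAt
  have hi1 : IntegrableOn (fun s : ℝ => g s) (Set.Icc (-S) (-R)) :=
    ContinuousOn.integrableOn_Icc fun s hs => (hc s
      ((by linarith [hs.2] : R ≤ -s).trans (neg_le_abs s))
      (abs_le.2 ⟨hs.1, by linarith [hs.2]⟩)).continuousWithinAt
  have hi2 : IntegrableOn (fun s : ℝ => g s) (Set.Icc R S) :=
    ContinuousOn.integrableOn_Icc fun s hs => (hc s (hs.1.trans (le_abs_self s))
      (abs_le.2 ⟨by linarith [hs.1], hs.2⟩)).continuousWithinAt
  rw [hset]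
  refine ⟨(hi1.mono_set Set.Ioc_subset_Icc_self).union (hi2.mono_set Set.Ico_subset_Icc_self), ?_⟩
  rw [setIntegral_union (by
      rw [Set.disjoint_left]
      intro s h1 h2
      linarith [h1.2, h2.1]) measurableSet_Ico (hi1.mono_set Set.Ioc_subset_Icc_self)
      (hi2.mono_set Set.Ico_subset_Icc_self), integral_Ico_eq_integral_Ioc,
      ← intervalIntegral.integral_of_le hRS, ← intervalIntegral.integral_of_le (by linarith),
      add_comm]
  congr 1
  have := intervalIntegral.integral_comp_neg (a := R) (b := S) (fun s : ℝ => g s)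
  rw [← this]
  simp

/-- For a rational function, growth along the real axis already determines the difference of the
degrees of numerator and denominator, hence the growth in all complex directions. -/
theorem isBigO_cobounded_of_rational {f : ℂ → ℂ} {P Q : Polynomial ℂ} (hQ : Q ≠ 0)
    (hf : ∀ z, Q.eval z ≠ 0 → f z = P.eval z / Q.eval z) {m : ℕ} {C ρ : ℝ}
    (hr : ∀ s : ℝ, ρ ≤ |s| → ‖f s‖ ≤ C * |s| ^ m) :
    f =O[Bornology.cobounded ℂ] fun z => z ^ m := by
  have hroots : ∀ᶠ z in Bornology.cobounded ℂ, Q.eval z ≠ 0 := by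
    have : (Q.roots.toFinset : Set ℂ).Finite := Finset.finite_toSet _
    have h := Bornology.isBounded_def.1 this.isBounded
    filter_upwards [h] with z hz h
    exact hz (by simp [hQ, h])
  have hP : P.eval =O[Bornology.cobounded ℂ] (Q * Polynomial.X ^ m).eval := by
    by_contra hcon
    have hdeg : (Q * Polynomial.X ^ m).degree < P.degree := by
      by_contra hd
      exact hcon (Polynomial.isBigO_cobounded_of_degree_le (not_lt.1 hd))
    -- If `deg P > deg Q + m`, then `Q z^m` is eventually smaller than `P / (2(|C| + 1))`. At a
    -- large real point the assumed bound `|P| ≤ C |s|^m |Q|` would then give `2(|C| + 1) ≤ |C|`.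
    have ho := Polynomial.isLittleO_cobounded_of_degree_lt hdeg
    have ho2 := ho.bound (show (0 : ℝ) < (2 * (|C| + 1))⁻¹ by positivity)
    have hreal : Tendsto (fun s : ℝ => (s : ℂ)) atTop (Bornology.cobounded ℂ) := by
      rw [← tendsto_norm_atTop_iff_cobounded]
      simpa using tendsto_abs_atTop_atTop
    obtain ⟨s, ⟨h1, h2⟩, h3, h4⟩ := (((hreal.eventually ho2).and (hreal.eventually hroots)).and
      ((eventually_ge_atTop ρ).and (eventually_gt_atTop 0))).exists
    have h5 := hr s (h3.trans (le_abs_self s))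
    rw [hf _ h2, norm_div, div_le_iff₀ (norm_pos_iff.2 h2)] at h5
    simp only [Polynomial.eval_mul, Polynomial.eval_pow, Polynomial.eval_X, norm_mul, norm_pow,
      Complex.norm_real, Real.norm_eq_abs] at h1
    have hq : 0 < ‖Q.eval (s : ℂ)‖ * |s| ^ m := by
      have := norm_pos_iff.2 h2
      have : 0 < |s| := abs_pos.2 h4.ne'
      positivity
    have h6 : C * |s| ^ m * ‖Q.eval (s : ℂ)‖ ≤ |C| * (‖Q.eval (s : ℂ)‖ * |s| ^ m) := by
      have := le_abs_self C
      calc C * |s| ^ m * ‖Q.eval (s : ℂ)‖ = C * (‖Q.eval (s : ℂ)‖ * |s| ^ m) := by ring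
        _ ≤ _ := mul_le_mul_of_nonneg_right this hq.le
    rw [inv_mul_eq_div, le_div_iff₀ (by positivity)] at h1
    nlinarith [abs_nonneg C]
  have h2 : f =ᶠ[Bornology.cobounded ℂ] fun z => P.eval z * (Q.eval z)⁻¹ :=
    hroots.mono fun z hz => by rw [hf z hz, div_eq_mul_inv]
  refine h2.trans_isBigO ?_
  refine (hP.mul (Asymptotics.isBigO_refl (fun z => (Q.eval z)⁻¹) _)).trans ?_
  refine Filter.EventuallyEq.isBigO ?_
  filter_upwards [hroots] with z hz
  simp only [Polynomial.eval_mul, Polynomial.eval_pow, Polynomial.eval_X]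
  field_simp

end Contours

/-! ### Coordinates and brackets -/

section Brackets

variable {d : ℕ}

theorem one_le_bracket {n : ℕ} (x : E n) : 1 ≤ bracket x :=
  Real.one_le_sqrt.2 (by nlinarith [sq_nonneg ‖x‖])

theorem bracket_pos {n : ℕ} (x : E n) : 0 < bracket x := one_pos.trans_le (one_le_bracket x)

theorem bracket_sq {n : ℕ} (x : E n) : bracket x ^ 2 = 1 + ‖x‖ ^ 2 :=
  Real.sq_sqrt (by positivity)

theorem norm_le_bracket {n : ℕ} (x : E n) : ‖x‖ ≤ bracket x :=
  Real.le_sqrt_of_sq_le (by linarith)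

theorem bracket_le {n : ℕ} (x : E n) : bracket x ≤ 1 + ‖x‖ :=
  Real.sqrt_le_iff.2 ⟨by positivity, by nlinarith [norm_nonneg x]⟩

theorem continuous_bracket {n : ℕ} : Continuous (bracket : E n → ℝ) := by
  unfold bracket; fun_prop

@[simp] theorem glue_last (ξ : E d) (s : ℝ) : glue ξ s (Fin.last d) = s := by
  simp [glue]

@[simp] theorem glue_castSucc (ξ : E d) (s : ℝ) (i : Fin d) : glue ξ s i.castSucc = ξ i := by
  simp [glue]

@[simp] theorem tang_glue (ξ : E d) (s : ℝ) : tang (glue ξ s) = ξ := by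
  ext i
  simp [tang]

@[simp] theorem glue_tang (ξ : E (d + 1)) : glue (tang ξ) (ξ (Fin.last d)) = ξ := by
  ext i
  refine Fin.lastCases ?_ (fun i => ?_) i <;> simp [tang]

theorem norm_glue_sq (ξ : E d) (s : ℝ) : ‖glue ξ s‖ ^ 2 = ‖ξ‖ ^ 2 + s ^ 2 := by
  simp [EuclideanSpace.norm_sq_eq, Fin.sum_univ_castSucc]

theorem bracket_glue_sq (ξ : E d) (s : ℝ) : bracket (glue ξ s) ^ 2 = bracket ξ ^ 2 + s ^ 2 := by
  rw [bracket_sq, bracket_sq, norm_glue_sq]; ring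

theorem bracket_le_bracket_glue (ξ : E d) (s : ℝ) : bracket ξ ≤ bracket (glue ξ s) := by
  refine le_of_sq_le_sq ?_ (bracket_pos _).le
  rw [bracket_glue_sq]; nlinarith [sq_nonneg s]

theorem abs_le_bracket_glue (ξ : E d) (s : ℝ) : |s| ≤ bracket (glue ξ s) := by
  refine le_of_sq_le_sq ?_ (bracket_pos _).le
  rw [bracket_glue_sq, sq_abs]; nlinarith [sq_nonneg (bracket ξ)]

theorem bracket_glue_le (ξ : E d) (s : ℝ) : bracket (glue ξ s) ≤ bracket ξ + |s| := by
  refine le_of_sq_le_sq ?_ (add_nonneg (bracket_pos _).le (abs_nonneg _))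
  rw [bracket_glue_sq, ← sq_abs s]; nlinarith [abs_nonneg s, bracket_pos ξ]

theorem glue_eq (ξ : E d) (s : ℝ) : glue ξ s = bdryIncl d ξ + s • unitVec (Fin.last d) := by
  ext i
  refine Fin.lastCases ?_ (fun i => ?_) i <;> simp [bdryIncl, unitVec]

theorem bdryIncl_unitVec (i : Fin d) : bdryIncl d (unitVec i) = unitVec i.castSucc := by
  ext k
  refine Fin.lastCases ?_ (fun k => ?_) k <;>
    simp [bdryIncl, unitVec, (Fin.castSucc_ne_last i).symm]

theorem continuous_glue : Continuous fun p : E d × ℝ => glue p.1 p.2 := by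
  simp only [glue_eq]
  exact ((bdryIncl d).continuous.comp continuous_fst).add (continuous_snd.smul continuous_const)

theorem mlen_snoc_zero (α : Fin d → ℕ) : mlen (Fin.snoc (α := fun _ => ℕ) α 0) = mlen α := by
  simp [mlen, Fin.sum_univ_castSucc]

theorem mfac_snoc_zero (α : Fin d → ℕ) : mfac (Fin.snoc (α := fun _ => ℕ) α 0) = mfac α := by
  simp [mfac, Fin.prod_univ_castSucc]

theorem one_le_mfac {n : ℕ} (α : Fin n → ℕ) : 1 ≤ mfac α :=
  Finset.one_le_prod' fun i _ => Nat.factorial_pos (α i)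

end Brackets

/-! ### Functions of `(x, ξ')` -/

section Families

variable {d : ℕ}

/-- The space of the variables `(x, ξ')`. -/
abbrev XV (d : ℕ) : Type := E (d + 1) × E d

/-- The word of directions of `∂_x^β ∂_{ξ'}^α`. -/
def wordV (β : Fin (d + 1) → ℕ) (α : Fin d → ℕ) : List (XV d) :=
  word (fun i => (unitVec i, 0)) β ++ word (fun i => (0, unitVec i)) α

theorem dXXi_eq_dList {n : ℕ} (β α : Fin n → ℕ) (f : E n × E n → ℂ) :
    dXXi β α f = dList (word (fun i => (unitVec i, 0)) β ++ word (fun i => (0, unitVec i)) α) f := by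
  rw [dXXi, dMulti_eq_dList, dMulti_eq_dList, dList_append]

theorem dXXiC_eq_dList (β α : Fin (d + 1) → ℕ) (f : E (d + 1) × E d × ℂ → ℂ) :
    dXXiC β α f = dList (word (fun i => (unitVec i, 0, 0)) β ++ word xiDir α) f := by
  rw [dXXiC, dMulti_eq_dList, dMulti_eq_dList, dList_append]

/-- The function `(x, ξ') ↦ a(x, (ξ', s))`. -/
def lineFam (a : E (d + 1) × E (d + 1) → ℂ) (s : ℝ) : XV d → ℂ := fun p => a (p.1, glue p.2 s)

/-- The function `(x, ξ') ↦ b(x, ξ', z)`. -/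
def compFam (b : E (d + 1) × E d × ℂ → ℂ) (z : ℂ) : XV d → ℂ := fun p => b (p.1, p.2, z)

theorem lineFam_realRestrict (b : E (d + 1) × E d × ℂ → ℂ) (s : ℝ) :
    lineFam (realRestrict b) s = compFam b s := by
  ext p
  simp [lineFam, realRestrict, compFam]

/-- The linear part of `(x, ξ') ↦ (x, (ξ', s))`. -/
def lineMap (d : ℕ) : XV d →L[ℝ] E (d + 1) × E (d + 1) :=
  (ContinuousLinearMap.id ℝ _).prodMap (bdryIncl d).toContinuousLinearMap

/-- The linear part of `(x, ξ') ↦ (x, ξ', z)`. -/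
def compMap (d : ℕ) : XV d →L[ℝ] E (d + 1) × E d × ℂ :=
  (ContinuousLinearMap.id ℝ _).prodMap (ContinuousLinearMap.inl ℝ (E d) ℂ)

theorem lineMap_add (p : XV d) (s : ℝ) :
    lineMap d p + (0, s • unitVec (Fin.last d)) = (p.1, glue p.2 s) := by
  rw [glue_eq]
  ext <;> simp [lineMap]

theorem compMap_add (p : XV d) (z : ℂ) : compMap d p + (0, 0, z) = (p.1, p.2, z) := by
  ext <;> simp [compMap]

theorem lineFam_eq (a : E (d + 1) × E (d + 1) → ℂ) (s : ℝ) :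
    lineFam a s = fun p => a (lineMap d p + (0, s • unitVec (Fin.last d))) := by
  ext p
  rw [lineMap_add, lineFam]

theorem compFam_eq (b : E (d + 1) × E d × ℂ → ℂ) (z : ℂ) :
    compFam b z = fun p => b (compMap d p + (0, 0, z)) := by
  ext p
  rw [compMap_add, compFam]

theorem contDiffAt_lineFam {a : E (d + 1) × E (d + 1) → ℂ} {s : ℝ} {p : XV d} {n : ℕ∞}
    (ha : ContDiffAt ℝ n a (p.1, glue p.2 s)) : ContDiffAt ℝ n (lineFam a s) p := by
  rw [lineFam_eq]
  rw [← lineMap_add] at ha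
  exact ha.comp p (f := fun p => lineMap d p + (0, s • unitVec (Fin.last d)))
    ((lineMap d).contDiff.add contDiff_const).contDiffAt

theorem contDiffAt_compFam {b : E (d + 1) × E d × ℂ → ℂ} {z : ℂ} {p : XV d} {n : ℕ∞}
    (hb : ContDiffAt ℝ n b (p.1, p.2, z)) : ContDiffAt ℝ n (compFam b z) p := by
  rw [compFam_eq]
  rw [← compMap_add] at hb
  exact hb.comp p (f := fun p => compMap d p + (0, 0, z))
    ((compMap d).contDiff.add contDiff_const).contDiffAt

theorem dList_lineFam {a : E (d + 1) × E (d + 1) → ℂ} {s : ℝ} {p : XV d} (L : List (XV d))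
    (ha : ContDiffAt ℝ (L.length : ℕ∞) a (p.1, glue p.2 s)) :
    dList L (lineFam a s) p = dList (L.map (lineMap d)) a (p.1, glue p.2 s) := by
  rw [← lineMap_add] at ha ⊢
  rw [lineFam_eq, dList_comp_affine _ _ _ ha]

theorem dList_compFam {b : E (d + 1) × E d × ℂ → ℂ} {z : ℂ} {p : XV d} (L : List (XV d))
    (hb : ContDiffAt ℝ (L.length : ℕ∞) b (p.1, p.2, z)) :
    dList L (compFam b z) p = dList (L.map (compMap d)) b (p.1, p.2, z) := by
  rw [← compMap_add] at hb ⊢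
  rw [compFam_eq, dList_comp_affine _ _ _ hb]

theorem dList_wordV_lineFam {a : E (d + 1) × E (d + 1) → ℂ} {s : ℝ} {p : XV d}
    (β : Fin (d + 1) → ℕ) (α : Fin d → ℕ) (ha : ContDiffAt ℝ ∞ a (p.1, glue p.2 s)) :
    dList (wordV β α) (lineFam a s) p =
      dXXi β (Fin.snoc (α := fun _ => ℕ) α 0) a (p.1, glue p.2 s) := by
  rw [dList_lineFam _ (contDiffAt_infty.1 ha _), dXXi_eq_dList, word_snoc, wordV, List.map_append,
    map_word, map_word]
  simp [lineMap, bdryIncl_unitVec]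

theorem dList_wordV_compFam {b : E (d + 1) × E d × ℂ → ℂ} {z : ℂ} {p : XV d}
    (β : Fin (d + 1) → ℕ) (α : Fin d → ℕ) (hb : ContDiffAt ℝ ∞ b (p.1, p.2, z)) :
    dList (wordV β α) (compFam b z) p =
      dXXiC β (Fin.snoc (α := fun _ => ℕ) α 0) b (p.1, p.2, z) := by
  rw [dList_compFam _ (contDiffAt_infty.1 hb _), dXXiC_eq_dList, word_snoc, wordV, List.map_append,
    map_word, map_word]
  simp [compMap, xiDir]

/-- Gevrey type symbol estimates of order `(m, m₂)`, with weight `wt` in place of `⟨ξ⟩`, for a family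
`f` of functions of `(x, ξ')`. -/
def GevOn {Ω : Type} (μ ν m₂ m : ℝ) (S : Set (Ω × XV d)) (wt : Ω × XV d → ℝ)
    (f : Ω → XV d → ℂ) : Prop :=
  ∃ C > (0 : ℝ), ∃ D ≥ (1 : ℝ), ∀ q ∈ S, ∀ (β : Fin (d + 1) → ℕ) (α : Fin d → ℕ),
    ‖dList (wordV β α) (f q.1) q.2‖ ≤ C * D ^ (mlen α + mlen β) * (mfac α : ℝ) ^ μ *
      (mfac β : ℝ) ^ ν * wt q ^ (m - mlen α) * bracket q.2.1 ^ (m₂ - mlen β)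

end Families

/-! ### Consequences of Assumption (A) -/

section Splitting

variable {d : ℕ}

/-- The part of Assumption (A) that concerns the sum `b` of the first `M` terms of the expansion
and the remainder `a - b`, with one radius `B` for all estimates. -/
structure Splitting (μ ν : ℝ) (m₁ : ℤ) (m₂ : ℝ) (B r : ℝ) (M : ℕ)
    (a : E (d + 1) × E (d + 1) → ℂ) (b : E (d + 1) × E d × ℂ → ℂ) : Prop where
  real_smooth : ∀ (x : E (d + 1)) (ξ' : E d) (s : ℝ), B ≤ |s| →
    ContDiffAt ℝ ∞ (realRestrict b) (x, glue ξ' s)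
  circle_smooth : ∀ (x : E (d + 1)) (ξ' : E d) (z : ℂ), ‖z‖ = B * bracket ξ' →
    ContDiffAt ℝ ∞ b (x, ξ', z)
  holomorphic : ∀ (x : E (d + 1)) (ξ' : E d) (z : ℂ), r * bracket ξ' < ‖z‖ →
    DifferentiableAt ℂ (fun z => b (x, ξ', z)) z
  growth : ∀ (x : E (d + 1)) (ξ' : E d),
    (fun z => b (x, ξ', z)) =O[Bornology.cobounded ℂ] fun z => z ^ m₁.toNat
  circle_bound : GevOn μ ν m₂ m₁ {q : ℂ × XV d | ‖q.1‖ = B * bracket q.2.2}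
    (fun q => bracket q.2.2) (compFam b)
  rem_bound : GevOn μ ν m₂ ((m₁ : ℝ) - M) {q : ℝ × XV d | B ≤ |q.1|}
    (fun q => bracket (glue q.2.2 q.1)) (lineFam fun p => a p - realRestrict b p)

/-- For a fixed index `j`, the `j`-dependence of an estimate of Assumption (A) is a constant, the
extra decay can be dropped because the brackets are at least one, and `α! ≤ (α!)^μ`. What is left is
the estimate of an SG symbol of the leading order. -/
theorem term_le {C D μ ν m₁ m₂ X Y : ℝ} (hμ : 1 ≤ μ) (hC : 0 ≤ C) (hD : 0 ≤ D) (hX : 1 ≤ X)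
    (hY : 1 ≤ Y) (n j : ℕ) {p q : ℕ} (hp : 1 ≤ p) (s t : ℕ) :
    C * D ^ (n + 2 * j) * ((j.factorial * q : ℕ) : ℝ) ^ ν * p * X ^ (m₂ - j - t) *
        Y ^ (m₁ - j - s) ≤
      C * D ^ (2 * j) * (j.factorial : ℝ) ^ ν *
        (D ^ n * (p : ℝ) ^ μ * (q : ℝ) ^ ν * Y ^ (m₁ - s) * X ^ (m₂ - t)) := by
  have h1 : (p : ℝ) ≤ (p : ℝ) ^ μ := by
    conv_lhs => rw [← Real.rpow_one (p : ℝ)]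
    exact Real.rpow_le_rpow_of_exponent_le (by exact_mod_cast hp) hμ
  have h2 : X ^ (m₂ - j - t) ≤ X ^ (m₂ - t) :=
    Real.rpow_le_rpow_of_exponent_le hX (by linarith [(Nat.cast_nonneg j : (0 : ℝ) ≤ j)])
  have h3 : Y ^ (m₁ - j - s) ≤ Y ^ (m₁ - s) :=
    Real.rpow_le_rpow_of_exponent_le hY (by linarith [(Nat.cast_nonneg j : (0 : ℝ) ≤ j)])
  rw [Nat.cast_mul, Real.mul_rpow (by positivity) (by positivity), pow_add]
  have hX0 : 0 < X := by linarith
  have hY0 : 0 < Y := by linarith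
  calc C * (D ^ n * D ^ (2 * j)) * ((j.factorial : ℝ) ^ ν * (q : ℝ) ^ ν) * p * X ^ (m₂ - j - t) *
        Y ^ (m₁ - j - s)
      ≤ C * (D ^ n * D ^ (2 * j)) * ((j.factorial : ℝ) ^ ν * (q : ℝ) ^ ν) * (p : ℝ) ^ μ *
        X ^ (m₂ - t) * Y ^ (m₁ - s) := by gcongr
    _ = _ := by ring

/-- Substituting the numbers `ξ'_i` and one indeterminate for `z` turns the multivariate quotient
into a quotient of polynomials in `z`. Its denominator is nonzero because `IsRationalInXi` excludes
vanishing on a whole line `ξ' = const`. -/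
theorem analytic_growth {b : E (d + 1) × E d × ℂ → ℂ} (hb : IsRationalInXi b) (x : E (d + 1))
    (ξ' : E d) {m : ℕ} {C ρ : ℝ} (hr : ∀ s : ℝ, ρ ≤ |s| → ‖b (x, ξ', s)‖ ≤ C * |s| ^ m) :
    (fun z => b (x, ξ', z)) =O[Bornology.cobounded ℂ] fun z => z ^ m := by
  obtain ⟨P, Q, hPQ⟩ := hb x
  obtain ⟨⟨z₀, hz₀⟩, hev⟩ := hPQ ξ'
  set g : Fin (d + 1) → Polynomial ℂ :=
    Fin.snoc (α := fun _ => Polynomial ℂ) (fun i => Polynomial.C (ξ' i : ℂ)) Polynomial.X with hg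
  have hgz : ∀ z : ℂ, (fun i => Polynomial.aeval z (g i)) =
      Fin.snoc (α := fun _ => ℂ) (fun i => (ξ' i : ℂ)) z := by
    intro z
    ext i
    refine Fin.lastCases ?_ (fun i => ?_) i <;> simp [hg]
  have heval : ∀ (R : MvPolynomial (Fin (d + 1)) ℂ) (z : ℂ),
      (MvPolynomial.aeval g R).eval z =
        MvPolynomial.eval (Fin.snoc (α := fun _ => ℂ) (fun i => (ξ' i : ℂ)) z) R := by
    intro R z
    rw [← hgz, ← MvPolynomial.coe_aeval_eq_eval, ← Polynomial.coe_aeval_eq_eval]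
    exact (AlgHom.congr_fun (MvPolynomial.comp_aeval g (Polynomial.aeval z)) R)
  refine isBigO_cobounded_of_rational (P := MvPolynomial.aeval g P) (Q := MvPolynomial.aeval g Q)
    ?_ ?_ hr
  · intro h
    apply hz₀
    rw [← heval, h, Polynomial.eval_zero]
  · intro z hz
    rw [heval] at hz
    rw [heval, heval]
    exact hev z hz

/-- The approximation is the partial sum of the expansion; the radii `B` and `r` do not depend on
its length `M`. The remainder estimate also has to be extended to the bounded region that condition
3) leaves out. -/
theorem exists_splitting {μ ν : ℝ} (hμ : 1 < μ) {m₁ : ℤ} {m₂ : ℝ}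
    {a : E (d + 1) × E (d + 1) → ℂ} (ha : IsSGSymbol μ ν m₁ m₂ a)
    (hA : AssumptionA μ ν m₁ m₂ a) :
    ∃ B > (0 : ℝ), ∃ r > (0 : ℝ), r < B ∧ ∀ M : ℕ, ∃ b, Splitting μ ν m₁ m₂ B r M a b := by
  obtain ⟨b, C, hC, D, hD, B, hB, r, hr, hrB, hrat, h1, h2, h2', h3⟩ := hA
  obtain ⟨has, Ca, hCa, Da, hDa, hab⟩ := ha
  refine ⟨B, hB, r, hr, hrB, fun M => ⟨fun p => ∑ j ∈ Finset.range M, b j p, ?_⟩⟩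
  have hlen : ∀ (x : E (d + 1)) (ξ' : E d) (s : ℝ), B ≤ |s| → B ≤ pairLen x (glue ξ' s) := by
    intro x ξ' s hs
    refine hs.trans (Real.le_sqrt_of_sq_le ?_)
    rw [norm_glue_sq, sq_abs]
    nlinarith [sq_nonneg ‖x‖, sq_nonneg ‖ξ'‖]
  have hcirc : ∀ (ξ' : E d) (z : ℂ), ‖z‖ = B * bracket ξ' →
      ∃ θ : ℝ, z = ((B * bracket ξ' : ℝ) : ℂ) * Complex.exp (Complex.I * (θ : ℂ)) := by
    intro ξ' z hz
    refine ⟨z.arg, ?_⟩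
    rw [← hz, mul_comm Complex.I, Complex.norm_mul_exp_arg_mul_I]
  have hcs : ∀ j (x : E (d + 1)) (ξ' : E d) (z : ℂ), ‖z‖ = B * bracket ξ' →
      ContDiffAt ℝ ∞ (b j) (x, ξ', z) := by
    intro j x ξ' z hz
    obtain ⟨θ, rfl⟩ := hcirc ξ' z hz
    exact (h2' j x ξ' θ).1
  have hrs : realRestrict (fun p => ∑ j ∈ Finset.range M, b j p) =
      fun p => ∑ j ∈ Finset.range M, realRestrict (b j) p := rfl
  set c : ℕ → ℝ := fun j => C * D ^ (2 * j) * (j.factorial : ℝ) ^ ν with hc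
  have hc0 : ∀ j, 0 ≤ c j := fun j => by positivity
  have hsum0 : 0 ≤ ∑ j ∈ Finset.range M, c j := Finset.sum_nonneg fun j _ => hc0 j
  refine ⟨?_, ?_, ?_, ?_, ?_, ?_⟩
  · intro x ξ' s hs
    rw [hrs]
    exact ContDiffAt.sum fun j _ => (h1 j x _ (hlen x ξ' s hs)).1
  · intro x ξ' z hz
    exact ContDiffAt.sum fun j _ => hcs j x ξ' z hz
  · intro x ξ' z hz
    refine DifferentiableAt.fun_sum fun j _ => ?_
    refine AnalyticAt.differentiableAt ?_
    by_contra hcon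
    exact absurd (h2 j x ξ' z hcon).1 (not_le.2 hz)
  · intro x ξ'
    refine Asymptotics.IsBigO.fun_sum (A := fun j z => b j (x, ξ', z)) (s := Finset.range M)
      (g := fun z : ℂ => z ^ m₁.toNat) fun j _ => ?_
    -- For `|s| ≥ ⟨ξ'⟩` one has `⟨(ξ', s)⟩ ≤ 2|s|`, which is where the power of two comes from; `|s|
    -- ≥ B` makes condition 1) available.
    refine analytic_growth (hrat j) x ξ' (ρ := max B (bracket ξ'))
      (C := C * D ^ (2 * j) * (j.factorial : ℝ) ^ ν * bracket x ^ (m₂ - j) * 2 ^ m₁.toNat) ?_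
    intro s hs
    have h := (h1 j x (glue ξ' s) (hlen x ξ' s ((le_max_left _ _).trans hs))).2 0 0
    have e : realRestrict (b j) (x, glue ξ' s) = b j (x, ξ', s) := by simp [realRestrict]
    rw [dXXi_eq_dList, word_zero, word_zero, List.nil_append, dList_nil, e] at h
    refine h.trans ?_
    have hbr : bracket (glue ξ' s) ^ ((m₁ : ℝ) - j - (mlen (0 : Fin (d + 1) → ℕ) : ℕ)) ≤
        2 ^ m₁.toNat * |s| ^ m₁.toNat := by
      rw [← mul_pow]
      have h5 : bracket (glue ξ' s) ≤ 2 * |s| :=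
        (bracket_glue_le ξ' s).trans (by linarith [(le_max_right _ _).trans hs])
      refine le_trans ?_ (pow_le_pow_left₀ (bracket_pos _).le h5 _)
      rw [← Real.rpow_natCast]
      refine Real.rpow_le_rpow_of_exponent_le (one_le_bracket _) ?_
      have h6 : (m₁ : ℝ) ≤ (m₁.toNat : ℝ) := by exact_mod_cast Int.self_le_toNat m₁
      have h7 : (0 : ℝ) ≤ ((mlen (0 : Fin (d + 1) → ℕ) : ℕ) : ℝ) := Nat.cast_nonneg _
      linarith [(Nat.cast_nonneg j : (0 : ℝ) ≤ j)]
    have e0 : mlen (0 : Fin (d + 1) → ℕ) = 0 := by simp [mlen]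
    have e1 : mfac (0 : Fin (d + 1) → ℕ) = 1 := by simp [mfac]
    rw [e0] at hbr ⊢
    rw [e1]
    simp only [Nat.cast_zero, sub_zero, add_zero, zero_add, mul_one, Nat.cast_one] at hbr ⊢
    have := Real.rpow_nonneg (bracket_pos x).le (m₂ - j)
    calc _ ≤ C * D ^ (2 * j) * (j.factorial : ℝ) ^ ν * bracket x ^ (m₂ - j) *
          (2 ^ m₁.toNat * |s| ^ m₁.toNat) := mul_le_mul_of_nonneg_left hbr (by positivity)
      _ = _ := by ring
  · refine ⟨∑ j ∈ Finset.range M, c j + 1, by linarith, max D 1, le_max_right _ _, ?_⟩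
    rintro ⟨z, x, ξ'⟩ hz β α
    simp only [Set.mem_ofPred_eq] at hz
    simp only
    rw [dList_wordV_compFam β α (ContDiffAt.sum fun j _ => hcs j x ξ' z hz), dXXiC_eq_dList,
      dList_sum _ _ fun j _ => contDiffAt_infty.1 (hcs j x ξ' z hz) _]
    set W := (max D 1) ^ (mlen α + mlen β) * (mfac α : ℝ) ^ μ * (mfac β : ℝ) ^ ν *
      bracket ξ' ^ ((m₁ : ℝ) - mlen α) * bracket x ^ (m₂ - mlen β) with hW
    have hW0 : 0 ≤ W := by
      have := (bracket_pos ξ').le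
      have := (bracket_pos x).le
      positivity
    have hb : ∀ j ∈ Finset.range M, ‖dList (word (fun i => (unitVec i, 0, 0)) β ++
        word xiDir (Fin.snoc (α := fun _ => ℕ) α 0)) (b j) (x, ξ', z)‖ ≤ c j * W := by
      intro j _
      obtain ⟨θ, rfl⟩ := hcirc ξ' z hz
      have h := (h2' j x ξ' θ).2 (Fin.snoc (α := fun _ => ℕ) α 0) β
      rw [dXXiC_eq_dList, mlen_snoc_zero, mfac_snoc_zero] at h
      refine h.trans ((term_le hμ.le hC.le hD.le (one_le_bracket x) (one_le_bracket ξ') _ j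
        (one_le_mfac α) _ _).trans (mul_le_mul_of_nonneg_left ?_ (hc0 j)))
      have := (bracket_pos ξ').le
      have := (bracket_pos x).le
      rw [hW]
      gcongr
      exact le_max_left _ _
    refine (norm_sum_le _ _).trans ((Finset.sum_le_sum hb).trans ?_)
    calc ∑ j ∈ Finset.range M, c j * W
        = (∑ j ∈ Finset.range M, c j) * W := by rw [Finset.sum_mul]
      _ ≤ (∑ j ∈ Finset.range M, c j + 1) * W := by nlinarith
      _ = _ := by rw [hW]; ring
  · set κ : ℝ := B * (M : ℝ) ^ (μ + ν - 1) with hκ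
    have hκ0 : 0 ≤ κ := by positivity
    set K₁ : ℝ := C * D ^ (2 * M) * (M.factorial : ℝ) ^ (μ + ν - 1) with hK₁
    set K₂ : ℝ := (Ca + ∑ j ∈ Finset.range M, c j) * κ ^ M with hK₂
    have hK₁0 : 0 < K₁ := by positivity
    have hK₂0 : 0 ≤ K₂ := by positivity
    set D' := max (max D Da) 1 with hD'
    have hDD : D ≤ D' := (le_max_left _ _).trans (le_max_left _ _)
    have hDaD : Da ≤ D' := (le_max_right _ _).trans (le_max_left _ _)
    refine ⟨K₁ + K₂, by linarith, D', le_max_right _ _, ?_⟩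
    rintro ⟨s, x, ξ'⟩ hs β α
    simp only [Set.mem_ofPred_eq] at hs
    simp only
    set ξ := glue ξ' s with hξ
    have hp := hlen x ξ' s hs
    have hsm : ContDiffAt ℝ ∞ (realRestrict fun p => ∑ j ∈ Finset.range M, b j p) (x, ξ) := by
      rw [hrs]
      exact ContDiffAt.sum fun j _ => (h1 j x _ hp).1
    have hbx := bracket_pos x
    have hbξ := bracket_pos ξ
    rw [dList_wordV_lineFam β α (has.contDiffAt.sub hsm)]
    set W := D' ^ (mlen α + mlen β) * (mfac α : ℝ) ^ μ * (mfac β : ℝ) ^ ν *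
      bracket ξ ^ ((m₁ : ℝ) - M - mlen α) * bracket x ^ (m₂ - mlen β) with hW
    have hW0 : 0 ≤ W := by positivity
    suffices h : ‖dXXi β (Fin.snoc (α := fun _ => ℕ) α 0) (fun p => a p -
        realRestrict (fun p => ∑ j ∈ Finset.range M, b j p) p) (x, ξ)‖ ≤ (K₁ + K₂) * W by
      refine h.trans (le_of_eq ?_)
      rw [hW]; ring
    -- Above the threshold `κ` condition 3) applies. Below it `⟨ξ⟩ ≤ κ`, so `1 ≤ κ^M ⟨ξ⟩^(-M)`: the
    -- symbol and the finitely many terms, estimated separately with order `m₁`, satisfy the bound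
    -- of order `m₁ - M` at the price of the constant `κ^M`.
    rcases le_or_gt κ (max (bracket x) (bracket ξ)) with hcase | hcase
    · have h := (h3 M x ξ hcase).2 (Fin.snoc (α := fun _ => ℕ) α 0) β
      rw [mlen_snoc_zero, mfac_snoc_zero] at h
      rw [hrs]
      refine h.trans (le_trans ?_ (mul_le_mul_of_nonneg_right (by linarith : K₁ ≤ K₁ + K₂) hW0))
      have hx : bracket x ^ (m₂ - M - mlen β) ≤ bracket x ^ (m₂ - mlen β) :=
        Real.rpow_le_rpow_of_exponent_le (one_le_bracket x)
          (by linarith [(Nat.cast_nonneg M : (0 : ℝ) ≤ M)])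
      calc _ ≤ C * (D' ^ (mlen α + mlen β) * D ^ (2 * M)) * (mfac α : ℝ) ^ μ * (mfac β : ℝ) ^ ν *
            (M.factorial : ℝ) ^ (μ + ν - 1) * bracket x ^ (m₂ - mlen β) *
            bracket ξ ^ ((m₁ : ℝ) - M - mlen α) := by
              rw [pow_add]
              gcongr
        _ = _ := by rw [hW, hK₁]; ring
    · have hκξ : bracket ξ ≤ κ := (le_max_right _ _).trans hcase.le
      set W' := D' ^ (mlen α + mlen β) * (mfac α : ℝ) ^ μ * (mfac β : ℝ) ^ ν *
        bracket ξ ^ ((m₁ : ℝ) - mlen α) * bracket x ^ (m₂ - mlen β) with hW'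
      have hW'0 : 0 ≤ W' := by positivity
      have hWW : W' ≤ κ ^ M * W := by
        have : bracket ξ ^ ((m₁ : ℝ) - mlen α) ≤
            κ ^ M * bracket ξ ^ ((m₁ : ℝ) - M - mlen α) := by
          rw [show (m₁ : ℝ) - mlen α = M + ((m₁ : ℝ) - M - mlen α) by ring, Real.rpow_add hbξ,
            Real.rpow_natCast]
          gcongr
        calc W' ≤ D' ^ (mlen α + mlen β) * (mfac α : ℝ) ^ μ * (mfac β : ℝ) ^ ν *
              (κ ^ M * bracket ξ ^ ((m₁ : ℝ) - M - mlen α)) * bracket x ^ (m₂ - mlen β) := by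
                rw [hW']; gcongr
          _ = _ := by rw [hW]; ring
      have hbj : ∀ j ∈ Finset.range M, ‖dXXi β (Fin.snoc (α := fun _ => ℕ) α 0)
          (realRestrict (b j)) (x, ξ)‖ ≤ c j * W' := by
        intro j _
        have h := (h1 j x ξ hp).2 (Fin.snoc (α := fun _ => ℕ) α 0) β
        rw [mlen_snoc_zero, mfac_snoc_zero] at h
        refine h.trans ((term_le hμ.le hC.le hD.le (one_le_bracket x) (one_le_bracket ξ) _ j
          (one_le_mfac α) _ _).trans (mul_le_mul_of_nonneg_left ?_ (hc0 j)))
        rw [hW']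
        gcongr
      have haj : ‖dXXi β (Fin.snoc (α := fun _ => ℕ) α 0) a (x, ξ)‖ ≤ Ca * W' := by
        have h := hab (Fin.snoc (α := fun _ => ℕ) α 0) β x ξ
        rw [mlen_snoc_zero, mfac_snoc_zero] at h
        refine h.trans ?_
        calc _ ≤ Ca * D' ^ (mlen α + mlen β) * (mfac α : ℝ) ^ μ * (mfac β : ℝ) ^ ν *
              bracket ξ ^ ((m₁ : ℝ) - mlen α) * bracket x ^ (m₂ - mlen β) := by gcongr
          _ = _ := by rw [hW']; ring
      have hsplit : dXXi β (Fin.snoc (α := fun _ => ℕ) α 0) (fun p => a p -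
          realRestrict (fun p => ∑ j ∈ Finset.range M, b j p) p) (x, ξ) =
          dXXi β (Fin.snoc (α := fun _ => ℕ) α 0) a (x, ξ) - ∑ j ∈ Finset.range M,
            dXXi β (Fin.snoc (α := fun _ => ℕ) α 0) (realRestrict (b j)) (x, ξ) := by
        simp only [dXXi_eq_dList]
        rw [dList_sub _ (contDiffAt_infty.1 has.contDiffAt _) (contDiffAt_infty.1 hsm _), hrs,
          dList_sum _ _ fun j _ => contDiffAt_infty.1 (h1 j x _ hp).1 _]
      rw [hsplit]
      calc _ ≤ Ca * W' + ∑ j ∈ Finset.range M, c j * W' :=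
            (norm_sub_le _ _).trans (add_le_add haj (norm_sum_le_of_le _ hbj))
        _ = (Ca + ∑ j ∈ Finset.range M, c j) * W' := by rw [add_mul, Finset.sum_mul]
        _ ≤ (Ca + ∑ j ∈ Finset.range M, c j) * (κ ^ M * W) :=
            mul_le_mul_of_nonneg_left hWW (by linarith)
        _ = K₂ * W := by rw [hK₂]; ring
        _ ≤ (K₁ + K₂) * W := mul_le_mul_of_nonneg_right (by linarith) hW0

theorem gevOn_lineFam {μ ν m₁ m₂ : ℝ} {a : E (d + 1) × E (d + 1) → ℂ}
    (ha : IsSGSymbol μ ν m₁ m₂ a) : GevOn μ ν m₂ m₁ (Set.univ : Set (ℝ × XV d))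
      (fun q => bracket (glue q.2.2 q.1)) (lineFam a) := by
  obtain ⟨has, C, hC, D, hD, h⟩ := ha
  refine ⟨C, hC, max D 1, le_max_right _ _, ?_⟩
  rintro ⟨s, x, ξ'⟩ _ β α
  have h := h (Fin.snoc (α := fun _ => ℕ) α 0) β x (glue ξ' s)
  rw [mlen_snoc_zero, mfac_snoc_zero] at h
  simp only
  rw [dList_wordV_lineFam β α has.contDiffAt]
  refine h.trans ?_
  have := bracket_pos x
  have := bracket_pos (glue ξ' s)
  gcongr
  exact le_max_left _ _

end Splitting

/-! ### Multiplication by `iξ_n` and the twisted normal derivative -/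

section Twisting

variable {d : ℕ}

/-- The normal direction in the space of the variables `(x, ξ')`. -/
def enV (d : ℕ) : XV d := (unitVec (Fin.last d), 0)

/-- The operator `∂_v + ic`, which is `∂_v` conjugated by an exponential. -/
def tw {V : Type} [NormedAddCommGroup V] [NormedSpace ℝ V] (v : V) (c : ℂ) (f : V → ℂ) : V → ℂ :=
  fun p => dDir v f p + Complex.I * c * f p

theorem contDiffAt_tw {V : Type} [NormedAddCommGroup V] [NormedSpace ℝ V] (v : V) (c : ℂ)
    {f : V → ℂ} {p : V} (hf : ContDiffAt ℝ ∞ f p) : ContDiffAt ℝ ∞ (tw v c f) p :=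
  (contDiffAt_dDir_infty v hf).add (contDiffAt_const.mul hf)

theorem dList_tw {V : Type} [NormedAddCommGroup V] [NormedSpace ℝ V] (v : V) (c : ℂ)
    (L : List V) {f : V → ℂ} {p : V} (hf : ContDiffAt ℝ ∞ f p) :
    dList L (tw v c f) p = dList (L ++ [v]) f p + Complex.I * c * dList L f p := by
  change dList L (fun q => dDir v f q + Complex.I * c * f q) p = _
  rw [dList_add L (contDiffAt_infty.1 (contDiffAt_dDir_infty v hf) _)
    (contDiffAt_infty.1 (contDiffAt_const.mul hf) _), dList_const_mul, dList_append]
  rfl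

theorem wordV_add_normal_perm (β : Fin (d + 1) → ℕ) (α : Fin d → ℕ) :
    (wordV (β + Pi.single (Fin.last d) 1) α).Perm (wordV β α ++ [enV d]) := by
  have h := word_add_single_perm (fun i => ((unitVec i, 0) : XV d)) β (Fin.last d)
  refine ((h.append_right _).trans ?_).trans (List.perm_append_singleton _ _).symm
  rfl

theorem mlen_add_single {n : ℕ} (β : Fin n → ℕ) (i : Fin n) :
    mlen (β + Pi.single i 1) = mlen β + 1 := by
  simp [mlen, Finset.sum_add_distrib]

/-- Raising one entry costs the factor `β_i + 1 ≤ 2^|β|`. This geometric loss is absorbed by the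
base `D` of a Gevrey estimate. -/
theorem mfac_add_single_le {n : ℕ} (β : Fin n → ℕ) (i : Fin n) :
    mfac (β + Pi.single i 1) ≤ mfac β * 2 ^ mlen β := by
  classical
  have h1 : mfac (β + Pi.single i 1) = mfac β * (β i + 1) := by
    unfold mfac
    rw [← Finset.mul_prod_erase _ _ (Finset.mem_univ i),
      ← Finset.mul_prod_erase _ (fun i => (β i).factorial) (Finset.mem_univ i)]
    have : ∏ k ∈ Finset.univ.erase i, ((β + Pi.single i 1 : Fin n → ℕ) k).factorial =
        ∏ k ∈ Finset.univ.erase i, (β k).factorial := by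
      refine Finset.prod_congr rfl fun k hk => ?_
      simp [(Finset.mem_erase.1 hk).1]
    rw [this]
    simp [Nat.factorial_succ]
    ring
  rw [h1]
  refine Nat.mul_le_mul_left _ ?_
  have h2 : β i ≤ mlen β := Finset.single_le_sum (f := β) (fun _ _ => Nat.zero_le _)
    (Finset.mem_univ i)
  exact (Nat.lt_two_pow_self (n := β i)).trans_le (Nat.pow_le_pow_right (by norm_num) h2)

variable {Ω : Type} {μ ν m₂ m : ℝ} {S : Set (Ω × XV d)} {wt : Ω × XV d → ℝ} {f : Ω → XV d → ℂ}

theorem GevOn.mul (hf : GevOn μ ν m₂ m S wt f) {c : Ω → ℂ} {K : ℝ} (hK : 0 < K)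
    (hc : ∀ q ∈ S, ‖c q.1‖ ≤ K * wt q) (hw : ∀ q ∈ S, 1 ≤ wt q) :
    GevOn μ ν m₂ (m + 1) S wt (fun o p => Complex.I * c o * f o p) := by
  obtain ⟨C, hC, D, hD, h⟩ := hf
  refine ⟨C * K, by positivity, D, hD, fun q hq β α => ?_⟩
  rw [dList_const_mul, norm_mul, norm_mul, Complex.norm_I, one_mul]
  have hw0 : 0 < wt q := one_pos.trans_le (hw q hq)
  have hx := bracket_pos q.2.1
  have hwm : wt q ^ (m + 1 - mlen α) = wt q ^ (m - mlen α) * wt q := by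
    rw [show m + 1 - mlen α = (m - mlen α) + 1 by ring, Real.rpow_add hw0, Real.rpow_one]
  rw [hwm]
  calc _ ≤ K * wt q * (C * D ^ (mlen α + mlen β) * (mfac α : ℝ) ^ μ *
      (mfac β : ℝ) ^ ν * wt q ^ (m - mlen α) * bracket q.2.1 ^ (m₂ - mlen β)) :=
        mul_le_mul (hc q hq) (h q hq β α) (norm_nonneg _) (by positivity)
    _ = _ := by ring

/-- The factor `ic` costs one power of the weight. The derivative `∂_{x_n}` costs only an increase
of `D`, and the gain in `⟨x⟩` that it brings is discarded, so that both terms have the same order.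
-/
theorem GevOn.tw (hν : 0 ≤ ν) (hf : GevOn μ ν m₂ m S wt f) {c : Ω → ℂ} {K : ℝ} (hK : 0 < K)
    (hc : ∀ q ∈ S, ‖c q.1‖ ≤ K * wt q) (hw : ∀ q ∈ S, 1 ≤ wt q)
    (hs : ∀ q ∈ S, ContDiffAt ℝ ∞ (f q.1) q.2) :
    GevOn μ ν m₂ (m + 1) S wt (fun o => tw (enV d) (c o) (f o)) := by
  obtain ⟨C', hC', D', hD', h'⟩ := hf.mul hK hc hw
  obtain ⟨C, hC, D, hD, h⟩ := hf
  have h2 : (1 : ℝ) ≤ 2 ^ ν := Real.one_le_rpow (by norm_num) hν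
  have hE : D ≤ max D D' * 2 ^ ν :=
    (le_max_left _ _).trans (le_mul_of_one_le_right (by positivity) h2)
  have hE' : D' ≤ max D D' * 2 ^ ν :=
    (le_max_right _ _).trans (le_mul_of_one_le_right (by positivity) h2)
  have hD0 : 0 < D := by linarith
  have hD'0 : 0 < D' := by linarith
  refine ⟨C * D + C', by positivity, max D D' * 2 ^ ν, hD.le.trans hE, fun q hq β α => ?_⟩
  have hw0 : 0 < wt q := one_pos.trans_le (hw q hq)
  have hx := bracket_pos q.2.1
  simp only
  rw [dList_tw _ _ _ (hs q hq), add_mul, add_mul, add_mul, add_mul, add_mul]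
  refine (norm_add_le _ _).trans (add_le_add ?_ ?_)
  · have h1 := h q hq (β + Pi.single (Fin.last d) 1) α
    rw [dList_perm (wordV_add_normal_perm β α) (contDiffAt_infty.1 (hs q hq) _)] at h1
    refine h1.trans ?_
    rw [mlen_add_single]
    have e1 : (mfac (β + Pi.single (Fin.last d) 1) : ℝ) ^ ν ≤
        (mfac β : ℝ) ^ ν * (2 ^ ν) ^ (mlen α + mlen β) := by
      calc (mfac (β + Pi.single (Fin.last d) 1) : ℝ) ^ ν ≤ ((mfac β : ℝ) * 2 ^ mlen β) ^ ν :=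
            Real.rpow_le_rpow (by positivity) (by exact_mod_cast mfac_add_single_le β _) hν
        _ = (mfac β : ℝ) ^ ν * (2 ^ ν) ^ mlen β := by
            rw [Real.mul_rpow (by positivity) (by positivity), ← Real.rpow_natCast,
              ← Real.rpow_natCast, ← Real.rpow_mul (by norm_num), ← Real.rpow_mul (by norm_num),
              mul_comm ν]
        _ ≤ _ := by
            gcongr
            omega
    have e2 : wt q ^ (m - mlen α) ≤ wt q ^ (m + 1 - mlen α) :=
      Real.rpow_le_rpow_of_exponent_le (hw q hq) (by linarith)
    have e3 : bracket q.2.1 ^ (m₂ - ((mlen β + 1 : ℕ) : ℝ)) ≤ bracket q.2.1 ^ (m₂ - mlen β) :=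
      Real.rpow_le_rpow_of_exponent_le (one_le_bracket _) (by push_cast; linarith)
    calc _ ≤ C * D ^ (mlen α + (mlen β + 1)) * (mfac α : ℝ) ^ μ *
          ((mfac β : ℝ) ^ ν * (2 ^ ν) ^ (mlen α + mlen β)) * wt q ^ (m + 1 - mlen α) *
          bracket q.2.1 ^ (m₂ - mlen β) := by gcongr
      _ = C * D * (D * 2 ^ ν) ^ (mlen α + mlen β) * (mfac α : ℝ) ^ μ *
          (mfac β : ℝ) ^ ν * wt q ^ (m + 1 - mlen α) *
          bracket q.2.1 ^ (m₂ - mlen β) := by rw [mul_pow]; ring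
      _ ≤ _ := by gcongr; exact le_max_left _ _
  · have h1 := h' q hq β α
    rw [dList_const_mul] at h1
    refine h1.trans ?_
    gcongr

end Twisting

/-! ### Data of boundary symbols -/

section BoundaryData

variable {d : ℕ}

/-- Holomorphy in `z` is the Cauchy–Riemann equation `∂_i F = i ∂_1 F`. It holds in a neighbourhood,
so it may be differentiated in any real direction `v`, and the derivatives commute. -/
theorem dDir_holomorphic {F : E (d + 1) × E d × ℂ → ℂ} {q₀ : E (d + 1) × E d × ℂ}
    (hF : ContDiffAt ℝ ∞ F q₀)
    (hol : ∀ᶠ q in 𝓝 q₀, DifferentiableAt ℂ (fun z => F (q.1, q.2.1, z)) q.2.2)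
    (v : E (d + 1) × E d × ℂ) :
    ∀ᶠ q in 𝓝 q₀, DifferentiableAt ℂ (fun z => dDir v F (q.1, q.2.1, z)) q.2.2 := by
  have incl : ∀ (G : E (d + 1) × E d × ℂ → ℂ) (q : E (d + 1) × E d × ℂ),
      DifferentiableAt ℝ G q → HasFDerivAt (fun z : ℂ => G (q.1, q.2.1, z))
        ((fderiv ℝ G q).comp ((ContinuousLinearMap.inr ℝ (E (d + 1)) (E d × ℂ)).comp
          (ContinuousLinearMap.inr ℝ (E d) ℂ))) q.2.2 := by
    intro G q hG
    have h1 : HasFDerivAt (fun z : ℂ => ((q.1, q.2.1, z) : E (d + 1) × E d × ℂ))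
        ((ContinuousLinearMap.inr ℝ (E (d + 1)) (E d × ℂ)).comp
          (ContinuousLinearMap.inr ℝ (E d) ℂ)) q.2.2 := by
      have h2 : (fun z : ℂ => ((q.1, q.2.1, z) : E (d + 1) × E d × ℂ)) =
          fun z => ((ContinuousLinearMap.inr ℝ (E (d + 1)) (E d × ℂ)).comp
            (ContinuousLinearMap.inr ℝ (E d) ℂ)) z + (q.1, q.2.1, 0) := by
        ext z <;> simp
      rw [h2]
      exact (ContinuousLinearMap.hasFDerivAt _).add_const _
    exact HasFDerivAt.comp (g := G) q.2.2 hG.hasFDerivAt h1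
  filter_upwards [eventually_contDiffAt (contDiffAt_infty.1 hF 2), hol.eventually_nhds,
    (eventually_contDiffAt (contDiffAt_infty.1 hF 2)).eventually_nhds] with q hq hhol hqe
  have hCR : dDir (0, 0, Complex.I) F =ᶠ[𝓝 q] fun p => Complex.I * dDir (0, 0, 1) F p := by
    filter_upwards [hhol, hqe] with p hp hpF
    have h1 := (differentiableAt_complex_iff_differentiableAt_real.1 hp).2
    rw [(incl F p (hpF.differentiableAt (by simp))).fderiv] at h1
    simpa [dDir] using h1
  have hd : DifferentiableAt ℝ (dDir v F) q := differentiableAt_dList [v] (n := 2) (by simp) hq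
  refine differentiableAt_complex_iff_differentiableAt_real.2 ⟨(incl _ q hd).differentiableAt, ?_⟩
  rw [(incl _ q hd).fderiv]
  have h2 : dDir (0, 0, Complex.I) (dDir v F) q = Complex.I * dDir (0, 0, 1) (dDir v F) q := by
    rw [dDir_comm _ _ hq, (dDir_congr v hCR).eq_of_nhds, dDir_const_mul, dDir_comm _ _ hq]
  simpa [dDir] using h2

/-- The properties of `a` and of the rational approximation `b` that make the boundary value of the
contour integral a symbol. -/
structure BdryData (μ ν m m₂ B : ℝ) (M : ℕ) (a : E (d + 1) × E (d + 1) → ℂ)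
    (b : E (d + 1) × E d × ℂ → ℂ) : Prop where
  smooth : ContDiff ℝ ∞ a
  bound : GevOn μ ν m₂ m (Set.univ : Set (ℝ × XV d))
    (fun q => bracket (glue q.2.2 q.1)) (lineFam a)
  real_smooth : ∀ (x : E (d + 1)) (ξ' : E d) (s : ℝ), B ≤ |s| →
    ContDiffAt ℝ ∞ (realRestrict b) (x, glue ξ' s)
  circle_smooth : ∀ (x : E (d + 1)) (ξ' : E d) (z : ℂ), ‖z‖ = B * bracket ξ' →
    ContDiffAt ℝ ∞ b (x, ξ', z)
  holomorphic : ∀ (x : E (d + 1)) (ξ' : E d) (z : ℂ), ‖z‖ = B * bracket ξ' →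
    ∀ᶠ q in 𝓝 (x, ξ', z), DifferentiableAt ℂ (fun z => b (q.1, q.2.1, z)) q.2.2
  circle_bound : GevOn μ ν m₂ m {q : ℂ × XV d | ‖q.1‖ = B * bracket q.2.2}
    (fun q => bracket q.2.2) (compFam b)
  rem_bound : GevOn μ ν m₂ (m - M) {q : ℝ × XV d | B ≤ |q.1|}
    (fun q => bracket (glue q.2.2 q.1)) (lineFam fun p => a p - realRestrict b p)

theorem Splitting.bdryData {μ ν m₂ B r : ℝ} {m₁ : ℤ} {M : ℕ} (hrB : r < B)
    {a : E (d + 1) × E (d + 1) → ℂ} {b : E (d + 1) × E d × ℂ → ℂ} (ha : IsSGSymbol μ ν m₁ m₂ a)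
    (h : Splitting μ ν m₁ m₂ B r M a b) : BdryData μ ν m₁ m₂ B M a b where
  smooth := ha.1
  bound := gevOn_lineFam ha
  real_smooth := h.real_smooth
  circle_smooth := h.circle_smooth
  holomorphic x ξ' z hz := by
    have hc : ContinuousAt (fun q : E (d + 1) × E d × ℂ => ‖q.2.2‖ - r * bracket q.2.1)
        (x, ξ', z) := by
      have := continuous_bracket (n := d)
      fun_prop
    -- The strict inequality `r < B` leaves a neighbourhood of the circle free of poles.
    have hpos : 0 < ‖z‖ - r * bracket ξ' := by
      rw [hz]; nlinarith [bracket_pos ξ']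
    filter_upwards [hc.eventually (lt_mem_nhds hpos)] with q hq
    exact h.holomorphic q.1 q.2.1 q.2.2 (by linarith)
  circle_bound := h.circle_bound
  rem_bound := h.rem_bound

/-- Multiplication by `iξ_n`. -/
def mulA (a : E (d + 1) × E (d + 1) → ℂ) : E (d + 1) × E (d + 1) → ℂ :=
  fun p => Complex.I * ((p.2 (Fin.last d) : ℝ) : ℂ) * a p

/-- Multiplication by `iz`. -/
def mulB (b : E (d + 1) × E d × ℂ → ℂ) : E (d + 1) × E d × ℂ → ℂ :=
  fun p => Complex.I * p.2.2 * b p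

/-- The operator `∂_{x_n} + iξ_n`. -/
def twA (a : E (d + 1) × E (d + 1) → ℂ) : E (d + 1) × E (d + 1) → ℂ :=
  fun p => dDir (unitVec (Fin.last d), 0) a p + mulA a p

/-- The operator `∂_{x_n} + iz`. -/
def twB (b : E (d + 1) × E d × ℂ → ℂ) : E (d + 1) × E d × ℂ → ℂ :=
  fun p => tw (enV d) p.2.2 (compFam b p.2.2) (p.1, p.2.1)

theorem compFam_twB (b : E (d + 1) × E d × ℂ → ℂ) (z : ℂ) :
    compFam (twB b) z = tw (enV d) z (compFam b z) := rfl

theorem lineFam_twA {a : E (d + 1) × E (d + 1) → ℂ} (ha : Differentiable ℝ a) (s : ℝ) :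
    lineFam (twA a) s = tw (enV d) s (lineFam a s) := by
  ext p
  rw [tw, lineFam_eq a, dDir_comp_affine _ _ _ (ha _)]
  simp only [lineFam, twA, mulA, lineMap_add]
  simp [lineMap, enV]

/-- `twB` differentiates only the slice `z = const`. Near a point of smoothness of `b` in all
variables this is a directional derivative of `b`, so that smoothness and holomorphy are inherited.
-/
theorem twB_eventuallyEq {b : E (d + 1) × E d × ℂ → ℂ} {q₀ : E (d + 1) × E d × ℂ}
    (hb : ContDiffAt ℝ ∞ b q₀) :
    twB b =ᶠ[𝓝 q₀] fun q => dDir (unitVec (Fin.last d), 0, 0) b q + mulB b q := by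
  filter_upwards [eventually_contDiffAt (contDiffAt_infty.1 hb 1)] with q hq
  have hd : DifferentiableAt ℝ b (compMap d (q.1, q.2.1) + (0, 0, q.2.2)) := by
    rw [compMap_add]
    exact hq.differentiableAt (by simp)
  rw [twB, tw, compFam_eq b, dDir_comp_affine _ _ _ hd]
  simp only [compMap_add]
  simp [mulB, compMap, enV]

theorem realRestrict_twB_eventuallyEq {b : E (d + 1) × E d × ℂ → ℂ} {q₀ : E (d + 1) × E (d + 1)}
    (hb : ContDiffAt ℝ ∞ (realRestrict b) q₀) :
    realRestrict (twB b) =ᶠ[𝓝 q₀] twA (realRestrict b) := by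
  filter_upwards [eventually_contDiffAt (contDiffAt_infty.1 hb 1)] with q hq
  have e : q = (q.1, glue (tang q.2) (q.2 (Fin.last d))) := by simp
  have hd : DifferentiableAt ℝ (realRestrict b)
      (lineMap d (q.1, tang q.2) + (0, q.2 (Fin.last d) • unitVec (Fin.last d))) := by
    rw [lineMap_add]
    simp only [glue_tang]
    exact hq.differentiableAt (by simp)
  simp only [realRestrict, twB]
  rw [← lineFam_realRestrict, tw, lineFam_eq, dDir_comp_affine _ _ _ hd]
  simp only [lineMap_add, glue_tang]
  simp [twA, mulA, lineMap, enV]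

theorem contDiffAt_mulA {a : E (d + 1) × E (d + 1) → ℂ} {q : E (d + 1) × E (d + 1)}
    (ha : ContDiffAt ℝ ∞ a q) : ContDiffAt ℝ ∞ (mulA a) q := by
  have h : ContDiff ℝ ∞ fun p : E (d + 1) × E (d + 1) => ((p.2 (Fin.last d) : ℝ) : ℂ) :=
    Complex.ofRealCLM.contDiff.comp
      ((EuclideanSpace.proj (𝕜 := ℝ) (Fin.last d)).contDiff.comp contDiff_snd)
  exact (contDiffAt_const.mul h.contDiffAt).mul ha

theorem contDiffAt_twA {a : E (d + 1) × E (d + 1) → ℂ} {q : E (d + 1) × E (d + 1)}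
    (ha : ContDiffAt ℝ ∞ a q) : ContDiffAt ℝ ∞ (twA a) q :=
  (contDiffAt_dDir_infty _ ha).add (contDiffAt_mulA ha)

theorem contDiffAt_mulB {b : E (d + 1) × E d × ℂ → ℂ} {q : E (d + 1) × E d × ℂ}
    (hb : ContDiffAt ℝ ∞ b q) : ContDiffAt ℝ ∞ (mulB b) q := by
  have h : ContDiff ℝ ∞ fun p : E (d + 1) × E d × ℂ => p.2.2 := contDiff_snd.comp contDiff_snd
  exact (contDiffAt_const.mul h.contDiffAt).mul hb

theorem BdryData.line_smooth {μ ν m m₂ B : ℝ} {M : ℕ} {a : E (d + 1) × E (d + 1) → ℂ}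
    {b : E (d + 1) × E d × ℂ → ℂ} (h : BdryData μ ν m m₂ B M a b) (s : ℝ) (p : XV d) :
    ContDiffAt ℝ ∞ (lineFam a s) p :=
  contDiffAt_lineFam h.smooth.contDiffAt

theorem BdryData.comp_smooth {μ ν m m₂ B : ℝ} {M : ℕ} {a : E (d + 1) × E (d + 1) → ℂ}
    {b : E (d + 1) × E d × ℂ → ℂ} (h : BdryData μ ν m m₂ B M a b) {s : ℝ} (hs : B ≤ |s|)
    (p : XV d) : ContDiffAt ℝ ∞ (compFam b s) p := by
  rw [← lineFam_realRestrict]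
  exact contDiffAt_lineFam (h.real_smooth _ _ s hs)

theorem BdryData.mul {μ ν m m₂ B : ℝ} {M : ℕ} (hB : 0 < B) {a : E (d + 1) × E (d + 1) → ℂ}
    {b : E (d + 1) × E d × ℂ → ℂ} (h : BdryData μ ν m m₂ B M a b) :
    BdryData μ ν (m + 1) m₂ B M (mulA a) (mulB b) where
  smooth := contDiff_iff_contDiffAt.2 fun q => contDiffAt_mulA h.smooth.contDiffAt
  bound := by
    have := h.bound.mul (c := fun s => (s : ℂ)) one_pos
      (fun q _ => by simpa using abs_le_bracket_glue q.2.2 q.1) (fun q _ => one_le_bracket _)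
    convert this using 3 with s p
    simp [lineFam, mulA]
  real_smooth x ξ' s hs := contDiffAt_mulA (h.real_smooth x ξ' s hs)
  circle_smooth x ξ' z hz := contDiffAt_mulB (h.circle_smooth x ξ' z hz)
  holomorphic x ξ' z hz := by
    filter_upwards [h.holomorphic x ξ' z hz] with q hq
    exact (differentiableAt_id.const_mul Complex.I).mul hq
  circle_bound := h.circle_bound.mul (c := fun z => z) hB (fun q hq => le_of_eq hq)
    (fun q _ => one_le_bracket _)
  rem_bound := by
    have := h.rem_bound.mul (c := fun s => (s : ℂ)) one_pos
      (fun q _ => by simpa using abs_le_bracket_glue q.2.2 q.1) (fun q _ => one_le_bracket _)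
    rw [show m + 1 - M = m - M + 1 by ring]
    convert this using 3 with s p
    simp [lineFam, mulA, mulB, realRestrict]
    ring

theorem GevOn.congr {Ω : Type} {μ ν m₂ m : ℝ} {S : Set (Ω × XV d)} {wt : Ω × XV d → ℝ}
    {f g : Ω → XV d → ℂ} (hf : GevOn μ ν m₂ m S wt f) (h : ∀ q ∈ S, f q.1 = g q.1) :
    GevOn μ ν m₂ m S wt g := by
  obtain ⟨C, hC, D, hD, hb⟩ := hf
  exact ⟨C, hC, D, hD, fun q hq β α => h q hq ▸ hb q hq β α⟩

theorem BdryData.tw_lineFam_rem {μ ν m m₂ B : ℝ} {M : ℕ} {a : E (d + 1) × E (d + 1) → ℂ}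
    {b : E (d + 1) × E d × ℂ → ℂ} (h : BdryData μ ν m m₂ B M a b) {s : ℝ} (hs : B ≤ |s|) :
    tw (enV d) s (lineFam (fun p => a p - realRestrict b p) s) =
      lineFam (fun p => twA a p - realRestrict (twB b) p) s := by
  have e1 : lineFam (fun p => a p - realRestrict b p) s =
      fun p => lineFam a s p - compFam b s p := by
    rw [← lineFam_realRestrict]; rfl
  have e2 : lineFam (fun p => twA a p - realRestrict (twB b) p) s =
      fun p => lineFam (twA a) s p - compFam (twB b) s p := by
    rw [← lineFam_realRestrict]; rfl
  rw [e1, e2, lineFam_twA (h.smooth.differentiable (by simp)), compFam_twB]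
  ext p
  have := dList_sub [enV d] (contDiffAt_infty.1 (h.line_smooth s p) _)
    (contDiffAt_infty.1 (h.comp_smooth hs p) _)
  simp only [dList_cons, dList_nil] at this
  simp only [tw, this]
  ring

/-- Applying `∂_{x_n} + iξ_n` to the symbol and `∂_{x_n} + iz` to the approximation keeps the two
compatible: the new remainder is the twisted old remainder (`BdryData.tw_lineFam_rem`). The length
`M` is unchanged, so each application uses up one order of the decay of the remainder. -/
theorem BdryData.tw {μ ν m m₂ B : ℝ} {M : ℕ} (hB : 0 < B) (hν : 0 ≤ ν)
    {a : E (d + 1) × E (d + 1) → ℂ} {b : E (d + 1) × E d × ℂ → ℂ}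
    (h : BdryData μ ν m m₂ B M a b) : BdryData μ ν (m + 1) m₂ B M (twA a) (twB b) where
  smooth := contDiff_iff_contDiffAt.2 fun q => contDiffAt_twA h.smooth.contDiffAt
  bound := by
    have := h.bound.tw hν (c := fun s => (s : ℂ)) one_pos
      (fun q _ => by simpa using abs_le_bracket_glue q.2.2 q.1) (fun q _ => one_le_bracket _)
      (fun q _ => h.line_smooth _ _)
    exact this.congr fun q _ => (lineFam_twA (h.smooth.differentiable (by simp)) q.1).symm
  real_smooth x ξ' s hs :=
    (contDiffAt_twA (h.real_smooth x ξ' s hs)).congr_of_eventuallyEq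
      (realRestrict_twB_eventuallyEq (h.real_smooth x ξ' s hs))
  circle_smooth x ξ' z hz :=
    ((contDiffAt_dDir_infty _ (h.circle_smooth x ξ' z hz)).add
      (contDiffAt_mulB (h.circle_smooth x ξ' z hz))).congr_of_eventuallyEq
      (twB_eventuallyEq (h.circle_smooth x ξ' z hz))
  holomorphic x ξ' z hz := by
    have hs := h.circle_smooth x ξ' z hz
    filter_upwards [h.holomorphic x ξ' z hz,
      dDir_holomorphic hs (h.holomorphic x ξ' z hz) (unitVec (Fin.last d), 0, 0),
      (twB_eventuallyEq hs).eventually_nhds] with q h1 h2 h3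
    have h4 : DifferentiableAt ℂ (fun z => dDir (unitVec (Fin.last d), 0, 0) b (q.1, q.2.1, z) +
        mulB b (q.1, q.2.1, z)) q.2.2 := h2.add ((differentiableAt_id.const_mul Complex.I).mul h1)
    refine h4.congr_of_eventuallyEq ?_
    have hc : ContinuousAt (fun z : ℂ => ((q.1, q.2.1, z) : E (d + 1) × E d × ℂ)) q.2.2 := by
      fun_prop
    exact hc.eventually h3
  circle_bound := h.circle_bound.tw hν (c := fun z => z) hB (fun q hq => le_of_eq hq)
    (fun q _ => one_le_bracket _) (fun q hq => contDiffAt_compFam (h.circle_smooth _ _ _ hq))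
  rem_bound := by
    have := h.rem_bound.tw hν (c := fun s => (s : ℂ)) one_pos
      (fun q _ => by simpa using abs_le_bracket_glue q.2.2 q.1) (fun q _ => one_le_bracket _)
      (fun q hq => contDiffAt_lineFam (h.smooth.contDiffAt.sub (h.real_smooth _ _ _ hq)))
    rw [show m + 1 - M = m - M + 1 by ring]
    exact this.congr fun q hq => h.tw_lineFam_rem hq

theorem BdryData.iterate {μ ν m m₂ B : ℝ} {M : ℕ} (hB : 0 < B) (hν : 0 ≤ ν)
    {a : E (d + 1) × E (d + 1) → ℂ} {b : E (d + 1) × E d × ℂ → ℂ}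
    (h : BdryData μ ν m m₂ B M a b) (k j : ℕ) :
    BdryData μ ν (m + j + k) m₂ B M (twA^[k] (mulA^[j] a)) (twB^[k] (mulB^[j] b)) := by
  have hj : BdryData μ ν (m + j) m₂ B M (mulA^[j] a) (mulB^[j] b) := by
    induction j with
    | zero => simpa using h
    | succ j ih =>
      rw [Function.iterate_succ_apply', Function.iterate_succ_apply', Nat.cast_succ, ← add_assoc]
      exact ih.mul hB
  induction k with
  | zero => simpa using hj
  | succ k ih =>
    rw [Function.iterate_succ_apply', Function.iterate_succ_apply', Nat.cast_succ, ← add_assoc]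
    exact ih.tw hB hν

end BoundaryData

/-! ### Parametric integrals over compact sets -/

section CompactIntegrals

variable {V J : Type} [NormedAddCommGroup V] [NormedSpace ℝ V] [FiniteDimensional ℝ V]
  [NormedAddCommGroup J] [NormedSpace ℝ J] {ι : Type} [Fintype ι]

theorem finite_words (n : ℕ) : {L : List ι | L.length ≤ n}.Finite := List.finite_length_le ι n

/-- Over a compact interval domination is automatic. Every derivative of the integrand is bounded
uniformly near `p₀` by compactness, and only finitely many words have length at most `n`. -/
theorem contDiffAt_integral_compact (b : Module.Basis ι ℝ V) (l : V →L[ℝ] J) {κ : ℝ → J}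
    (hκ : Continuous κ) {w : ℝ → ℂ} (hw : Continuous w) {g : J → ℂ} {p₀ : V} {lo hi : ℝ}
    (hg : ∀ s ∈ Set.Icc lo hi, ContDiffAt ℝ ∞ g (l p₀ + κ s)) {T : Set ℝ} (hT : MeasurableSet T)
    (hTI : T ⊆ Set.Icc lo hi) (n : ℕ) :
    ContDiffAt ℝ (n : ℕ∞) (fun p => ∫ s in T, w s * g (l p + κ s)) p₀ ∧
    ∀ L : List ι, L.length ≤ n → dList (L.map b) (fun p => ∫ s in T, w s * g (l p + κ s)) p₀ =
      ∫ s in T, w s * dList ((L.map b).map l) g (l p₀ + κ s) := by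
  have hc : ∀ s, ContinuousAt (fun z : V × ℝ => l z.1 + κ z.2) (p₀, s) := by
    intro s; fun_prop
  have hsmooth : ∀ᶠ p in 𝓝 p₀, ∀ s ∈ Set.Icc lo hi, ContDiffAt ℝ (n : ℕ∞) g (l p + κ s) :=
    isCompact_Icc.eventually_forall_of_forall_eventually fun s hs =>
      (hc s).eventually (eventually_contDiffAt (contDiffAt_infty.1 (hg s hs) n))
  have hbd : ∀ L : List ι, ∃ C : ℝ, ∀ᶠ p in 𝓝 p₀, ∀ s ∈ Set.Icc lo hi,
      ‖w s * dList ((L.map b).map l) g (l p + κ s)‖ ≤ C := by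
    intro L
    have hcont : ∀ s ∈ Set.Icc lo hi, ContinuousAt
        (fun z : V × ℝ => w z.2 * dList ((L.map b).map l) g (l z.1 + κ z.2)) (p₀, s) := by
      intro s hs
      refine (hw.continuousAt.comp continuousAt_snd).mul ?_
      exact ContinuousAt.comp (g := dList ((L.map b).map l) g)
        (contDiffAt_dList_infty _ (hg s hs)).continuousAt (hc s)
    obtain ⟨C, hC⟩ := isCompact_Icc.exists_bound_of_continuousOn (s := Set.Icc lo hi)
      (f := fun s => w s * dList ((L.map b).map l) g (l p₀ + κ s)) fun s hs =>
        (ContinuousAt.comp (f := fun s : ℝ => (p₀, s)) (hcont s hs)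
          (by fun_prop)).continuousWithinAt
    refine ⟨C + 1, isCompact_Icc.eventually_forall_of_forall_eventually fun s hs => ?_⟩
    filter_upwards [(hcont s hs).norm.eventually
      (gt_mem_nhds (lt_of_le_of_lt (hC s hs) (lt_add_one C)))] with z hz
    exact hz.le
  choose C hC using hbd
  have hev : ∀ᶠ p in 𝓝 p₀, (∀ s ∈ Set.Icc lo hi, ContDiffAt ℝ (n : ℕ∞) g (l p + κ s)) ∧
      ∀ L ∈ {L : List ι | L.length ≤ n}, ∀ s ∈ Set.Icc lo hi,
        ‖w s * dList ((L.map b).map l) g (l p + κ s)‖ ≤ C L :=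
    hsmooth.and ((Filter.eventually_all_finite (finite_words n)).2 fun L _ => hC L)
  obtain ⟨U, hUp, hUo, hp₀⟩ := eventually_nhds_iff.1 hev
  have hsm : ∀ p ∈ U, ∀ s ∈ T, ContDiffAt ℝ (n : ℕ∞) (fun q => w s * g (l q + κ s)) p := by
    intro p hp s hs
    refine contDiffAt_const.mul ?_
    exact ((hUp p hp).1 s (hTI hs)).comp p (f := fun q => l q + κ s)
      (l.contDiff.add contDiff_const).contDiffAt
  have hdl : ∀ p ∈ U, ∀ s ∈ T, ∀ L : List ι, L.length ≤ n →
      dList (L.map b) (fun q => w s * g (l q + κ s)) p =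
        w s * dList ((L.map b).map l) g (l p + κ s) := by
    intro p hp s hs L hL
    rw [dList_const_mul]
    change w s * dList (L.map b) (fun q => g (l q + κ s)) p = _
    rw [dList_comp_affine l (κ s)]
    refine ((hUp p hp).1 s (hTI hs)).of_le ?_
    rw [List.length_map]
    exact_mod_cast hL
  have hfin : IsFiniteMeasure (volume.restrict T) :=
    ⟨by
      rw [Measure.restrict_apply_univ]
      exact (measure_mono hTI).trans_lt (by simp)⟩
  have key := contDiffOn_integral_of_words (ρ := volume.restrict T) b n
    (f := fun p s => w s * g (l p + κ s)) hUo ?_ ?_ ?_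
  · refine ⟨(key.1.contDiffAt (hUo.mem_nhds hp₀)), fun L hL => ?_⟩
    rw [key.2 L hL p₀ hp₀]
    exact setIntegral_congr_fun hT fun s hs => hdl p₀ hp₀ s hs L hL
  · intro p hp
    refine ContinuousOn.aestronglyMeasurable (fun s hs => ?_) hT
    refine ContinuousAt.continuousWithinAt (hw.continuousAt.mul ?_)
    exact ContinuousAt.comp (f := fun s => l p + κ s) ((hUp p hp).1 s (hTI hs)).continuousAt
      (by fun_prop)
  · exact (ae_restrict_iff' hT).2 (ae_of_all _ fun s hs p hp => hsm p hp s hs)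
  · intro L hL
    refine ⟨fun _ => C L, integrable_const _, (ae_restrict_iff' hT).2 (ae_of_all _ ?_)⟩
    intro s hs p hp
    rw [hdl p hp s hs L hL]
    exact (hUp p hp).2 L hL s (hTI hs)

end CompactIntegrals

/-! ### The boundary symbol -/

section BoundarySymbol

variable {d : ℕ}

/-- The map `(x', ξ') ↦ ((x', 0), ξ')`. -/
def bdryMap (d : ℕ) : E d × E d →L[ℝ] XV d :=
  (bdryIncl d).toContinuousLinearMap.prodMap (ContinuousLinearMap.id ℝ _)

/-- The standard basis of the space of the variables `(x', ξ')`. -/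
def bdryBasis (d : ℕ) : Module.Basis (Fin d ⊕ Fin d) ℝ (E d × E d) :=
  (EuclideanSpace.basisFun (Fin d) ℝ).toBasis.prod (EuclideanSpace.basisFun (Fin d) ℝ).toBasis

theorem bdryBasis_eq : ⇑(bdryBasis d) =
    Sum.elim (fun i => ((unitVec i, 0) : E d × E d)) (fun i => (0, unitVec i)) := by
  ext i : 1
  rcases i with i | i <;> simp [bdryBasis, unitVec]

theorem exists_word_perm {V : Type} {m n : ℕ} (e₁ : Fin m → V) (e₂ : Fin n → V)
    (L : List (Fin m ⊕ Fin n)) :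
    ∃ β α, (L.map (Sum.elim e₁ e₂)).Perm (word e₁ β ++ word e₂ α) := by
  induction L with
  | nil => exact ⟨0, 0, by simp [word_zero]⟩
  | cons k L ih =>
    obtain ⟨β, α, h⟩ := ih
    rcases k with i | i
    · exact ⟨β + Pi.single i 1, α, (h.cons _).trans
        ((word_add_single_perm e₁ β i).symm.append_right _)⟩
    · exact ⟨β, α + Pi.single i 1, (h.cons _).trans (List.perm_middle.symm.trans
        ((word_add_single_perm e₂ α i).symm.append_left _))⟩

theorem map_word_bdryMap (β α : Fin d → ℕ) :
    (word (fun i => ((unitVec i, 0) : E d × E d)) β ++ word (fun i => (0, unitVec i)) α).map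
      (bdryMap d) = wordV (Fin.snoc (α := fun _ => ℕ) β 0) α := by
  rw [List.map_append, map_word, map_word, wordV, word_snoc]
  simp [bdryMap, bdryIncl_unitVec]

theorem exists_map_bdryMap_perm (L : List (Fin d ⊕ Fin d)) :
    ∃ β α, ((L.map (bdryBasis d)).map (bdryMap d)).Perm
      (wordV (Fin.snoc (α := fun _ => ℕ) β 0) α) := by
  obtain ⟨β, α, h⟩ := exists_word_perm (fun i => ((unitVec i, 0) : E d × E d))
    (fun i => (0, unitVec i)) L
  refine ⟨β, α, ?_⟩
  rw [bdryBasis_eq, ← map_word_bdryMap]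
  exact h.map _

variable (B : ℝ) (a : E (d + 1) × E (d + 1) → ℂ) (b : E (d + 1) × E d × ℂ → ℂ)

/-- The contour integral that represents the boundary value, with the contour of radius `R`. -/
def bdryForm (R : ℝ) (p : E d × E d) : ℂ :=
  (∫ s in (outer R)ᶜ, lineFam a s (bdryMap d p)) +
    arcInt (fun z => compFam b z (bdryMap d p)) R +
    ∫ s in outer R, lineFam (fun q => a q - realRestrict b q) s (bdryMap d p)

/-- The contour integral over the contour of radius `B⟨ξ'⟩`. -/
def bdrySym (p : E d × E d) : ℂ := bdryForm a b (B * bracket p.2) p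

variable {B a b} {μ ν m m₂ : ℝ} {M : ℕ}

theorem outer_compl_subset (R : ℝ) : (outer R)ᶜ ⊆ Set.Icc (-R) R := by
  intro s hs
  rw [Set.mem_compl_iff, mem_outer, not_le, abs_lt] at hs
  exact ⟨hs.1.le, hs.2.le⟩

theorem outer_subset_outer {R S : ℝ} (h : R ≤ S) : outer S ⊆ outer R := fun _ hs => h.trans hs

theorem continuousOn_lineFam_rem (h : BdryData μ ν m m₂ B M a b) (p : XV d) :
    ContinuousOn (fun s => lineFam (fun q => a q - realRestrict b q) s p) (outer B) := by
  intro s hs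
  have hc : ContinuousAt (fun q => a q - realRestrict b q) (p.1, glue p.2 s) :=
    (h.smooth.contDiffAt.sub (h.real_smooth p.1 p.2 s hs)).continuousAt
  refine ContinuousAt.continuousWithinAt (ContinuousAt.comp (f := fun s => (p.1, glue p.2 s)) hc ?_)
  have := (continuous_glue (d := d)).comp (continuous_const.prodMk continuous_id :
    Continuous fun s : ℝ => (p.2, s))
  exact (continuous_const.prodMk this).continuousAt

theorem continuous_lineFam (ha : Continuous a) (p : XV d) :
    Continuous (fun s => lineFam a s p) := by
  have := (continuous_glue (d := d)).comp (continuous_const.prodMk continuous_id :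
    Continuous fun s : ℝ => (p.2, s))
  exact ha.comp (continuous_const.prodMk this)

theorem bracket_rpow_le {n : ℕ} (ξ' : E n) {e : ℝ} (he : e ≤ -2) (s : ℝ) :
    bracket (glue ξ' s) ^ e ≤ (1 + s ^ 2)⁻¹ := by
  have h1 : bracket (glue ξ' s) ^ e ≤ bracket (glue ξ' s) ^ (-2 : ℝ) :=
    Real.rpow_le_rpow_of_exponent_le (one_le_bracket _) he
  refine h1.trans ?_
  rw [Real.rpow_neg (bracket_pos _).le, Real.rpow_two, bracket_glue_sq]
  have := one_le_bracket ξ'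
  gcongr
  nlinarith

theorem integrable_rem_words (h : BdryData μ ν m m₂ B M a b) (hM : m - M ≤ -2) :
    ∀ (β : Fin (d + 1) → ℕ) (α : Fin d → ℕ), ∃ C : ℝ, ∀ (p : XV d) (s : ℝ), B ≤ |s| →
      ‖dList (wordV β α) (lineFam (fun q => a q - realRestrict b q) s) p‖ ≤
        C * bracket p.1 ^ (m₂ - mlen β) * (1 + s ^ 2)⁻¹ := by
  obtain ⟨C, hC, D, hD, hb⟩ := h.rem_bound
  intro β α
  refine ⟨C * D ^ (mlen α + mlen β) * (mfac α : ℝ) ^ μ * (mfac β : ℝ) ^ ν, fun p s hs => ?_⟩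
  have h1 := hb (s, p) hs β α
  have h2 := bracket_rpow_le p.2 (e := m - M - mlen α)
    (by linarith [(Nat.cast_nonneg (mlen α) : (0 : ℝ) ≤ mlen α)]) s
  have := bracket_pos p.1
  refine h1.trans ?_
  calc _ ≤ C * D ^ (mlen α + mlen β) * (mfac α : ℝ) ^ μ * (mfac β : ℝ) ^ ν * (1 + s ^ 2)⁻¹ *
        bracket p.1 ^ (m₂ - mlen β) := by gcongr
    _ = _ := by ring

theorem integrableOn_rem (h : BdryData μ ν m m₂ B M a b) (hM : m - M ≤ -2) {R : ℝ} (hR : B ≤ R)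
    (p : XV d) :
    IntegrableOn (fun s => lineFam (fun q => a q - realRestrict b q) s p) (outer R) := by
  obtain ⟨C, hC⟩ := integrable_rem_words h hM 0 0
  refine Integrable.mono' (g := fun s => C * bracket p.1 ^ (m₂ - (mlen (0 : Fin (d + 1) → ℕ) : ℕ)) *
    (1 + s ^ 2)⁻¹) (integrable_inv_one_add_sq.integrableOn.const_mul _)
    (((continuousOn_lineFam_rem h p).mono (outer_subset_outer hR)).aestronglyMeasurable
      (measurableSet_outer R)) ((ae_restrict_iff' (measurableSet_outer R)).2 (ae_of_all _ ?_))
  intro s hs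
  have := hC p s (hR.trans hs)
  rwa [wordV, word_zero, word_zero, List.nil_append, dList_nil] at this

/-- On `R ≤ |s| < S` enlarging the radius exchanges the integral of `a - b` for that of `a`. The
difference is the integral of `b`, which by Cauchy's theorem is the difference of the two arc
integrals. -/
theorem bdryForm_eq_of_le (hB : 0 < B) (h : BdryData μ ν m m₂ B M a b) (hM : m - M ≤ -2)
    {R S : ℝ} (hR : B ≤ R) (hRS : R ≤ S) (p : E d × E d)
    (hol : ∀ z : ℂ, R ≤ ‖z‖ → ‖z‖ ≤ S → 0 ≤ z.im →
      DifferentiableAt ℂ (fun z => compFam b z (bdryMap d p)) z) :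
    bdryForm a b R p = bdryForm a b S p := by
  obtain ⟨hi, he⟩ := setIntegral_outer_diff (hB.trans_le hR) hRS hol
  have ha := continuous_lineFam h.smooth.continuous (bdryMap d p)
  have haI : ∀ T : ℝ, IntegrableOn (fun s => lineFam a s (bdryMap d p)) (outer T)ᶜ := fun T =>
    (ha.continuousOn.integrableOn_Icc).mono_set (outer_compl_subset T)
  have hr := integrableOn_rem h hM hR (bdryMap d p)
  have hmd := (measurableSet_outer R).diff (measurableSet_outer S)
  have hsub : outer R \ outer S ⊆ (outer S)ᶜ := fun s hs => hs.2
  have e1 : ∫ s in (outer S)ᶜ, lineFam a s (bdryMap d p) =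
      (∫ s in (outer R)ᶜ, lineFam a s (bdryMap d p)) +
        ∫ s in outer R \ outer S, lineFam a s (bdryMap d p) := by
    rw [← setIntegral_union _ hmd (haI R) ((haI S).mono_set hsub)]
    · congr 2
      ext s
      have := @outer_subset_outer R S hRS s
      simp only [Set.mem_compl_iff, Set.mem_union, Set.mem_sdiff]
      tauto
    · rw [Set.disjoint_left]
      exact fun s h1 h2 => h1 h2.1
  have e2 : ∫ s in outer R, lineFam (fun q => a q - realRestrict b q) s (bdryMap d p) =
      (∫ s in outer R \ outer S, lineFam (fun q => a q - realRestrict b q) s (bdryMap d p)) +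
        ∫ s in outer S, lineFam (fun q => a q - realRestrict b q) s (bdryMap d p) := by
    rw [← setIntegral_union _ (measurableSet_outer S) (hr.mono_set Set.sdiff_subset)
      (hr.mono_set (outer_subset_outer hRS)), Set.sdiff_union_of_subset (outer_subset_outer hRS)]
    exact Set.disjoint_sdiff_left
  have e3 : ∫ s in outer R \ outer S, lineFam (fun q => a q - realRestrict b q) s (bdryMap d p) =
      (∫ s in outer R \ outer S, lineFam a s (bdryMap d p)) -
        ∫ s in outer R \ outer S, compFam b s (bdryMap d p) := by
    rw [← integral_sub ((haI S).mono_set hsub) hi]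
    refine integral_congr_ae (ae_of_all _ fun s => ?_)
    simp only [← lineFam_realRestrict]
    rfl
  rw [bdryForm, bdryForm, e1, e2, e3, he]
  ring

/-- For `ξ'` near a given point the radii `B⟨ξ'⟩` are close to the frozen one, and `b` is
holomorphic in a thin annulus containing both circles, by compactness of the circle. Hence changing
the radius does not change the value. -/
theorem bdrySym_eventuallyEq (hB : 0 < B) (h : BdryData μ ν m m₂ B M a b) (hM : m - M ≤ -2)
    (p₀ : E d × E d) : bdrySym B a b =ᶠ[𝓝 p₀] bdryForm a b (B * bracket p₀.2) := by
  set R₀ := B * bracket p₀.2 with hR₀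
  have hR₀B : B ≤ R₀ := le_mul_of_one_le_right hB.le (one_le_bracket _)
  have hR₀0 : 0 < R₀ := hB.trans_le hR₀B
  -- The angle runs over a full period, so that every `z` with modulus near `R₀` is reached by its
  -- own modulus and argument.
  have h1 : ∀ᶠ t : (E d × E d) × ℝ in 𝓝 (p₀, R₀), ∀ θ ∈ Set.Icc (-Real.pi) Real.pi,
      DifferentiableAt ℂ (fun z => compFam b z (bdryMap d t.1)) (circ t.2 θ) := by
    refine isCompact_Icc.eventually_forall_of_forall_eventually fun θ _ => ?_
    have hz := h.holomorphic (bdryMap d p₀).1 (bdryMap d p₀).2 (circ R₀ θ)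
      (by rw [norm_circ hR₀0.le]; rfl)
    have hcirc : Continuous fun t : ((E d × E d) × ℝ) × ℝ => circ t.1.2 t.2 := by
      unfold circ; fun_prop
    have hc : Continuous (fun t : ((E d × E d) × ℝ) × ℝ =>
        (((bdryMap d t.1.1).1, (bdryMap d t.1.1).2, circ t.1.2 t.2) :
          E (d + 1) × E d × ℂ)) := by fun_prop
    exact (hc.continuousAt (x := ((p₀, R₀), θ))).eventually hz
  rw [nhds_prod_eq] at h1
  obtain ⟨P, hP, Q, hQ, hPQ⟩ := eventually_prod_iff.1 h1
  obtain ⟨δ, hδ, hδQ⟩ := Metric.eventually_nhds_iff.1 hQ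
  have hcb : ContinuousAt (fun p : E d × E d => B * bracket p.2) p₀ := by
    have := continuous_bracket (n := d)
    fun_prop
  filter_upwards [hP, hcb.eventually (Metric.ball_mem_nhds R₀ hδ)] with p hp hpδ
  have hBp : B ≤ B * bracket p.2 := le_mul_of_one_le_right hB.le (one_le_bracket _)
  rw [Real.dist_eq, abs_lt] at hpδ
  have hol : ∀ z : ℂ, R₀ - δ < ‖z‖ → ‖z‖ < R₀ + δ →
      DifferentiableAt ℂ (fun z => compFam b z (bdryMap d p)) z := by
    intro z hz1 hz2
    have := hPQ hp (hδQ (y := ‖z‖) (by rw [Real.dist_eq, abs_lt]; constructor <;> linarith))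
      z.arg ⟨(Complex.neg_pi_lt_arg z).le, Complex.arg_le_pi z⟩
    rwa [circ, mul_comm Complex.I, Complex.norm_mul_exp_arg_mul_I] at this
  rw [bdrySym]
  rcases le_total (B * bracket p.2) R₀ with hle | hle
  · exact bdryForm_eq_of_le hB h hM hBp hle p fun z h1 h2 _ => hol z (by linarith) (by linarith)
  · exact (bdryForm_eq_of_le hB h hM hR₀B hle p fun z h1 h2 _ =>
      hol z (by linarith) (by linarith)).symm

theorem contDiffAt_rem_integral (h : BdryData μ ν m m₂ B M a b) (hM : m - M ≤ -2) {R : ℝ}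
    (hR : B ≤ R) (p₀ : E d × E d) (n : ℕ) :
    ContDiffAt ℝ (n : ℕ∞) (fun p => ∫ s in outer R,
      lineFam (fun q => a q - realRestrict b q) s (bdryMap d p)) p₀ ∧
    ∀ L : List (Fin d ⊕ Fin d), L.length ≤ n → dList (L.map (bdryBasis d))
      (fun p => ∫ s in outer R, lineFam (fun q => a q - realRestrict b q) s (bdryMap d p)) p₀ =
      ∫ s in outer R, dList ((L.map (bdryBasis d)).map (bdryMap d))
        (lineFam (fun q => a q - realRestrict b q) s) (bdryMap d p₀) := by
  choose C hC using integrable_rem_words h hM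
  have hsm : ∀ s ∈ outer R, ∀ p : XV d,
      ContDiffAt ℝ ∞ (lineFam (fun q => a q - realRestrict b q) s) p := fun s hs p =>
    contDiffAt_lineFam (h.smooth.contDiffAt.sub (h.real_smooth _ _ _ (hR.trans hs)))
  have hdl : ∀ s ∈ outer R, ∀ (p : E d × E d) (L : List (Fin d ⊕ Fin d)),
      dList (L.map (bdryBasis d))
        (fun p => lineFam (fun q => a q - realRestrict b q) s (bdryMap d p)) p =
      dList ((L.map (bdryBasis d)).map (bdryMap d))
        (lineFam (fun q => a q - realRestrict b q) s) (bdryMap d p) := by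
    intro s hs p L
    have := dList_comp_affine (bdryMap d) 0 (p := p) (L.map (bdryBasis d))
      (g := lineFam (fun q => a q - realRestrict b q) s) (contDiffAt_infty.1 (hsm s hs _) _)
    simpa using this
  choose β α hβα using exists_map_bdryMap_perm (d := d)
  set e : List (Fin d ⊕ Fin d) → ℝ := fun L =>
    m₂ - mlen (Fin.snoc (α := fun _ => ℕ) (β L) 0 : Fin (d + 1) → ℕ)
  set K : List (Fin d ⊕ Fin d) → ℝ := fun L =>
    C (Fin.snoc (α := fun _ => ℕ) (β L) 0) (α L)
  -- The bound depends on `x` through a power of `⟨x⟩`. Near `p₀` it exceeds its value at `p₀` by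
  -- less than one, simultaneously for the finitely many words needed.
  have hev : ∀ᶠ p in 𝓝 p₀, ∀ L ∈ {L : List (Fin d ⊕ Fin d) | L.length ≤ n},
      K L * bracket (bdryMap d p).1 ^ e L < K L * bracket (bdryMap d p₀).1 ^ e L + 1 := by
    refine (Filter.eventually_all_finite (finite_words n)).2 fun L _ => ?_
    have hc : ContinuousAt (fun p => K L * bracket (bdryMap d p).1 ^ e L) p₀ := by
      refine continuousAt_const.mul (ContinuousAt.rpow_const ?_ (Or.inl (bracket_pos _).ne'))
      have := continuous_bracket (n := d + 1)
      fun_prop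
    exact hc.eventually (gt_mem_nhds (lt_add_one _))
  obtain ⟨U, hUp, hUo, hp₀⟩ := eventually_nhds_iff.1 hev
  have hmo := measurableSet_outer R
  have key := contDiffOn_integral_of_words (ρ := volume.restrict (outer R)) (bdryBasis d) n
    (f := fun p s => lineFam (fun q => a q - realRestrict b q) s (bdryMap d p)) hUo ?_ ?_ ?_
  · refine ⟨key.1.contDiffAt (hUo.mem_nhds hp₀), fun L hL => ?_⟩
    rw [key.2 L hL p₀ hp₀]
    exact setIntegral_congr_fun hmo fun s hs => hdl s hs p₀ L
  · intro p _
    exact ((continuousOn_lineFam_rem h _).mono (outer_subset_outer hR)).aestronglyMeasurable hmo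
  · refine (ae_restrict_iff' hmo).2 (ae_of_all _ fun s hs p _ => ?_)
    exact (contDiffAt_infty.1 (hsm s hs _) n).comp p (bdryMap d).contDiff.contDiffAt
  · intro L hL
    refine ⟨fun s => (K L * bracket (bdryMap d p₀).1 ^ e L + 1) * (1 + s ^ 2)⁻¹,
      integrable_inv_one_add_sq.integrableOn.const_mul _,
      (ae_restrict_iff' hmo).2 (ae_of_all _ fun s hs p hp => ?_)⟩
    rw [hdl s hs p L, dList_perm (hβα L) (contDiffAt_infty.1 (hsm s hs _) _)]
    refine (hC _ _ _ s (hR.trans hs)).trans ?_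
    exact mul_le_mul_of_nonneg_right (hUp p hp L hL).le (by positivity)

/-- The radius is frozen at `p₀` and the derivatives are evaluated at `p₀` only, exactly where the
circle estimates of `b` are available. -/
theorem bdryForm_derivatives (hB : 0 < B) (h : BdryData μ ν m m₂ B M a b) (hM : m - M ≤ -2)
    (p₀ : E d × E d) (n : ℕ) :
    ContDiffAt ℝ (n : ℕ∞) (bdryForm a b (B * bracket p₀.2)) p₀ ∧
    ∀ L : List (Fin d ⊕ Fin d), L.length ≤ n →
      dList (L.map (bdryBasis d)) (bdryForm a b (B * bracket p₀.2)) p₀ =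
      (∫ s in (outer (B * bracket p₀.2))ᶜ,
        dList ((L.map (bdryBasis d)).map (bdryMap d)) (lineFam a s) (bdryMap d p₀)) +
      arcInt (fun z => dList ((L.map (bdryBasis d)).map (bdryMap d)) (compFam b z) (bdryMap d p₀))
        (B * bracket p₀.2) +
      ∫ s in outer (B * bracket p₀.2), dList ((L.map (bdryBasis d)).map (bdryMap d))
        (lineFam (fun q => a q - realRestrict b q) s) (bdryMap d p₀) := by
  set R := B * bracket p₀.2 with hRdef
  have hR : B ≤ R := le_mul_of_one_le_right hB.le (one_le_bracket _)
  have hR0 : 0 < R := hB.trans_le hR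
  have h1 := contDiffAt_integral_compact (bdryBasis d) ((lineMap d).comp (bdryMap d))
    (κ := fun s => (0, s • unitVec (Fin.last d))) (by fun_prop) (w := fun _ => 1)
    continuous_const (g := a) (p₀ := p₀) (lo := -R) (hi := R) (fun s _ => h.smooth.contDiffAt)
    (measurableSet_outer R).compl (outer_compl_subset R) n
  have h2 := contDiffAt_integral_compact (bdryBasis d) ((compMap d).comp (bdryMap d))
    (κ := fun θ => (0, 0, circ R θ)) (by have := continuous_circ R; fun_prop)
    (w := fun θ => Complex.I * circ R θ) (by have := continuous_circ R; fun_prop) (g := b)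
    (p₀ := p₀) (lo := 0) (hi := Real.pi) (fun θ _ => by
      rw [ContinuousLinearMap.comp_apply, compMap_add]
      exact h.circle_smooth _ _ _ (by rw [norm_circ hR0.le]; rfl))
    measurableSet_Ioc Set.Ioc_subset_Icc_self n
  have h3 := contDiffAt_rem_integral h hM hR p₀ n
  have e1 : ∀ p : E d × E d, ∫ s in (outer R)ᶜ, lineFam a s (bdryMap d p) =
      ∫ s in (outer R)ᶜ, 1 * a (((lineMap d).comp (bdryMap d)) p +
        (0, s • unitVec (Fin.last d))) := by
    intro p
    simp only [ContinuousLinearMap.comp_apply, lineMap_add, one_mul]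
    rfl
  have e2 : ∀ p : E d × E d, arcInt (fun z => compFam b z (bdryMap d p)) R =
      ∫ θ in Set.Ioc 0 Real.pi, Complex.I * circ R θ * b (((compMap d).comp (bdryMap d)) p +
        (0, 0, circ R θ)) := by
    intro p
    rw [arcInt, intervalIntegral.integral_of_le Real.pi_pos.le]
    simp only [ContinuousLinearMap.comp_apply, compMap_add]
    refine integral_congr_ae (ae_of_all _ fun θ => ?_)
    simp only [compFam]
    ring
  have hform : bdryForm a b R = fun p => ((∫ s in (outer R)ᶜ,
      1 * a (((lineMap d).comp (bdryMap d)) p + (0, s • unitVec (Fin.last d)))) +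
      ∫ θ in Set.Ioc 0 Real.pi, Complex.I * circ R θ * b (((compMap d).comp (bdryMap d)) p +
        (0, 0, circ R θ))) + ∫ s in outer R,
          lineFam (fun q => a q - realRestrict b q) s (bdryMap d p) := by
    ext p
    rw [bdryForm, e1, e2]
  rw [hform]
  refine ⟨(h1.1.add h2.1).add h3.1, fun L hL => ?_⟩
  have hlen : ((((L.map (bdryBasis d)).length : ℕ) : ℕ∞) : WithTop ℕ∞) ≤ ((n : ℕ∞) : WithTop ℕ∞) := by
    rw [List.length_map]; exact_mod_cast hL
  rw [dList_add _ ((h1.1.add h2.1).of_le hlen) (h3.1.of_le hlen),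
    dList_add _ (h1.1.of_le hlen) (h2.1.of_le hlen), h1.2 L hL, h2.2 L hL, h3.2 L hL]
  congr 2
  · refine integral_congr_ae (ae_of_all _ fun s => ?_)
    simp only
    rw [one_mul, dList_lineFam _ (contDiffAt_infty.1 h.smooth.contDiffAt _),
      ContinuousLinearMap.comp_apply, lineMap_add, List.map_map, List.map_map, List.map_map]
    rfl
  · rw [arcInt, intervalIntegral.integral_of_le Real.pi_pos.le]
    refine integral_congr_ae (ae_of_all _ fun θ => ?_)
    simp only
    rw [dList_compFam _ (contDiffAt_infty.1 (h.circle_smooth _ _ _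
        (by rw [norm_circ hR0.le]; rfl)) _), ContinuousLinearMap.comp_apply, compMap_add,
      List.map_map, List.map_map, List.map_map, mul_comm]
    rfl

end BoundarySymbol

/-! ### The boundary symbol is an SG symbol -/

section SymbolEstimates

variable {d : ℕ}

/-- The constant does not depend on `k`: since `w ≤ y`, the factor `y^(-k)` is compared with
`w^(-k)` without loss, and comparability is used for the exponent `m` alone. -/
theorem rpow_sub_le_of_comparable {w y K : ℝ} (hw : 0 < w) (hwy : w ≤ y) (hK : 1 ≤ K)
    (hy : y ≤ K * w) (m : ℝ) (k : ℕ) : y ^ (m - k) ≤ K ^ |m| * w ^ (m - k) := by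
  have hy0 := hw.trans_le hwy
  have h1 : y ^ m ≤ K ^ |m| * w ^ m := by
    rcases le_total 0 m with hm | hm
    · rw [abs_of_nonneg hm, ← Real.mul_rpow (by positivity) hw.le]
      exact Real.rpow_le_rpow hy0.le hy hm
    · refine (Real.rpow_le_rpow_of_nonpos hw hwy hm).trans ?_
      exact le_mul_of_one_le_left (by positivity) (Real.one_le_rpow hK (abs_nonneg m))
  have h2 : y ^ (-(k : ℝ)) ≤ w ^ (-(k : ℝ)) :=
    Real.rpow_le_rpow_of_nonpos hw hwy (by simp)
  rw [sub_eq_add_neg, Real.rpow_add hy0, Real.rpow_add hw, ← mul_assoc]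
  exact mul_le_mul h1 h2 (by positivity) (by positivity)

theorem integrable_inv_sq_add_sq {w : ℝ} (hw : 0 < w) :
    Integrable (fun s : ℝ => (w ^ 2 + s ^ 2)⁻¹) ∧ ∫ s : ℝ, (w ^ 2 + s ^ 2)⁻¹ = Real.pi / w := by
  have h : (fun s : ℝ => (w ^ 2 + s ^ 2)⁻¹) = fun s => (w ^ 2)⁻¹ * (1 + (s / w) ^ 2)⁻¹ := by
    ext s
    rw [← mul_inv]
    congr 1
    field_simp
  rw [h]
  refine ⟨(integrable_inv_one_add_sq.comp_div hw.ne').const_mul _, ?_⟩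
  rw [integral_const_mul, Measure.integral_comp_div (fun s : ℝ => (1 + s ^ 2)⁻¹),
    integral_univ_inv_one_add_sq, abs_of_pos hw, smul_eq_mul]
  field_simp

theorem bracket_bdryIncl (x : E d) : bracket (bdryIncl d x) = bracket x := by
  rw [bracket, bracket, (bdryIncl d).norm_map]

theorem IsSGSymbol.const_mul {n : ℕ} {μ ν m₁ m₂ : ℝ} {a : E n × E n → ℂ}
    (h : IsSGSymbol μ ν m₁ m₂ a) (c : ℂ) : IsSGSymbol μ ν m₁ m₂ fun p => c * a p := by
  obtain ⟨hs, C, hC, D, hD, hb⟩ := h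
  refine ⟨contDiff_const.mul hs, (‖c‖ + 1) * C, by positivity, D, hD, fun α β x ξ => ?_⟩
  have := hb α β x ξ
  rw [dXXi_eq_dList] at this ⊢
  rw [dList_const_mul, norm_mul, mul_assoc, mul_assoc, mul_assoc, mul_assoc, mul_assoc]
  rw [mul_assoc, mul_assoc, mul_assoc, mul_assoc] at this
  exact mul_le_mul (by linarith) this (norm_nonneg _) (by positivity)

variable {μ ν m m₂ B : ℝ} {M : ℕ} {a : E (d + 1) × E (d + 1) → ℂ} {b : E (d + 1) × E d × ℂ → ℂ}

theorem BdryData.contDiff_bdrySym (hB : 0 < B) (h : BdryData μ ν m m₂ B M a b)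
    (hM : m - M ≤ -2) : ContDiff ℝ ∞ (bdrySym B a b) := by
  refine contDiff_iff_contDiffAt.2 fun p₀ => contDiffAt_infty.2 fun n => ?_
  exact (bdryForm_derivatives hB h hM p₀ n).1.congr_of_eventuallyEq
    (bdrySym_eventuallyEq hB h hM p₀)

theorem BdryData.dXXi_bdrySym (hB : 0 < B) (h : BdryData μ ν m m₂ B M a b)
    (hM : m - M ≤ -2) (β α : Fin d → ℕ) (p : E d × E d) :
    dXXi β α (bdrySym B a b) p =
      (∫ s in (outer (B * bracket p.2))ᶜ,
        dList (wordV (Fin.snoc (α := fun _ => ℕ) β 0) α) (lineFam a s) (bdryMap d p)) +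
      arcInt (fun z => dList (wordV (Fin.snoc (α := fun _ => ℕ) β 0) α) (compFam b z)
        (bdryMap d p)) (B * bracket p.2) +
      ∫ s in outer (B * bracket p.2), dList (wordV (Fin.snoc (α := fun _ => ℕ) β 0) α)
        (lineFam (fun q => a q - realRestrict b q) s) (bdryMap d p) := by
  have hw : word (fun i => ((unitVec i, 0) : E d × E d)) β ++ word (fun i => (0, unitVec i)) α =
      (word Sum.inl β ++ word Sum.inr α).map (bdryBasis d) := by
    rw [List.map_append, map_word, map_word]
    simp only [bdryBasis_eq, Sum.elim_inl, Sum.elim_inr]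
  rw [dXXi_eq_dList, hw, (dList_congr _ (bdrySym_eventuallyEq hB h hM p)).eq_of_nhds,
    (bdryForm_derivatives hB h hM p _).2 _ le_rfl, ← hw, map_word_bdryMap]

/-- The three pieces are estimated with a common base `D`, each producing one extra power of `⟨ξ'⟩`,
which accounts for the order `m + 1`. -/
theorem BdryData.isSGSymbol (hB : 0 < B) (h : BdryData μ ν m m₂ B M a b) (hM : m - M ≤ -2) :
    IsSGSymbol μ ν (m + 1) m₂ (bdrySym B a b) := by
  refine ⟨h.contDiff_bdrySym hB hM, ?_⟩
  obtain ⟨C₁, hC₁, D₁, hD₁, h₁⟩ := h.bound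
  obtain ⟨C₂, hC₂, D₂, hD₂, h₂⟩ := h.circle_bound
  obtain ⟨C₃, hC₃, D₃, hD₃, h₃⟩ := h.rem_bound
  set D := max D₁ (max D₂ D₃) with hDdef
  have hD : 1 ≤ D := hD₁.trans (le_max_left _ _)
  have hD₁D : D₁ ≤ D := le_max_left _ _
  have hD₂D : D₂ ≤ D := (le_max_left _ _).trans (le_max_right _ _)
  have hD₃D : D₃ ≤ D := (le_max_right _ _).trans (le_max_right _ _)
  refine ⟨C₁ * (1 + B) ^ |m| * (2 * B) + Real.pi * (B * C₂) + Real.pi * C₃, by positivity, D,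
    by linarith, fun α β x ξ => ?_⟩
  rw [h.dXXi_bdrySym hB hM]
  set β' : Fin (d + 1) → ℕ := Fin.snoc (α := fun _ => ℕ) β 0
  set p := bdryMap d (x, ξ) with hp
  have hp2 : p.2 = ξ := rfl
  have hpx : bracket p.1 = bracket x := bracket_bdryIncl x
  have hl : mlen β' = mlen β := mlen_snoc_zero β
  have hf : mfac β' = mfac β := mfac_snoc_zero β
  set w := bracket ξ with hw
  have hw1 : 1 ≤ w := one_le_bracket ξ
  have hw0 : 0 < w := by linarith
  have hwm : w ^ (m + 1 - mlen α) = w ^ (m - mlen α) * w := by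
    rw [show m + 1 - mlen α = (m - mlen α) + 1 by ring, Real.rpow_add hw0, Real.rpow_one]
  have hX := bracket_pos x
  set F : ℝ := D ^ (mlen α + mlen β) * (mfac α : ℝ) ^ μ * (mfac β : ℝ) ^ ν *
    bracket x ^ (m₂ - mlen β) with hF
  have hF0 : 0 ≤ F := by positivity
  have hR : B ≤ B * w := le_mul_of_one_le_right hB.le hw1
  have hR0 : 0 < B * w := hB.trans_le hR
  have hgl : ∀ {C D' y : ℝ}, 0 ≤ C → 1 ≤ D' → D' ≤ D → 0 ≤ y →
      C * D' ^ (mlen α + mlen β') * (mfac α : ℝ) ^ μ * (mfac β' : ℝ) ^ ν * y *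
        bracket p.1 ^ (m₂ - mlen β') ≤ C * F * y := by
    intro C D' y hC hD' hDD hy
    rw [hl, hf, hpx, hF]
    calc C * D' ^ (mlen α + mlen β) * (mfac α : ℝ) ^ μ * (mfac β : ℝ) ^ ν * y *
          bracket x ^ (m₂ - mlen β)
        ≤ C * D ^ (mlen α + mlen β) * (mfac α : ℝ) ^ μ * (mfac β : ℝ) ^ ν * y *
          bracket x ^ (m₂ - mlen β) := by gcongr
      _ = _ := by ring
  have hin : ‖∫ s in (outer (B * w))ᶜ, dList (wordV β' α) (lineFam a s) p‖ ≤
      C₁ * (1 + B) ^ |m| * (2 * B) * F * w ^ (m + 1 - mlen α) := by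
    have hb : ∀ s ∈ (outer (B * w))ᶜ, ‖dList (wordV β' α) (lineFam a s) p‖ ≤
        C₁ * F * ((1 + B) ^ |m| * w ^ (m - mlen α)) := by
      intro s hs
      rw [Set.mem_compl_iff, mem_outer, not_le] at hs
      refine (h₁ (s, p) trivial β' α).trans
        ((hgl hC₁.le hD₁ hD₁D (Real.rpow_nonneg (bracket_pos _).le _)).trans ?_)
      refine mul_le_mul_of_nonneg_left ?_ (by positivity)
      refine rpow_sub_le_of_comparable hw0 (bracket_le_bracket_glue ξ s) (by linarith) ?_ m _
      exact (bracket_glue_le ξ s).trans (by rw [add_mul, one_mul, ← hw]; linarith)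
    have hvol : volume.real (outer (B * w))ᶜ ≤ 2 * (B * w) := by
      refine (measureReal_mono (outer_compl_subset _) (by simp)).trans ?_
      rw [Real.volume_real_Icc_of_le (by linarith)]
      linarith
    refine (norm_setIntegral_le_of_norm_le_const
      ((measure_mono (outer_compl_subset _)).trans_lt (by simp)) hb).trans ?_
    calc _ ≤ C₁ * F * ((1 + B) ^ |m| * w ^ (m - mlen α)) * (2 * (B * w)) := by gcongr
      _ = _ := by rw [hwm]; ring
  have harc : ‖arcInt (fun z => dList (wordV β' α) (compFam b z) p) (B * w)‖ ≤
      Real.pi * (B * C₂) * F * w ^ (m + 1 - mlen α) := by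
    have hb : ∀ θ ∈ Set.uIoc 0 Real.pi, ‖dList (wordV β' α) (compFam b (circ (B * w) θ)) p *
        (Complex.I * circ (B * w) θ)‖ ≤ C₂ * F * w ^ (m - mlen α) * (B * w) := by
      intro θ _
      rw [norm_mul, norm_mul, Complex.norm_I, one_mul, norm_circ hR0.le]
      refine mul_le_mul_of_nonneg_right ?_ hR0.le
      exact (h₂ (circ (B * w) θ, p) (norm_circ hR0.le θ) β' α).trans
        (hgl hC₂.le hD₂ hD₂D (Real.rpow_nonneg (bracket_pos _).le _))
    rw [arcInt]
    refine (intervalIntegral.norm_integral_le_of_norm_le_const hb).trans (le_of_eq ?_)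
    rw [sub_zero, abs_of_pos Real.pi_pos, hwm]
    ring
  have hout : ‖∫ s in outer (B * w), dList (wordV β' α)
      (lineFam (fun q => a q - realRestrict b q) s) p‖ ≤
      Real.pi * C₃ * F * w ^ (m + 1 - mlen α) := by
    obtain ⟨hi, he⟩ := integrable_inv_sq_add_sq hw0
    -- A factor `⟨(ξ', s)⟩^(-2) = (⟨ξ'⟩² + s²)^(-1)` is kept for the integration. The remaining
    -- exponent is nonpositive by `hM`, so there `⟨(ξ', s)⟩` may be replaced by the smaller `⟨ξ'⟩`.
    have hb : ∀ s ∈ outer (B * w), ‖dList (wordV β' α)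
        (lineFam (fun q => a q - realRestrict b q) s) p‖ ≤
        C₃ * F * w ^ (m + 2 - mlen α) * (w ^ 2 + s ^ 2)⁻¹ := by
      intro s hs
      have hy0 := bracket_pos (glue ξ s)
      refine (h₃ (s, p) (hR.trans hs) β' α).trans
        ((hgl hC₃.le hD₃ hD₃D (Real.rpow_nonneg (bracket_pos _).le _)).trans ?_)
      rw [mul_assoc (C₃ * F)]
      refine mul_le_mul_of_nonneg_left ?_ (by positivity)
      simp only
      rw [hp2, show m - M - mlen α = (m - M + 2 - mlen α) + (-2 : ℝ) by ring,
        Real.rpow_add hy0, Real.rpow_neg hy0.le, Real.rpow_two, bracket_glue_sq]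
      refine mul_le_mul_of_nonneg_right ?_ (by positivity)
      refine (Real.rpow_le_rpow_of_nonpos hw0 (bracket_le_bracket_glue ξ s) ?_).trans ?_
      · linarith [(Nat.cast_nonneg (mlen α) : (0 : ℝ) ≤ mlen α)]
      · exact Real.rpow_le_rpow_of_exponent_le hw1
          (by linarith [(Nat.cast_nonneg M : (0 : ℝ) ≤ M)])
    refine (norm_integral_le_of_norm_le ((hi.const_mul _).integrableOn)
      ((ae_restrict_iff' (measurableSet_outer _)).2 (ae_of_all _ hb))).trans ?_
    refine (setIntegral_le_integral (hi.const_mul _)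
      (ae_of_all _ fun s => by positivity)).trans (le_of_eq ?_)
    rw [integral_const_mul, he, show m + 2 - mlen α = (m + 1 - mlen α) + 1 by ring,
      Real.rpow_add hw0, Real.rpow_one]
    field_simp
  refine (norm_add₃_le).trans ((add_le_add (add_le_add hin harc) hout).trans (le_of_eq ?_))
  rw [hF]
  ring

end SymbolEstimates

/-! ### Oscillating factors -/

section Oscillation

variable {V : Type} [NormedAddCommGroup V] [NormedSpace ℝ V]

theorem dDir_exp_mul (l : V →L[ℝ] ℂ) (v : V) {g : V → ℂ} {p : V} (hg : DifferentiableAt ℝ g p) :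
    dDir v (fun q => Complex.exp (Complex.I * l q) * g q) p =
      Complex.exp (Complex.I * l p) * tw v (l v) g p := by
  have h : HasFDerivAt (fun q => Complex.exp (Complex.I * l q) * g q) _ p :=
    ((l.hasFDerivAt (x := p)).const_mul Complex.I).cexp.mul hg.hasFDerivAt
  rw [dDir, h.fderiv]
  simp [tw, dDir]
  ring

/-- The composition of the operators `∂_v + i l(v)`, where `v` runs through a list. -/
def twList (l : V → ℂ) (L : List V) (g : V → ℂ) : V → ℂ := L.foldr (fun v f => tw v (l v) f) g

theorem contDiff_tw (v : V) (c : ℂ) {g : V → ℂ} (hg : ContDiff ℝ ∞ g) : ContDiff ℝ ∞ (tw v c g) :=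
  contDiff_iff_contDiffAt.2 fun _ => contDiffAt_tw v c hg.contDiffAt

theorem contDiff_twList (l : V → ℂ) (L : List V) {g : V → ℂ} (hg : ContDiff ℝ ∞ g) :
    ContDiff ℝ ∞ (twList l L g) := by
  induction L with
  | nil => exact hg
  | cons v L ih => exact contDiff_tw v (l v) ih

/-- Conjugation by the exponential turns each `∂_v` into `∂_v + i l(v)`, so an oscillating function
is differentiated by acting on its amplitude alone. -/
theorem dList_exp_mul (l : V →L[ℝ] ℂ) (L : List V) {g : V → ℂ} (hg : ContDiff ℝ ∞ g) :
    dList L (fun q => Complex.exp (Complex.I * l q) * g q) =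
      fun p => Complex.exp (Complex.I * l p) * twList l L g p := by
  induction L with
  | nil => rfl
  | cons v L ih =>
    ext p
    rw [dList_cons, ih, dDir_exp_mul l v ((contDiff_twList l L hg).differentiable (by simp) p)]
    rfl

end Oscillation

/-! ### Amplitudes -/

section Amplitudes

variable {n : ℕ}

/-- A smooth function of `(x, ξ)` all of whose derivatives grow at most like `⟨ξ⟩^(2m)` in `ξ` and
polynomially in `x`. -/
structure Amp (m : ℕ) (a : E n × E n → ℂ) : Prop where
  smooth : ContDiff ℝ ∞ a
  bound : ∀ L : List (Fin n ⊕ Fin n), ∃ C : ℝ, 0 ≤ C ∧ ∃ N : ℕ, ∀ p : E n × E n,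
    ‖dList (L.map (bdryBasis n)) a p‖ ≤ C * (1 + ‖p.1‖ ^ 2) ^ N * (1 + ‖p.2‖ ^ 2) ^ m

theorem Amp.deriv {m : ℕ} {a : E n × E n → ℂ} (ha : Amp m a) (i : Fin n ⊕ Fin n) :
    Amp m (dDir (bdryBasis n i) a) where
  smooth := contDiff_iff_contDiffAt.2 fun _ => contDiffAt_dDir_infty _ ha.smooth.contDiffAt
  bound L := by
    obtain ⟨C, hC, N, h⟩ := ha.bound (L ++ [i])
    refine ⟨C, hC, N, fun p => ?_⟩
    have := h p
    rwa [List.map_append, dList_append] at this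

theorem amp_zero (m : ℕ) : Amp m (fun _ : E n × E n => 0) where
  smooth := contDiff_const
  bound L := ⟨0, le_rfl, 0, fun p => by rw [dList_zero_fun]; simp⟩

theorem bracket_rpow_le_pow {x : E n} {e : ℝ} {N : ℕ} (h : e ≤ N) :
    bracket x ^ e ≤ (1 + ‖x‖ ^ 2) ^ N := by
  rw [← bracket_sq, ← pow_mul, ← Real.rpow_natCast]
  refine Real.rpow_le_rpow_of_exponent_le (one_le_bracket x) (h.trans ?_)
  push_cast
  linarith [(Nat.cast_nonneg N : (0 : ℝ) ≤ N)]

theorem IsSGSymbol.amp {μ ν m₁ m₂ : ℝ} {a : E n × E n → ℂ} (ha : IsSGSymbol μ ν m₁ m₂ a) {m : ℕ}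
    (hm : m₁ ≤ m) : Amp m a where
  smooth := ha.1
  bound L := by
    obtain ⟨C, hC, D, hD, h⟩ := ha.2
    obtain ⟨β, α, hp⟩ := exists_word_perm (fun i => ((unitVec i, 0) : E n × E n))
      (fun i => (0, unitVec i)) L
    obtain ⟨N, hN⟩ := exists_nat_ge m₂
    refine ⟨C * D ^ (mlen α + mlen β) * (mfac α : ℝ) ^ μ * (mfac β : ℝ) ^ ν, by positivity, N,
      fun p => ?_⟩
    rw [bdryBasis_eq, dList_perm hp (contDiffAt_infty.1 ha.1.contDiffAt _), ← dXXi_eq_dList]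
    have h1 : bracket p.2 ^ (m₁ - mlen α) ≤ (1 + ‖p.2‖ ^ 2) ^ m :=
      bracket_rpow_le_pow (by linarith [(Nat.cast_nonneg (mlen α) : (0 : ℝ) ≤ mlen α)])
    have h2 : bracket p.1 ^ (m₂ - mlen β) ≤ (1 + ‖p.1‖ ^ 2) ^ N :=
      bracket_rpow_le_pow (by linarith [(Nat.cast_nonneg (mlen β) : (0 : ℝ) ≤ mlen β)])
    have := bracket_pos p.1
    have := bracket_pos p.2
    refine (h α β p.1 p.2).trans ?_
    calc _ ≤ C * D ^ (mlen α + mlen β) * (mfac α : ℝ) ^ μ * (mfac β : ℝ) ^ ν *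
          (1 + ‖p.2‖ ^ 2) ^ m * (1 + ‖p.1‖ ^ 2) ^ N := by gcongr
      _ = _ := by ring

theorem Amp.exists_bound {m : ℕ} {a : E n × E n → ℂ} (ha : Amp m a) : ∃ C : ℝ, 0 ≤ C ∧ ∃ N : ℕ,
    ∀ p, ‖a p‖ ≤ C * (1 + ‖p.1‖ ^ 2) ^ N * (1 + ‖p.2‖ ^ 2) ^ m := ha.bound []

/-- Multiplication by `⟨x⟩^(2N)`. -/
def mulBracket (n N : ℕ) : 𝓢(E n, ℂ) →L[ℂ] 𝓢(E n, ℂ) :=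
  SchwartzMap.smulLeftCLM ℂ fun x : E n => (((1 + ‖x‖ ^ 2) ^ N : ℝ) : ℂ)

theorem mulBracket_apply (N : ℕ) (ψ : 𝓢(E n, ℂ)) (x : E n) :
    mulBracket n N ψ x = (((1 + ‖x‖ ^ 2) ^ N : ℝ) : ℂ) * ψ x :=
  SchwartzMap.smulLeftCLM_apply_apply (by fun_prop) ψ x

theorem norm_mulBracket_apply (N : ℕ) (ψ : 𝓢(E n, ℂ)) (x : E n) :
    ‖mulBracket n N ψ x‖ = (1 + ‖x‖ ^ 2) ^ N * ‖ψ x‖ := by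
  rw [mulBracket_apply, norm_mul, Complex.norm_real, Real.norm_of_nonneg (by positivity)]

theorem integrable_bracket_mul (N : ℕ) (ψ : 𝓢(E n, ℂ)) :
    Integrable fun x => (1 + ‖x‖ ^ 2) ^ N * ‖ψ x‖ := by
  simpa only [norm_mulBracket_apply] using (mulBracket n N ψ).integrable.norm

/-- The seminorm `∫ ⟨x⟩^(2N) |ψ(x)| dx`. -/
def intSeminorm (n N : ℕ) : Seminorm ℂ 𝓢(E n, ℂ) :=
  (normSeminorm ℂ (Lp ℂ 1 (volume : Measure (E n)))).comp
    ((SchwartzMap.toLpCLM ℂ ℂ 1 volume).comp (mulBracket n N)).toLinearMap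

theorem continuous_intSeminorm (n N : ℕ) : Continuous (intSeminorm n N) :=
  continuous_norm.comp ((SchwartzMap.toLpCLM ℂ ℂ 1 volume).comp (mulBracket n N)).continuous

theorem intSeminorm_apply (N : ℕ) (ψ : 𝓢(E n, ℂ)) :
    intSeminorm n N ψ = ∫ x, (1 + ‖x‖ ^ 2) ^ N * ‖ψ x‖ := by
  change ‖(mulBracket n N ψ).toLp 1 volume‖ = _
  rw [L1.norm_eq_integral_norm]
  refine integral_congr_ae ?_
  filter_upwards [(mulBracket n N ψ).coeFn_toLp 1 volume] with x hx
  rw [hx, norm_mulBracket_apply]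

theorem expI_eq (x ξ : E n) :
    expI x ξ = Complex.exp (Complex.I * (Complex.ofRealCLM.comp (innerSL ℝ x)) ξ) := rfl

theorem norm_expI (x ξ : E n) : ‖expI x ξ‖ = 1 := by
  rw [expI, mul_comm]
  exact Complex.norm_exp_ofReal_mul_I _

theorem continuous_expI : Continuous fun p : E n × E n => expI p.1 p.2 := by
  unfold expI; fun_prop

/-- `∫ e^{ix·ξ} a(x, ξ) ψ(x) dx`. -/
def ampInt (a : E n × E n → ℂ) (ψ : 𝓢(E n, ℂ)) (ξ : E n) : ℂ :=
  ∫ x : E n, expI x ξ * a (x, ξ) * ψ x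

variable {m : ℕ} {a : E n × E n → ℂ}

theorem Amp.integrable (ha : Amp m a) (ψ : 𝓢(E n, ℂ)) (ξ : E n) :
    Integrable fun x => expI x ξ * a (x, ξ) * ψ x := by
  obtain ⟨C, hC, N, h⟩ := ha.exists_bound
  refine Integrable.mono' ((integrable_bracket_mul N ψ).const_mul (C * (1 + ‖ξ‖ ^ 2) ^ m)) ?_
    (ae_of_all _ fun x => ?_)
  · have hp : Continuous fun x : E n => (x, ξ) := continuous_id.prodMk continuous_const
    have h1 : Continuous fun x : E n => expI x ξ := (continuous_expI (n := n)).comp hp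
    have h2 : Continuous fun x : E n => a (x, ξ) := ha.smooth.continuous.comp hp
    exact ((h1.mul h2).mul ψ.continuous).aestronglyMeasurable
  · rw [norm_mul, norm_mul, norm_expI, one_mul]
    refine (mul_le_mul_of_nonneg_right (h (x, ξ)) (norm_nonneg _)).trans (le_of_eq ?_)
    ring

theorem Amp.norm_ampInt_le (ha : Amp m a) : ∃ C : ℝ, 0 ≤ C ∧ ∃ N : ℕ, ∀ ψ ξ,
    ‖ampInt a ψ ξ‖ ≤ (1 + ‖ξ‖ ^ 2) ^ m * (C * intSeminorm n N ψ) := by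
  obtain ⟨C, hC, N, h⟩ := ha.exists_bound
  refine ⟨C, hC, N, fun ψ ξ => ?_⟩
  rw [intSeminorm_apply, ← mul_assoc, ← integral_const_mul]
  refine norm_integral_le_of_norm_le ((integrable_bracket_mul N ψ).const_mul _)
    (ae_of_all _ fun x => ?_)
  rw [norm_mul, norm_mul, norm_expI, one_mul]
  refine (mul_le_mul_of_nonneg_right (h (x, ξ)) (norm_nonneg _)).trans (le_of_eq ?_)
  ring

/-- Multiplication by `ix_i`. -/
def mulCoord (i : Fin n) : 𝓢(E n, ℂ) →L[ℂ] 𝓢(E n, ℂ) :=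
  SchwartzMap.smulLeftCLM ℂ
    ⇑(Complex.I • Complex.ofRealCLM.comp (EuclideanSpace.proj i : E n →L[ℝ] ℝ))

theorem mulCoord_apply (i : Fin n) (ψ : 𝓢(E n, ℂ)) (x : E n) :
    mulCoord i ψ x = Complex.I * ((x i : ℝ) : ℂ) * ψ x :=
  SchwartzMap.smulLeftCLM_apply_apply (ContinuousLinearMap.hasTemperateGrowth _) ψ x

/-- The derivative in `ξ_i` hits the amplitude or brings down `ix_i`, which is absorbed by the
Schwartz function. Both terms are again integrals of the same type. -/
theorem Amp.dDir_ampInt (ha : Amp m a) (ψ : 𝓢(E n, ℂ)) (i : Fin n) (ξ : E n) :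
    DifferentiableAt ℝ (ampInt a ψ) ξ ∧
    dDir (unitVec i) (ampInt a ψ) ξ =
      ampInt (dDir (bdryBasis n (Sum.inr i)) a) ψ ξ + ampInt a (mulCoord i ψ) ξ := by
  have hb : ∀ i, bdryBasis n (Sum.inr i) = (0, unitVec i) := fun i => by
    rw [bdryBasis_eq, Sum.elim_inr]
  have hB : ∀ i, (EuclideanSpace.basisFun (Fin n) ℝ).toBasis i = unitVec i := fun i => by
    simp [unitVec]
  have hg : ∀ x ζ, DifferentiableAt ℝ (fun ζ => a (x, ζ)) ζ := fun x ζ =>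
    ((ha.smooth.differentiable (by simp)).comp (g := a)
      (differentiable_const x |>.prodMk differentiable_id)) ζ
  have hpart : ∀ x i ζ, dDir (unitVec i) (fun ζ => a (x, ζ)) ζ =
      dDir (bdryBasis n (Sum.inr i)) a (x, ζ) := by
    intro x i ζ
    have h1 : (fun ζ => a (x, ζ)) = fun ζ => a (ContinuousLinearMap.inr ℝ (E n) (E n) ζ + (x, 0)) := by
      ext ζ; simp
    rw [h1, dDir_comp_affine _ _ _ (ha.smooth.differentiable (by simp) _), hb]
    simp
  have hder : ∀ x i ζ, dDir (unitVec i) (fun ζ => expI x ζ * a (x, ζ) * ψ x) ζ =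
      expI x ζ * dDir (bdryBasis n (Sum.inr i)) a (x, ζ) * ψ x +
        expI x ζ * a (x, ζ) * mulCoord i ψ x := by
    intro x i ζ
    have h1 : (fun ζ => expI x ζ * a (x, ζ) * ψ x) = fun ζ => ψ x * (Complex.exp (Complex.I *
        (Complex.ofRealCLM.comp (innerSL ℝ x)) ζ) * a (x, ζ)) := by
      ext ζ; rw [expI_eq]; ring
    rw [h1, dDir_const_mul]
    simp only
    rw [dDir_exp_mul _ _ (hg x ζ), ← expI_eq, tw, hpart, mulCoord_apply]
    simp [unitVec, EuclideanSpace.inner_single_right]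
    ring
  obtain ⟨C, hC, N, h⟩ := ha.exists_bound
  choose C' hC' N' h' using fun i => (ha.deriv (Sum.inr i)).exists_bound
  -- On the unit ball about `ξ` the growth in the covariable is at most `K`, which gives a
  -- dominating function independent of the point of the ball.
  set K : ℝ := (1 + (‖ξ‖ + 1) ^ 2) ^ m with hK
  have hKle : ∀ ζ ∈ Metric.ball ξ 1, (1 + ‖ζ‖ ^ 2) ^ m ≤ K := by
    intro ζ hζ
    have h1 : ‖ζ‖ ≤ ‖ξ‖ + 1 := by
      have := norm_sub_norm_le ζ ξ
      rw [Metric.mem_ball, dist_eq_norm] at hζ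
      linarith
    rw [hK]
    gcongr
  have key := hasFDerivAt_integral_of_words (ρ := volume)
    (EuclideanSpace.basisFun (Fin n) ℝ).toBasis (U := Metric.ball ξ 1)
    (f := fun ζ x => expI x ζ * a (x, ζ) * ψ x) Metric.isOpen_ball
    (fun ζ _ => (ha.integrable ψ ζ).aestronglyMeasurable)
    (ae_of_all _ fun x ζ _ => by
      have h1 : DifferentiableAt ℝ (fun ζ => expI x ζ) ζ := by
        have : DifferentiableAt ℝ (fun ζ => Complex.exp (Complex.I *
          (Complex.ofRealCLM.comp (innerSL ℝ x)) ζ)) ζ := by fun_prop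
        exact this
      exact (h1.mul (hg x ζ)).mul_const _)
    (G := fun x => C * K * ((1 + ‖x‖ ^ 2) ^ N * ‖ψ x‖)) ((integrable_bracket_mul N ψ).const_mul _)
    (ae_of_all _ fun x ζ hζ => by
      rw [norm_mul, norm_mul, norm_expI, one_mul]
      refine (mul_le_mul_of_nonneg_right (h (x, ζ)) (norm_nonneg _)).trans ?_
      calc C * (1 + ‖x‖ ^ 2) ^ N * (1 + ‖ζ‖ ^ 2) ^ m * ‖ψ x‖
          ≤ C * (1 + ‖x‖ ^ 2) ^ N * K * ‖ψ x‖ := by gcongr; exact hKle ζ hζ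
        _ = _ := by ring)
    (H := fun i x => C' i * K * ((1 + ‖x‖ ^ 2) ^ N' i * ‖ψ x‖) +
      C * K * ((1 + ‖x‖ ^ 2) ^ N * ‖mulCoord i ψ x‖))
    (fun i => ((integrable_bracket_mul _ ψ).const_mul _).add
      ((integrable_bracket_mul _ (mulCoord i ψ)).const_mul _))
    (fun i => ae_of_all _ fun x ζ hζ => by
      rw [hB, hder]
      refine (norm_add_le _ _).trans (add_le_add ?_ ?_)
      · rw [norm_mul, norm_mul, norm_expI, one_mul]
        refine (mul_le_mul_of_nonneg_right (h' i (x, ζ)) (norm_nonneg _)).trans ?_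
        calc C' i * (1 + ‖x‖ ^ 2) ^ N' i * (1 + ‖ζ‖ ^ 2) ^ m * ‖ψ x‖
            ≤ C' i * (1 + ‖x‖ ^ 2) ^ N' i * K * ‖ψ x‖ := by
              have := hC' i
              gcongr; exact hKle ζ hζ
          _ = _ := by ring
      · rw [norm_mul, norm_mul, norm_expI, one_mul]
        refine (mul_le_mul_of_nonneg_right (h (x, ζ)) (norm_nonneg _)).trans ?_
        calc C * (1 + ‖x‖ ^ 2) ^ N * (1 + ‖ζ‖ ^ 2) ^ m * ‖mulCoord i ψ x‖
            ≤ C * (1 + ‖x‖ ^ 2) ^ N * K * ‖mulCoord i ψ x‖ := by gcongr; exact hKle ζ hζ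
          _ = _ := by ring)
    (Metric.mem_ball_self one_pos)
  refine ⟨key.1, ?_⟩
  have h2 := key.2 (unitVec i)
  simp only [hder] at h2
  rw [integral_add ((ha.deriv (Sum.inr i)).integrable ψ ξ) (ha.integrable (mulCoord i ψ) ξ)] at h2
  exact h2

/-- Since `ξ_i e^{ix·ξ} = -i ∂_{x_i} e^{ix·ξ}`, integration by parts moves the derivative onto the
amplitude and the Schwartz function. The growth exponent in `ξ` does not increase, which is the
source of all decay in `ξ`. -/
theorem Amp.coord_mul_ampInt (ha : Amp m a) (ψ : 𝓢(E n, ℂ)) (i : Fin n) (ξ : E n) :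
    ((ξ i : ℝ) : ℂ) * ampInt a ψ ξ = ampInt (dDir (bdryBasis n (Sum.inl i)) a) (Complex.I • ψ) ξ +
      ampInt a (Complex.I • ∂_{unitVec i} ψ) ξ := by
  have hb : bdryBasis n (Sum.inl i) = (unitVec i, 0) := by rw [bdryBasis_eq, Sum.elim_inl]
  have hg : ∀ x, DifferentiableAt ℝ (fun x => a (x, ξ)) x := fun x =>
    ((ha.smooth.differentiable (by simp)).comp (g := a)
      (differentiable_id.prodMk (differentiable_const ξ))) x
  have hpart : ∀ x, dDir (unitVec i) (fun x => a (x, ξ)) x =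
      dDir (bdryBasis n (Sum.inl i)) a (x, ξ) := by
    intro x
    have h1 : (fun x => a (x, ξ)) = fun x => a (ContinuousLinearMap.inl ℝ (E n) (E n) x + (0, ξ)) := by
      ext x; simp
    rw [h1, dDir_comp_affine _ _ _ (ha.smooth.differentiable (by simp) _), hb]
    simp
  have hd : ∀ x, DifferentiableAt ℝ (fun x => expI x ξ * a (x, ξ)) x := by
    intro x
    have h1 : DifferentiableAt ℝ (fun x => expI x ξ) x := by
      exact ((Complex.ofRealCLM.comp ((innerSL ℝ).flip ξ)).differentiableAt.const_mul _).cexp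
    exact h1.mul (hg x)
  have hder : ∀ x, fderiv ℝ (fun x => expI x ξ * a (x, ξ)) x (unitVec i) =
      expI x ξ * (dDir (bdryBasis n (Sum.inl i)) a (x, ξ) +
        Complex.I * ((ξ i : ℝ) : ℂ) * a (x, ξ)) := by
    intro x
    have h1 : dDir (unitVec i) (fun x => expI x ξ * a (x, ξ)) x =
        expI x ξ * tw (unitVec i) ((inner ℝ (unitVec i) ξ : ℝ) : ℂ) (fun x => a (x, ξ)) x :=
      dDir_exp_mul (Complex.ofRealCLM.comp ((innerSL ℝ).flip ξ)) (unitVec i) (hg x)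
    rw [tw, hpart] at h1
    simpa [dDir, unitVec, EuclideanSpace.inner_single_left] using h1
  have i1 := (ha.deriv (Sum.inl i)).integrable ψ ξ
  have i2 := ha.integrable ψ ξ
  have i3 := ha.integrable (∂_{unitVec i} ψ) ξ
  have e1 : (fun x => fderiv ℝ (fun x => expI x ξ * a (x, ξ)) x (unitVec i) * ψ x) = fun x =>
      expI x ξ * dDir (bdryBasis n (Sum.inl i)) a (x, ξ) * ψ x +
        Complex.I * ((ξ i : ℝ) : ℂ) * (expI x ξ * a (x, ξ) * ψ x) := by
    ext x; rw [hder]; ring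
  have key := integral_mul_fderiv_eq_neg_fderiv_mul_of_integrable (𝕜 := ℂ) (μ := volume)
    (f := fun x => expI x ξ * a (x, ξ)) (g := ψ) (v := unitVec i)
    (by rw [e1]; exact i1.add (i2.const_mul _)) (by simpa only [← SchwartzMap.lineDerivOp_apply_eq_fderiv] using i3) i2
    (fun x _ => hd x) (fun x _ => ψ.differentiable x)
  simp only [← SchwartzMap.lineDerivOp_apply_eq_fderiv] at key
  rw [e1, integral_add i1 (i2.const_mul _), integral_const_mul] at key
  have hI : ∀ (f : E n × E n → ℂ) (φ : 𝓢(E n, ℂ)), ampInt f (Complex.I • φ) ξ =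
      Complex.I * ampInt f φ ξ := by
    intro f φ
    rw [ampInt, ampInt, ← integral_const_mul]
    refine integral_congr_ae (ae_of_all _ fun x => ?_)
    simp only [smul_apply, smul_eq_mul]
    ring
  rw [hI, hI]
  change ampInt a (∂_{unitVec i} ψ) ξ = -(ampInt _ ψ ξ + Complex.I * ((ξ i : ℝ) : ℂ) * ampInt a ψ ξ) at key
  rw [key]
  linear_combination (((ξ i : ℝ) : ℂ) * ampInt a ψ ξ) * Complex.I_mul_I

end Amplitudes

/-! ### Oscillatory integrals as operators on Schwartz functions -/

section SchwartzOperators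

variable {n : ℕ}

/-- Sums of the maps `ψ ↦ ∫ e^{ix·ξ} a(x, ξ) (Aψ)(x) dx`. -/
inductive AmpMap (m : ℕ) : (𝓢(E n, ℂ) → E n → ℂ) → Prop
  | base {a : E n × E n → ℂ} (ha : Amp m a) (A : 𝓢(E n, ℂ) →L[ℂ] 𝓢(E n, ℂ)) :
      AmpMap m fun ψ => ampInt a (A ψ)
  | add {H₁ H₂ : 𝓢(E n, ℂ) → E n → ℂ} (h₁ : AmpMap m H₁) (h₂ : AmpMap m H₂) :
      AmpMap m fun ψ ξ => H₁ ψ ξ + H₂ ψ ξ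

variable {m : ℕ} {H : 𝓢(E n, ℂ) → E n → ℂ}

theorem AmpMap.zero : AmpMap (n := n) m fun _ _ => 0 := by
  have h := AmpMap.base (amp_zero (n := n) m) (ContinuousLinearMap.id ℂ _)
  have h0 : ampInt (n := n) (fun _ => 0) = fun _ _ => 0 := by
    ext ψ ξ
    simp [ampInt]
  rw [h0] at h
  exact h

theorem AmpMap.sum {ι : Type} (s : Finset ι) {F : ι → 𝓢(E n, ℂ) → E n → ℂ}
    (h : ∀ i, AmpMap m (F i)) : AmpMap m fun ψ ξ => ∑ i ∈ s, F i ψ ξ := by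
  classical
  induction s using Finset.induction_on with
  | empty => simpa using AmpMap.zero
  | insert i s hi ih => simpa only [Finset.sum_insert hi] using (h i).add ih

theorem AmpMap.deriv (h : AmpMap m H) (i : Fin n) :
    (∀ ψ, Differentiable ℝ (H ψ)) ∧ AmpMap m fun ψ => dDir (unitVec i) (H ψ) := by
  induction h with
  | @base a ha A =>
    refine ⟨fun ψ ξ => (ha.dDir_ampInt (A ψ) i ξ).1, ?_⟩
    have h := (AmpMap.base (ha.deriv (Sum.inr i)) A).add (AmpMap.base ha ((mulCoord i).comp A))
    convert h using 3 with ψ ξ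
    exact (ha.dDir_ampInt (A ψ) i ξ).2
  | add _ _ ih₁ ih₂ =>
    refine ⟨fun ψ => (ih₁.1 ψ).add (ih₂.1 ψ), ?_⟩
    convert ih₁.2.add ih₂.2 using 3 with ψ ξ
    change fderiv ℝ _ ξ (unitVec i) = _
    rw [fderiv_fun_add (ih₁.1 ψ ξ) (ih₂.1 ψ ξ)]
    rfl

theorem AmpMap.coord_mul (h : AmpMap m H) (i : Fin n) :
    AmpMap m fun ψ ξ => ((ξ i : ℝ) : ℂ) * H ψ ξ := by
  induction h with
  | @base a ha A =>
    have h := (AmpMap.base (ha.deriv (Sum.inl i)) (Complex.I • A)).add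
      (AmpMap.base ha (Complex.I • (LineDeriv.lineDerivOpCLM ℂ 𝓢(E n, ℂ) (unitVec i)).comp A))
    convert h using 3 with ψ ξ
    exact ha.coord_mul_ampInt (A ψ) i ξ
  | add _ _ ih₁ ih₂ =>
    simpa only [mul_add] using ih₁.add ih₂

/-- Because `1 + |ξ|² = 1 + ∑ ξ_i²`, repeated multiplication by coordinates suffices; the exponent
`m` stays the same for every `k`. -/
theorem AmpMap.bracket_mul (h : AmpMap m H) (k : ℕ) :
    AmpMap m fun ψ ξ => (((1 + ‖ξ‖ ^ 2) ^ k : ℝ) : ℂ) * H ψ ξ := by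
  induction k with
  | zero => simpa using h
  | succ k ih =>
    have h := ih.add (AmpMap.sum Finset.univ fun i => (ih.coord_mul i).coord_mul i)
    convert h using 3 with ψ ξ
    simp only [← mul_assoc, ← Finset.sum_mul]
    rw [EuclideanSpace.norm_sq_eq]
    push_cast
    simp only [Real.norm_eq_abs, ← Complex.ofReal_pow, sq_abs]
    push_cast
    rw [pow_succ]
    simp only [pow_two]
    ring

theorem AmpMap.exists_seminorm (h : AmpMap m H) : ∃ p : Seminorm ℂ 𝓢(E n, ℂ), Continuous p ∧
    ∀ ψ ξ, ‖H ψ ξ‖ ≤ (1 + ‖ξ‖ ^ 2) ^ m * p ψ := by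
  induction h with
  | @base a ha A =>
    obtain ⟨C, hC, N, hb⟩ := ha.norm_ampInt_le
    refine ⟨(C.toNNReal • intSeminorm n N).comp A.toLinearMap, ?_, fun ψ ξ => ?_⟩
    · exact ((continuous_intSeminorm n N).const_smul C.toNNReal).comp A.continuous
    · refine (hb (A ψ) ξ).trans (le_of_eq ?_)
      simp [NNReal.smul_def, hC]
  | add _ _ ih₁ ih₂ =>
    obtain ⟨p₁, c₁, h₁⟩ := ih₁
    obtain ⟨p₂, c₂, h₂⟩ := ih₂
    refine ⟨p₁ + p₂, c₁.add c₂, fun ψ ξ => ?_⟩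
    refine (norm_add_le _ _).trans ((add_le_add (h₁ ψ ξ) (h₂ ψ ξ)).trans (le_of_eq ?_))
    simp [mul_add]

/-- Multiplying by `(1 + |ξ|²)^(m + k)` preserves the growth bound of exponent `m`, so cancelling
`(1 + |ξ|²)^m` leaves decay of any chosen order `k`. -/
theorem AmpMap.exists_seminorm_decay (h : AmpMap m H) (k : ℕ) :
    ∃ p : Seminorm ℂ 𝓢(E n, ℂ), Continuous p ∧ ∀ ψ ξ, (1 + ‖ξ‖ ^ 2) ^ k * ‖H ψ ξ‖ ≤ p ψ := by
  obtain ⟨p, hp, hb⟩ := (h.bracket_mul (m + k)).exists_seminorm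
  refine ⟨p, hp, fun ψ ξ => ?_⟩
  have h1 := hb ψ ξ
  rw [norm_mul, Complex.norm_real, Real.norm_of_nonneg (by positivity), pow_add, mul_assoc] at h1
  exact le_of_mul_le_mul_left h1 (by positivity)

theorem fderiv_eq_sum_unitVec (f : E n → ℂ) (ξ : E n) :
    fderiv ℝ f ξ = ∑ i, ContinuousLinearMap.smulRightL ℝ (E n) ℂ (EuclideanSpace.proj i)
      (dDir (unitVec i) f ξ) := by
  ext v
  conv_lhs => rw [← (EuclideanSpace.basisFun (Fin n) ℝ).toBasis.sum_repr v]
  simp [dDir, unitVec, -Module.Basis.sum_repr]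

theorem AmpMap.contDiff (h : AmpMap m H) (ψ : 𝓢(E n, ℂ)) (N : ℕ) :
    ContDiff ℝ (N : ℕ∞) (H ψ) := by
  -- `AmpMap.deriv` yields differentiability only when some coordinate direction exists. In
  -- dimension zero every function is constant.
  rcases isEmpty_or_nonempty (Fin n) with he | ⟨⟨i₀⟩⟩
  · have hc : H ψ = fun _ => H ψ 0 := funext fun ξ => congrArg _ (Subsingleton.elim _ _)
    rw [hc]
    exact contDiff_const
  induction N generalizing H with
  | zero => exact contDiff_zero.2 ((h.deriv i₀).1 ψ).continuous
  | succ N ih =>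
    rw [show (((N + 1 : ℕ) : ℕ∞) : WithTop ℕ∞) = ((N : ℕ∞) : WithTop ℕ∞) + 1 by norm_cast,
      contDiff_succ_iff_fderiv]
    refine ⟨(h.deriv i₀).1 ψ, by simp, ?_⟩
    rw [funext (fderiv_eq_sum_unitVec (H ψ))]
    exact ContDiff.sum fun i _ => (ContinuousLinearMap.contDiff _).comp (ih (h.deriv i).2)

theorem seminorm_sum_apply {ι W : Type} [AddCommGroup W] [Module ℂ W] (s : Finset ι)
    (p : ι → Seminorm ℂ W) (x : W) : (∑ i ∈ s, p i) x = ∑ i ∈ s, p i x := by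
  classical
  induction s using Finset.induction_on with
  | empty => simp
  | insert i s hi ih => rw [Finset.sum_insert hi, Finset.sum_insert hi, _root_.add_apply, ih]

theorem norm_iteratedFDeriv_sum_le {ι V W : Type} [Fintype ι] [NormedAddCommGroup V]
    [NormedSpace ℝ V] [NormedAddCommGroup W] [NormedSpace ℝ W] {f : ι → V → W} {l : ℕ}
    (hf : ∀ i, ContDiff ℝ (l : ℕ∞) (f i)) (x : V) :
    ‖iteratedFDeriv ℝ l (fun y => ∑ i, f i y) x‖ ≤ ∑ i, ‖iteratedFDeriv ℝ l (f i) x‖ := by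
  rw [iteratedFDeriv_sum fun i _ => hf i, Finset.sum_apply]
  exact norm_sum_le _ _

/-- The class is closed under coordinate derivatives, so by induction on `l` higher derivatives obey
the same decay estimates. -/
theorem AmpMap.exists_seminorm_iteratedFDeriv (h : AmpMap m H) (k l : ℕ) :
    ∃ p : Seminorm ℂ 𝓢(E n, ℂ), Continuous p ∧
      ∀ ψ ξ, (1 + ‖ξ‖ ^ 2) ^ k * ‖iteratedFDeriv ℝ l (H ψ) ξ‖ ≤ p ψ := by
  induction l generalizing H with
  | zero => simpa using h.exists_seminorm_decay k
  | succ l ih =>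
    choose p hp hb using fun i => ih (h.deriv i).2
    set L : Fin n → ℂ →L[ℝ] (E n →L[ℝ] ℂ) := fun i =>
      ContinuousLinearMap.smulRightL ℝ (E n) ℂ (EuclideanSpace.proj i)
    have hsum : ∀ ψ, (∑ i, ‖L i‖₊ • p i) ψ = ∑ i, ‖L i‖ * p i ψ := by
      intro ψ
      rw [seminorm_sum_apply]
      rfl
    refine ⟨∑ i, ‖L i‖₊ • p i, ?_, fun ψ ξ => ?_⟩
    · simp_rw [funext hsum]
      exact continuous_finsetSum _ fun i _ => (hp i).const_mul _
    · have hs := fun i => (h.deriv i).2.contDiff ψ l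
      rw [← norm_iteratedFDeriv_fderiv, funext (fderiv_eq_sum_unitVec (H ψ)), hsum]
      refine (mul_le_mul_of_nonneg_left (norm_iteratedFDeriv_sum_le
        (f := fun i ξ => L i (dDir (unitVec i) (H ψ) ξ))
        (fun i => (L i).contDiff.comp (hs i)) ξ) (by positivity)).trans ?_
      rw [Finset.mul_sum]
      refine Finset.sum_le_sum fun i _ => ?_
      have h1 := (L i).norm_iteratedFDeriv_comp_left (hs i).contDiffAt (x := ξ) (n := l) le_rfl
      refine (mul_le_mul_of_nonneg_left h1 (by positivity)).trans ?_
      rw [mul_left_comm]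
      exact mul_le_mul_of_nonneg_left (hb i ψ ξ) (norm_nonneg _)

/-- The operator `ψ ↦ ∫ e^{ix·ξ} a(x, ξ) ψ(x) dx` on Schwartz functions. -/
def ampCLM {a : E n × E n → ℂ} (ha : Amp m a) : 𝓢(E n, ℂ) →L[ℂ] 𝓢(E n, ℂ) :=
  SchwartzMap.mkCLM (ampInt a)
    (fun f g ξ => by
      rw [ampInt, ampInt, ampInt, ← integral_add (ha.integrable f ξ) (ha.integrable g ξ)]
      refine integral_congr_ae (ae_of_all _ fun x => ?_)
      simp only [add_apply]
      ring)
    (fun c f ξ => by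
      rw [ampInt, ampInt, RingHom.id_apply, smul_eq_mul, ← integral_const_mul]
      refine integral_congr_ae (ae_of_all _ fun x => ?_)
      simp only [smul_apply, smul_eq_mul]
      ring)
    (fun f => contDiff_infty.2
      ((AmpMap.base ha (ContinuousLinearMap.id ℂ _)).contDiff f))
    (fun kl => by
      obtain ⟨p, hp, hb⟩ := (AmpMap.base ha
        (ContinuousLinearMap.id ℂ _)).exists_seminorm_iteratedFDeriv kl.1 kl.2
      obtain ⟨s, C, _, hC⟩ := Seminorm.bound_of_continuous (schwartz_withSeminorms ℂ _ _) p hp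
      refine ⟨s, C, C.2, fun f ξ => ?_⟩
      have h1 : ‖ξ‖ ^ kl.1 ≤ (1 + ‖ξ‖ ^ 2) ^ kl.1 :=
        pow_le_pow_left₀ (norm_nonneg _) (by nlinarith [sq_nonneg (‖ξ‖ - 1)]) _
      exact (mul_le_mul_of_nonneg_right h1 (norm_nonneg _)).trans ((hb f ξ).trans (hC f)))

/-- The dilation by `(2π)⁻¹`. -/
def dilation (n : ℕ) : E n ≃L[ℝ] E n :=
  ContinuousLinearEquiv.smulLeft (Units.mk0 (2 * Real.pi)⁻¹ (by positivity))

/-- The operator `g ↦ (2π)⁻ⁿ ∫ e^{-iy·ξ} g(ξ) dξ`. -/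
def scaledFourier (n : ℕ) : 𝓢(E n, ℂ) →L[ℂ] 𝓢(E n, ℂ) :=
  fourierConst n • (SchwartzMap.compCLMOfContinuousLinearEquiv ℂ (dilation n)).comp
    (FourierTransform.fourierCLM ℂ 𝓢(E n, ℂ))

theorem scaledFourier_apply (g : 𝓢(E n, ℂ)) (y : E n) :
    scaledFourier n g y = fourierConst n * ∫ ξ : E n, expI y (-ξ) * g ξ := by
  change fourierConst n * FourierTransform.fourier (⇑g) ((2 * Real.pi)⁻¹ • y) = _
  rw [Real.fourier_eq]
  congr 1
  refine integral_congr_ae (ae_of_all _ fun ξ => ?_)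
  simp only [Circle.smul_def, Real.fourierChar_apply, smul_eq_mul, expI]
  congr 2
  rw [inner_smul_right, inner_neg_right, real_inner_comm]
  have := Real.pi_ne_zero
  push_cast
  field_simp

theorem lineDeriv_scaledFourier (g : 𝓢(E n, ℂ)) (i : Fin n) :
    ∂_{unitVec i} (scaledFourier n g) = -scaledFourier n (mulCoord i g) := by
  have e : (-(2 * Real.pi * Complex.I) : ℂ) •
      SchwartzMap.smulLeftCLM ℂ (inner ℝ · (dilation n (unitVec i))) g = -mulCoord i g := by
    ext x
    have ht : (inner ℝ · (dilation n (unitVec i)) : E n → ℝ).HasTemperateGrowth := by fun_prop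
    have hd : dilation n (unitVec i) = (2 * Real.pi)⁻¹ • unitVec i := rfl
    rw [smul_apply, neg_apply, mulCoord_apply, SchwartzMap.smulLeftCLM_apply_apply ht, hd,
      inner_smul_right]
    simp [unitVec, EuclideanSpace.inner_single_right]
    have := Real.pi_ne_zero
    field_simp
  have hF : FourierTransform.fourier (-mulCoord i g) = -FourierTransform.fourier (mulCoord i g) :=
    map_neg (FourierTransform.fourierCLM ℂ 𝓢(E n, ℂ)) _
  change ∂_{unitVec i} (fourierConst n • SchwartzMap.compCLMOfContinuousLinearEquiv ℂ (dilation n)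
    (FourierTransform.fourier g)) = -(fourierConst n •
      SchwartzMap.compCLMOfContinuousLinearEquiv ℂ (dilation n)
        (FourierTransform.fourier (mulCoord i g)))
  rw [LineDeriv.lineDerivOp_smul, SchwartzMap.lineDerivOp_compCLMOfContinuousLinearEquiv,
    SchwartzMap.lineDerivOp_fourier_eq, e, hF, map_neg, smul_neg]

theorem opTranspose_eq {a : E n × E n → ℂ} (ha : Amp m a) (φ : 𝓢(E n, ℂ)) (y : E n) :
    scaledFourier n (ampCLM ha φ) y = opTranspose a φ y := by
  rw [scaledFourier_apply]
  rfl

end SchwartzOperators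

/-! ### The operator applied to layers -/

section Layers

variable {d : ℕ}

theorem measurePreserving_glue :
    MeasurePreserving (fun p : E d × ℝ => glue p.1 p.2) volume volume := by
  have h1 : MeasurePreserving (Prod.map (WithLp.ofLp : E d → Fin d → ℝ) (id : ℝ → ℝ))
      volume volume := (PiLp.volume_preserving_ofLp (Fin d)).prod (MeasurePreserving.id volume)
  have h2 : MeasurePreserving (Prod.swap : (Fin d → ℝ) × ℝ → ℝ × (Fin d → ℝ)) volume volume :=
    Measure.measurePreserving_swap
  have h3 := (volume_preserving_piFinSuccAbove (fun _ : Fin (d + 1) => ℝ) (Fin.last d)).symm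
  have h4 := PiLp.volume_preserving_toLp (Fin (d + 1))
  have e : (fun p : E d × ℝ => glue p.1 p.2) = WithLp.toLp 2 ∘
      (MeasurableEquiv.piFinSuccAbove (fun _ : Fin (d + 1) => ℝ) (Fin.last d)).symm ∘
        Prod.swap ∘ Prod.map WithLp.ofLp id := by
    ext p i
    refine Fin.lastCases ?_ (fun i => ?_) i <;>
      simp [MeasurableEquiv.piFinSuccAbove, Fin.insertNthEquiv]
  rw [e]
  exact h4.comp (h3.comp (h2.comp h1))

theorem measurableEmbedding_glue :
    MeasurableEmbedding (fun p : E d × ℝ => glue p.1 p.2) :=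
  Topology.IsClosedEmbedding.measurableEmbedding (by
    refine (Homeomorph.mk (Equiv.mk (fun p : E d × ℝ => glue p.1 p.2)
      (fun ξ => (tang ξ, ξ (Fin.last d))) (fun p => by simp) (fun ξ => by simp))
      continuous_glue ?_).isClosedEmbedding
    change Continuous fun ξ : E (d + 1) => (tang ξ, ξ (Fin.last d))
    unfold tang
    fun_prop)

theorem integral_glue {F : Type*} [NormedAddCommGroup F] [NormedSpace ℝ F] (f : E (d + 1) → F) :
    ∫ ξ, f ξ = ∫ p : E d × ℝ, f (glue p.1 p.2) :=
  (measurePreserving_glue.integral_comp measurableEmbedding_glue f).symm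

theorem continuous_tang : Continuous (tang : E (d + 1) → E d) := by
  unfold tang; fun_prop

/-- The Fourier transform `û` as a Schwartz function. -/
def hatSchwartz {n : ℕ} (u : 𝓢(E n, ℂ)) : 𝓢(E n, ℂ) := (fourierConst n)⁻¹ • scaledFourier n u

theorem fourierConst_ne_zero (n : ℕ) : fourierConst n ≠ 0 := by
  have := Real.pi_pos
  rw [fourierConst, Complex.ofReal_ne_zero]
  positivity

theorem expI_neg_comm {n : ℕ} (x ξ : E n) : expI x (-ξ) = expI ξ (-x) := by
  rw [expI, expI, inner_neg_right, inner_neg_right, real_inner_comm]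

theorem hatSchwartz_apply {n : ℕ} (u : 𝓢(E n, ℂ)) (ξ : E n) : hatSchwartz u ξ = hat u ξ := by
  rw [hatSchwartz, smul_apply, scaledFourier_apply, smul_eq_mul,
    inv_mul_cancel_left₀ (fourierConst_ne_zero n), hat]
  simp only [expI_neg_comm ξ]

theorem expI_glue (x ξ : E (d + 1)) : expI x ξ =
    expI (tang x) (tang ξ) * Complex.exp (Complex.I * (x (Fin.last d) * ξ (Fin.last d) : ℝ)) := by
  rw [expI, expI, ← Complex.exp_add, ← mul_add, ← Complex.ofReal_add]
  congr 3
  rw [PiLp.inner_apply, Fin.sum_univ_castSucc, PiLp.inner_apply]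
  simp [tang, mul_comm]

/-- Fubini: restricting `e^{-iy·ξ}` to `y_n = 0` removes `ξ_n` from the phase, and the integration
against `u` over `y'` produces `û(ξ')`. -/
theorem layer_scaledFourier (u : 𝓢(E d, ℂ)) (g : 𝓢(E (d + 1), ℂ)) :
    layer u (scaledFourier (d + 1) g) =
      fourierConst (d + 1) * ∫ ξ, hat u (tang ξ) * g ξ := by
  rw [layer_apply]
  simp only [scaledFourier_apply]
  have h0 : ∀ x' : E d, (fourierConst (d + 1) * ∫ ξ, expI (glue x' 0) (-ξ) * g ξ) * u x' =
      fourierConst (d + 1) * ∫ ξ, expI x' (-tang ξ) * u x' * g ξ := by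
    intro x'
    rw [mul_assoc, ← integral_mul_const]
    congr 2
    ext ξ
    rw [expI_glue]
    have : tang (-ξ) = -tang ξ := by ext i; simp [tang]
    simp [this]
    ring
  simp only [h0]
  rw [integral_const_mul, integral_integral_swap]
  · congr 2
    ext ξ
    rw [hat, integral_mul_const]
  · have h1 : Integrable (fun p : E d × E (d + 1) => u p.1 * g p.2) := u.integrable.mul_prod g.integrable
    refine h1.mono ?_ (ae_of_all _ fun p => ?_)
    · have h2 : Continuous fun p : E d × E (d + 1) => expI p.1 (-tang p.2) :=
        (continuous_expI (n := d)).comp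
          (continuous_fst.prodMk (continuous_tang.comp continuous_snd).neg)
      exact ((h2.mul (u.continuous.comp continuous_fst)).mul
        (g.continuous.comp continuous_snd)).aestronglyMeasurable
    · simp [Function.uncurry, norm_expI]

/-- The minus sign from the distributional derivative cancels the one from differentiating
`e^{-iy·ξ}`, so each derivative of `δ` becomes multiplication by `iξ_n`. -/
theorem layerDeriv_scaledFourier (u : 𝓢(E d, ℂ)) (j : ℕ) (g : 𝓢(E (d + 1), ℂ)) :
    layerDeriv u j (scaledFourier (d + 1) g) =
      layer u (scaledFourier (d + 1) ((mulCoord (Fin.last d))^[j] g)) := by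
  induction j generalizing g with
  | zero => rfl
  | succ j ih =>
    rw [layerDeriv, Function.iterate_succ_apply', Function.iterate_succ_apply, ← ih,
      TemperedDistribution.lineDerivOp_apply_apply, ← layerDeriv, lineDeriv_scaledFourier, neg_neg]

theorem mulCoord_iterate_ampCLM {m : ℕ} {a : E (d + 1) × E (d + 1) → ℂ} (ha : Amp m a)
    (φ : 𝓢(E (d + 1), ℂ)) (j : ℕ) (ξ : E (d + 1)) :
    (mulCoord (Fin.last d))^[j] (ampCLM ha φ) ξ = ampInt (mulA^[j] a) φ ξ := by
  induction j with
  | zero => rfl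
  | succ j ih =>
    rw [Function.iterate_succ_apply', Function.iterate_succ_apply', mulCoord_apply, ih, ampInt,
      ampInt, ← integral_const_mul]
    refine integral_congr_ae (ae_of_all _ fun x => ?_)
    simp only [mulA]
    ring

/-- The distribution `op(a)(u ⊗ δ^{(j)})`. -/
def opLayer {m : ℕ} {a : E (d + 1) × E (d + 1) → ℂ} (ha : Amp m a) (u : 𝓢(E d, ℂ)) (j : ℕ) :
    𝓢'(E (d + 1), ℂ) :=
  PointwiseConvergenceCLM.precomp ℂ ((scaledFourier (d + 1)).comp (ampCLM ha)) (layerDeriv u j)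

theorem isOpOfDistribution_opLayer {m : ℕ} {a : E (d + 1) × E (d + 1) → ℂ} (ha : Amp m a)
    (u : 𝓢(E d, ℂ)) (j : ℕ) : IsOpOfDistribution a (layerDeriv u j) (opLayer ha u j) :=
  fun φ => ⟨scaledFourier (d + 1) (ampCLM ha φ), opTranspose_eq ha φ, rfl⟩

/-- After pairing with `φ` the integral over `ξ` converges absolutely: `ampInt (mulA^[j] a) φ` is a
Schwartz function and `û(ξ')` is bounded. Divergence appears only when the integrations over `x` and
`ξ` are interchanged. -/
theorem opLayer_apply {m : ℕ} {a : E (d + 1) × E (d + 1) → ℂ} (ha : Amp m a) (u : 𝓢(E d, ℂ))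
    (j : ℕ) (φ : 𝓢(E (d + 1), ℂ)) :
    Integrable (fun ξ => hat u (tang ξ) * ampInt (mulA^[j] a) φ ξ) ∧
    opLayer ha u j φ =
      fourierConst (d + 1) * ∫ ξ, hat u (tang ξ) * ampInt (mulA^[j] a) φ ξ := by
  constructor
  · simp only [← mulCoord_iterate_ampCLM ha, ← hatSchwartz_apply]
    obtain ⟨C, hC⟩ := (hatSchwartz u).decay 0 0
    refine (SchwartzMap.integrable _).bdd_mul (c := C)
      ((hatSchwartz u).continuous.comp continuous_tang).aestronglyMeasurable
      (ae_of_all _ fun ξ => ?_)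
    simpa using hC.2 (tang ξ)
  · change layerDeriv u j (scaledFourier (d + 1) (ampCLM ha φ)) = _
    rw [layerDeriv_scaledFourier, layer_scaledFourier]
    simp only [mulCoord_iterate_ampCLM]

end Layers

/-! ### Oscillatory families -/

section OscillatoryFamilies

variable {d : ℕ}

/-- The linear form `x ↦ x'·ξ' + x_n z`. -/
def phase (ξ' : E d) (z : ℂ) : E (d + 1) →L[ℝ] ℂ :=
  Complex.ofRealCLM.comp (innerSL ℝ (bdryIncl d ξ')) +
    (EuclideanSpace.proj (Fin.last d) : E (d + 1) →L[ℝ] ℝ).smulRight z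

theorem phase_apply (ξ' : E d) (z : ℂ) (x : E (d + 1)) :
    phase ξ' z x = ((inner ℝ (tang x) ξ' : ℝ) : ℂ) + (x (Fin.last d) : ℂ) * z := by
  have : inner ℝ (bdryIncl d ξ') x = inner ℝ (tang x) ξ' := by
    rw [real_inner_comm, PiLp.inner_apply, Fin.sum_univ_castSucc, PiLp.inner_apply]
    simp [tang, bdryIncl]
  simp [phase, this]

theorem phase_unitVec_last (ξ' : E d) (z : ℂ) : phase ξ' z (unitVec (Fin.last d)) = z := by
  have : tang (unitVec (Fin.last d)) = 0 := by
    ext i; simp [tang, unitVec]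
  rw [phase_apply, this]
  simp [unitVec]

theorem norm_phase_unitVec_le (ξ' : E d) (z : ℂ) (i : Fin (d + 1)) :
    ‖phase ξ' z (unitVec i)‖ ≤ bracket ξ' * (1 + ‖z‖) := by
  have hb := one_le_bracket ξ'
  refine Fin.lastCases ?_ (fun i => ?_) i
  · rw [phase_unitVec_last]
    nlinarith [norm_nonneg z]
  · have h1 : tang (unitVec i.castSucc) = unitVec i := by
      rw [← bdryIncl_unitVec]
      exact tang_glue _ _
    have h2 : (unitVec i.castSucc : E (d + 1)) (Fin.last d) = 0 := by
      simp [unitVec, (Fin.castSucc_ne_last i).symm]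
    rw [phase_apply, h1, h2, Complex.ofReal_zero, zero_mul, add_zero, Complex.norm_real]
    have h3 : ‖inner ℝ (unitVec i) ξ'‖ ≤ ‖ξ'‖ := by
      refine (norm_inner_le_norm _ _).trans ?_
      simp [unitVec]
    have := norm_le_bracket ξ'
    nlinarith [norm_nonneg z]

/-- The modulus is `e^{-x_n Im z}`. This is the only place where the sign of `x_n` matters, and the
reason for closing contours in the upper half-plane. -/
theorem norm_exp_phase_le (ξ' : E d) {z : ℂ} (hz : 0 ≤ z.im) {x : E (d + 1)}
    (hx : 0 ≤ x (Fin.last d)) : ‖Complex.exp (Complex.I * phase ξ' z x)‖ ≤ 1 := by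
  rw [Complex.norm_exp, Real.exp_le_one_iff, phase_apply]
  simp
  positivity

theorem continuous_phase {c : E d × ℝ → ℂ} (hc : Continuous c) (x : E (d + 1)) :
    Continuous fun o : E d × ℝ => phase o.1 (c o) x := by
  simp only [phase_apply]
  fun_prop

/-- A family of smooth functions of `x`, all derivatives of which are dominated, after
multiplication by `(1 + |c|)^q`, by `⟨x⟩^N ⟨ξ'⟩^P (1 + s²)⁻¹`. -/
structure OscFamily (q : ℕ) (S : Set (E d × ℝ)) (c : E d × ℝ → ℂ)
    (f : E d × ℝ → E (d + 1) → ℂ) : Prop where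
  smooth : ∀ o ∈ S, ContDiff ℝ ∞ (f o)
  meas : ∀ x, AEStronglyMeasurable (fun o => f o x) (volume.restrict S)
  bound : ∀ L : List (Fin (d + 1)), ∃ C : ℝ, 0 ≤ C ∧ ∃ N P : ℕ, ∀ o ∈ S, ∀ x,
    ‖dList (L.map unitVec) (f o) x‖ * (1 + ‖c o‖) ^ q ≤
      C * bracket x ^ N * (bracket o.1 ^ P * (1 + o.2 ^ 2)⁻¹)

variable {q : ℕ} {S : Set (E d × ℝ)} {c : E d × ℝ → ℂ} {f : E d × ℝ → E (d + 1) → ℂ}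

theorem OscFamily.mono (h : OscFamily q S c f) {q' : ℕ} (hq : q' ≤ q) : OscFamily q' S c f where
  smooth := h.smooth
  meas := h.meas
  bound L := by
    obtain ⟨C, hC, N, P, hb⟩ := h.bound L
    refine ⟨C, hC, N, P, fun o ho x => le_trans ?_ (hb o ho x)⟩
    have : 1 ≤ 1 + ‖c o‖ := by linarith [norm_nonneg (c o)]
    gcongr

/-- The extra term contains a component of the phase covector, at most `⟨ξ'⟩(1 + |c|)`. Thus each
derivative uses up one unit of `q` and one power of `⟨ξ'⟩`, the latter harmless against the Schwartz
factor `v`. -/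
theorem OscFamily.bound_tw (h : OscFamily (q + 1) S c f) (i : Fin (d + 1))
    (L : List (Fin (d + 1))) : ∃ C : ℝ, 0 ≤ C ∧ ∃ N P : ℕ, ∀ o ∈ S, ∀ x,
    ‖dList (L.map unitVec) (SGBoundary.tw (unitVec i) (phase o.1 (c o) (unitVec i)) (f o)) x‖ *
      (1 + ‖c o‖) ^ q ≤ C * bracket x ^ N * (bracket o.1 ^ P * (1 + o.2 ^ 2)⁻¹) := by
  obtain ⟨C, hC, N, P, hb⟩ := h.bound (L ++ [i])
  obtain ⟨C', hC', N', P', hb'⟩ := h.bound L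
  refine ⟨C + C', by positivity, N + N', P + (P' + 1), fun o ho x => ?_⟩
  rw [dList_tw _ _ _ (h.smooth o ho).contDiffAt]
  have h1 := hb o ho x
  have h2 := hb' o ho x
  rw [List.map_append, List.map_singleton] at h1
  have hx := one_le_bracket x
  have hξ := one_le_bracket o.1
  have hc1 : 1 ≤ 1 + ‖c o‖ := by linarith [norm_nonneg (c o)]
  have hs : 0 < (1 + o.2 ^ 2)⁻¹ := by positivity
  have e1 : ‖dList (L.map unitVec ++ [unitVec i]) (f o) x‖ * (1 + ‖c o‖) ^ q ≤
      C * bracket x ^ (N + N') * (bracket o.1 ^ (P + (P' + 1)) * (1 + o.2 ^ 2)⁻¹) := by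
    calc _ ≤ ‖dList (L.map unitVec ++ [unitVec i]) (f o) x‖ * (1 + ‖c o‖) ^ (q + 1) := by
          gcongr
          omega
      _ ≤ _ := h1
      _ ≤ _ := by
          gcongr _ * ?_ * (?_ * _)
          · exact pow_le_pow_right₀ hx (by omega)
          · exact pow_le_pow_right₀ hξ (by omega)
  have e2 : ‖Complex.I * phase o.1 (c o) (unitVec i) * dList (L.map unitVec) (f o) x‖ *
      (1 + ‖c o‖) ^ q ≤
      C' * bracket x ^ (N + N') * (bracket o.1 ^ (P + (P' + 1)) * (1 + o.2 ^ 2)⁻¹) := by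
    rw [norm_mul, norm_mul, Complex.norm_I, one_mul]
    calc _ ≤ bracket o.1 * (1 + ‖c o‖) * ‖dList (L.map unitVec) (f o) x‖ * (1 + ‖c o‖) ^ q := by
          gcongr
          exact norm_phase_unitVec_le _ _ _
      _ = bracket o.1 * (‖dList (L.map unitVec) (f o) x‖ * (1 + ‖c o‖) ^ (q + 1)) := by
          rw [pow_succ]; ring
      _ ≤ bracket o.1 * (C' * bracket x ^ N' * (bracket o.1 ^ P' * (1 + o.2 ^ 2)⁻¹)) := by
          gcongr
      _ = C' * bracket x ^ N' * (bracket o.1 ^ (P' + 1) * (1 + o.2 ^ 2)⁻¹) := by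
          rw [pow_succ]; ring
      _ ≤ _ := by
          gcongr _ * ?_ * (?_ * _)
          · exact pow_le_pow_right₀ hx (by omega)
          · exact pow_le_pow_right₀ hξ (by omega)
  calc _ ≤ (‖dList (L.map unitVec ++ [unitVec i]) (f o) x‖ +
        ‖Complex.I * phase o.1 (c o) (unitVec i) * dList (L.map unitVec) (f o) x‖) *
          (1 + ‖c o‖) ^ q := by gcongr; exact norm_add_le _ _
    _ ≤ _ := by rw [add_mul, add_mul, add_mul]; exact add_le_add e1 e2

theorem OscFamily.tw (hS : MeasurableSet S) (hc : Continuous c) (h : OscFamily (q + 1) S c f)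
    (i : Fin (d + 1)) :
    OscFamily q S c fun o => SGBoundary.tw (unitVec i) (phase o.1 (c o) (unitVec i)) (f o) where
  smooth o ho := contDiff_tw _ _ (h.smooth o ho)
  meas x := by
    have h1 := aestronglyMeasurable_dDir (ρ := volume.restrict S) (f := fun x o => f o x)
      isOpen_univ (fun x _ => h.meas x) ((ae_restrict_iff' hS).2 (ae_of_all _ fun o ho p _ =>
        (h.smooth o ho).differentiable (by simp) p)) (unitVec i) x trivial
    have h2 : Continuous fun o : E d × ℝ => Complex.I * phase o.1 (c o) (unitVec i) :=
      continuous_const.mul (continuous_phase hc _)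
    exact h1.add (h2.aestronglyMeasurable.mul (h.meas x))
  bound L := h.bound_tw i L

theorem OscFamily.twList (hS : MeasurableSet S) (hc : Continuous c) (L : List (Fin (d + 1)))
    (h : OscFamily (q + L.length) S c f) :
    OscFamily q S c fun o => twList (phase o.1 (c o)) (L.map unitVec) (f o) := by
  induction L generalizing q with
  | nil => exact h
  | cons i L ih =>
    refine OscFamily.tw hS hc (ih (q := q + 1) ?_) i
    rw [List.length_cons] at h
    rwa [show q + 1 + L.length = q + (L.length + 1) by ring]

/-- The function `x ↦ ∫ v(ξ') e^{i(x'·ξ' + x_n c)} f(x) d(ξ', s)`. -/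
def oscInt (S : Set (E d × ℝ)) (c : E d × ℝ → ℂ) (v : 𝓢(E d, ℂ)) (f : E d × ℝ → E (d + 1) → ℂ)
    (x : E (d + 1)) : ℂ :=
  ∫ o in S, v o.1 * (Complex.exp (Complex.I * phase o.1 (c o) x) * f o x)

theorem integrable_schwartz_mul_inv (v : 𝓢(E d, ℂ)) (P : ℕ) :
    Integrable fun o : E d × ℝ => ‖v o.1‖ * (bracket o.1 ^ P * (1 + o.2 ^ 2)⁻¹) := by
  have h1 : Integrable fun ξ : E d => ‖v ξ‖ * bracket ξ ^ P := by
    refine (integrable_bracket_mul P v).mono' ?_ (ae_of_all _ fun ξ => ?_)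
    · exact (v.continuous.norm.mul (continuous_bracket.pow P)).aestronglyMeasurable
    · have := bracket_pos ξ
      rw [Real.norm_of_nonneg (by positivity), mul_comm]
      refine mul_le_mul_of_nonneg_right ?_ (norm_nonneg _)
      have := bracket_rpow_le_pow (x := ξ) (e := P) (N := P) le_rfl
      rwa [Real.rpow_natCast] at this
  have h2 := h1.mul_prod integrable_inv_one_add_sq
  rw [← Measure.volume_eq_prod] at h2
  simpa only [mul_assoc] using h2

theorem OscFamily.exists_bound (hIm : ∀ o ∈ S, 0 ≤ (c o).im) (h : OscFamily q S c f)
    (v : 𝓢(E d, ℂ)) : ∃ G : E d × ℝ → ℝ, Integrable G ∧ (∀ o, 0 ≤ G o) ∧ ∃ N : ℕ, ∀ o ∈ S,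
      ∀ x : E (d + 1), 0 ≤ x (Fin.last d) →
        ‖v o.1 * (Complex.exp (Complex.I * phase o.1 (c o) x) * f o x)‖ ≤ bracket x ^ N * G o := by
  obtain ⟨C, hC, N, P, hb⟩ := h.bound []
  refine ⟨fun o => C * (‖v o.1‖ * (bracket o.1 ^ P * (1 + o.2 ^ 2)⁻¹)),
    (integrable_schwartz_mul_inv v P).const_mul C, fun o => ?_, N, fun o ho x hx => ?_⟩
  · have := bracket_pos o.1
    positivity
  · have h1 := hb o ho x
    have h2 : ‖f o x‖ ≤ C * bracket x ^ N * (bracket o.1 ^ P * (1 + o.2 ^ 2)⁻¹) :=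
      (le_mul_of_one_le_right (norm_nonneg _)
        (one_le_pow₀ (by linarith [norm_nonneg (c o)]))).trans h1
    rw [norm_mul, norm_mul]
    calc _ ≤ ‖v o.1‖ * (1 * (C * bracket x ^ N * (bracket o.1 ^ P * (1 + o.2 ^ 2)⁻¹))) := by
          gcongr
          exact norm_exp_phase_le _ (hIm o ho) hx
      _ = _ := by ring

theorem OscFamily.aestronglyMeasurable (hc : Continuous c) (h : OscFamily q S c f)
    (v : 𝓢(E d, ℂ)) (x : E (d + 1)) : AEStronglyMeasurable
      (fun o => v o.1 * (Complex.exp (Complex.I * phase o.1 (c o) x) * f o x))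
      (volume.restrict S) := by
  have h1 : Continuous fun o : E d × ℝ => v o.1 := v.continuous.comp continuous_fst
  have h2 : Continuous fun o : E d × ℝ => Complex.exp (Complex.I * phase o.1 (c o) x) :=
    Complex.continuous_exp.comp (continuous_const.mul (continuous_phase hc x))
  exact h1.aestronglyMeasurable.mul (h2.aestronglyMeasurable.mul (h.meas x))

theorem OscFamily.integrableOn (hS : MeasurableSet S) (hc : Continuous c)
    (hIm : ∀ o ∈ S, 0 ≤ (c o).im) (h : OscFamily q S c f) (v : 𝓢(E d, ℂ)) {x : E (d + 1)}
    (hx : 0 ≤ x (Fin.last d)) :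
    IntegrableOn (fun o => v o.1 * (Complex.exp (Complex.I * phase o.1 (c o) x) * f o x)) S := by
  obtain ⟨G, hG, _, N, hb⟩ := h.exists_bound hIm v
  exact Integrable.mono' (hG.integrableOn.const_mul (bracket x ^ N))
    (h.aestronglyMeasurable hc v x)
    ((ae_restrict_iff' hS).2 (ae_of_all _ fun o ho => hb o ho x hx))

theorem isOpen_upperHalf : IsOpen (upperHalf d) := by
  have h : Continuous fun x : E (d + 1) => x (Fin.last d) := by fun_prop
  exact isOpen_lt continuous_const h

theorem dList_osc_term {o : E d × ℝ} (hf : ContDiff ℝ ∞ (f o)) (v : 𝓢(E d, ℂ)) (L : List (E (d + 1)))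
    (x : E (d + 1)) :
    dList L (fun x => v o.1 * (Complex.exp (Complex.I * phase o.1 (c o) x) * f o x)) x =
      v o.1 * (Complex.exp (Complex.I * phase o.1 (c o) x) *
        SGBoundary.twList (phase o.1 (c o)) L (f o) x) := by
  have h1 := dList_const_mul (v o.1) L
    (fun x => Complex.exp (Complex.I * phase o.1 (c o) x) * f o x)
  rw [dList_exp_mul _ _ hf] at h1
  exact congrFun h1 x

/-- Differentiation under the integral sign is done on unit balls about points of the half-space,
where the powers of `⟨x⟩` are bounded. The exponent `q` in the estimates is the number of
derivatives that the family can afford. -/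
theorem OscFamily.derivatives (hS : MeasurableSet S) (hc : Continuous c)
    (hIm : ∀ o ∈ S, 0 ≤ (c o).im) (h : OscFamily q S c f) (v : 𝓢(E d, ℂ)) :
    ContDiffOn ℝ (q : ℕ∞) (oscInt S c v f) (upperHalf d) ∧
    ∀ L : List (Fin (d + 1)), L.length ≤ q → ∀ x ∈ upperHalf d,
      dList (L.map unitVec) (oscInt S c v f) x =
        oscInt S c v (fun o => SGBoundary.twList (phase o.1 (c o)) (L.map unitVec) (f o)) x := by
  have hb : ⇑(EuclideanSpace.basisFun (Fin (d + 1)) ℝ).toBasis = unitVec := by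
    ext i : 1; simp [unitVec]
  have key : ∀ x₀ ∈ upperHalf d,
      ContDiffOn ℝ (q : ℕ∞) (oscInt S c v f) (upperHalf d ∩ Metric.ball x₀ 1) ∧
      ∀ L : List (Fin (d + 1)), L.length ≤ q → ∀ x ∈ upperHalf d ∩ Metric.ball x₀ 1,
        dList (L.map unitVec) (oscInt S c v f) x =
          oscInt S c v (fun o => SGBoundary.twList (phase o.1 (c o)) (L.map unitVec) (f o)) x := by
    intro x₀ hx₀
    have hbr : ∀ x ∈ upperHalf d ∩ Metric.ball x₀ 1, bracket x ≤ 2 + ‖x₀‖ := by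
      intro x hx
      have h1 := hx.2
      rw [Metric.mem_ball, dist_eq_norm] at h1
      have h2 := norm_sub_norm_le x x₀
      linarith [bracket_le x]
    have := contDiffOn_integral_of_words (ρ := volume.restrict S)
      (EuclideanSpace.basisFun (Fin (d + 1)) ℝ).toBasis q
      (f := fun x o => v o.1 * (Complex.exp (Complex.I * phase o.1 (c o) x) * f o x))
      (isOpen_upperHalf.inter (Metric.isOpen_ball (x := x₀) (ε := 1)))
      (fun x _ => h.aestronglyMeasurable hc v x)
      ((ae_restrict_iff' hS).2 (ae_of_all _ fun o ho x _ => by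
        refine contDiffAt_const.mul (ContDiffAt.mul ?_ (contDiffAt_infty.1
          (h.smooth o ho).contDiffAt q))
        exact (contDiff_const.mul (phase o.1 (c o)).contDiff).cexp.contDiffAt))
      (fun L hL => by
        obtain ⟨G, hG, hG0, N, hGb⟩ := OscFamily.exists_bound hIm
          (OscFamily.twList (q := 0) hS hc L (h.mono (by omega))) v
        refine ⟨fun o => (2 + ‖x₀‖) ^ N * G o, hG.integrableOn.const_mul _,
          (ae_restrict_iff' hS).2 (ae_of_all _ fun o ho x hx => ?_)⟩
        rw [hb, dList_osc_term (h.smooth o ho)]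
        refine (hGb o ho x (le_of_lt hx.1)).trans ?_
        refine mul_le_mul_of_nonneg_right ?_ (hG0 o)
        exact pow_le_pow_left₀ (bracket_pos x).le (hbr x hx) N)
    refine ⟨this.1, fun L hL x hx => ?_⟩
    have h2 := this.2 L hL x hx
    rw [hb] at h2
    refine h2.trans (setIntegral_congr_fun hS fun o ho => ?_)
    exact dList_osc_term (h.smooth o ho) v _ x
  refine ⟨fun x hx => ?_, fun L hL x hx => (key x hx).2 L hL x ⟨hx, Metric.mem_ball_self one_pos⟩⟩
  exact (((key x hx).1 x ⟨hx, Metric.mem_ball_self one_pos⟩).contDiffAt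
    ((isOpen_upperHalf.inter Metric.isOpen_ball).mem_nhds
      ⟨hx, Metric.mem_ball_self one_pos⟩)).contDiffWithinAt

/-- The dominating function remains valid at `x_n = 0`, so dominated convergence gives the boundary
value. -/
theorem OscFamily.tendsto_boundary (hS : MeasurableSet S) (hc : Continuous c)
    (hIm : ∀ o ∈ S, 0 ≤ (c o).im) (h : OscFamily q S c f) (v : 𝓢(E d, ℂ)) (x' : E d) :
    Tendsto (fun t : ℝ => oscInt S c v f (glue x' t)) (𝓝[>] 0) (𝓝 (oscInt S c v f (glue x' 0))) := by
  obtain ⟨G, hG, hG0, N, hGb⟩ := h.exists_bound hIm v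
  have hcg : Continuous fun t : ℝ => glue x' t :=
    (continuous_glue (d := d)).comp (continuous_const.prodMk continuous_id)
  refine tendsto_integral_filter_of_dominated_convergence (fun o => (bracket x' + 1) ^ N * G o)
    (Eventually.of_forall fun t => h.aestronglyMeasurable hc v _) ?_
    (hG.integrableOn.const_mul _) ((ae_restrict_iff' hS).2 (ae_of_all _ fun o ho => ?_))
  · filter_upwards [Ioo_mem_nhdsGT one_pos] with t ht
    refine (ae_restrict_iff' hS).2 (ae_of_all _ fun o ho => ?_)
    refine (hGb o ho _ (by rw [glue_last]; exact ht.1.le)).trans ?_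
    refine mul_le_mul_of_nonneg_right (pow_le_pow_left₀ (bracket_pos _).le ?_ N) (hG0 o)
    refine (bracket_glue_le x' t).trans ?_
    rw [abs_of_pos ht.1]
    linarith [ht.2]
  · have h1 : Continuous fun t : ℝ => v o.1 * (Complex.exp (Complex.I * phase o.1 (c o) (glue x' t)) *
        f o (glue x' t)) := by
      have := (h.smooth o ho).continuous.comp hcg
      have := (phase o.1 (c o)).continuous.comp hcg
      exact continuous_const.mul ((Complex.continuous_exp.comp (continuous_const.mul this)).mul
        ((h.smooth o ho).continuous.comp hcg))
    exact (h1.tendsto 0).mono_left nhdsWithin_le_nhds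

end OscillatoryFamilies

/-! ### The oscillatory families of a boundary value problem -/

section Pieces

variable {d : ℕ}

/-- The points `(ξ', s)` with `|s| < B⟨ξ'⟩`. -/
def inSet (d : ℕ) (B : ℝ) : Set (E d × ℝ) := {o | |o.2| < B * bracket o.1}

/-- The points `(ξ', s)` with `|s| ≥ B⟨ξ'⟩`. -/
def outSet (d : ℕ) (B : ℝ) : Set (E d × ℝ) := {o | B * bracket o.1 ≤ |o.2|}

/-- The points `(ξ', θ)` with `0 < θ ≤ π`. -/
def arcSet (d : ℕ) : Set (E d × ℝ) := {o | o.2 ∈ Set.Ioc 0 Real.pi}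

/-- The point `s` of the real line. -/
def linePt (o : E d × ℝ) : ℂ := (o.2 : ℂ)

/-- The point of argument `θ` on the circle of radius `B⟨ξ'⟩`. -/
def arcPt (B : ℝ) (o : E d × ℝ) : ℂ := circ (B * bracket o.1) o.2

/-- The function `x ↦ a(x, (ξ', s))`. -/
def lineFun (a : E (d + 1) × E (d + 1) → ℂ) (o : E d × ℝ) (x : E (d + 1)) : ℂ :=
  lineFam a o.2 (x, o.1)

/-- The function `x ↦ iz b(x, ξ', z)`, where `z` is on the circle of radius `B⟨ξ'⟩`. -/
def arcFun (B : ℝ) (b : E (d + 1) × E d × ℂ → ℂ) (o : E d × ℝ) (x : E (d + 1)) : ℂ :=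
  Complex.I * arcPt B o * compFam b (arcPt B o) (x, o.1)

theorem measurableSet_inSet (B : ℝ) : MeasurableSet (inSet d B) := by
  have := continuous_bracket (n := d)
  exact (isOpen_lt (f := fun o : E d × ℝ => |o.2|) (by fun_prop) (by fun_prop)).measurableSet

theorem measurableSet_outSet (B : ℝ) : MeasurableSet (outSet d B) := by
  have := continuous_bracket (n := d)
  exact (isClosed_le (g := fun o : E d × ℝ => |o.2|) (by fun_prop) (by fun_prop)).measurableSet

theorem measurableSet_arcSet : MeasurableSet (arcSet d) :=
  measurable_snd measurableSet_Ioc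

theorem continuous_linePt : Continuous (linePt (d := d)) := by
  unfold linePt; fun_prop

theorem continuous_arcPt (B : ℝ) : Continuous (arcPt (d := d) B) := by
  have := continuous_bracket (n := d)
  unfold arcPt circ; fun_prop

theorem norm_arcPt {B : ℝ} (hB : 0 < B) (o : E d × ℝ) : ‖arcPt B o‖ = B * bracket o.1 :=
  norm_circ (mul_pos hB (bracket_pos _)).le _

theorem linePt_im (o : E d × ℝ) : 0 ≤ (linePt o).im := by simp [linePt]

theorem arcPt_im {B : ℝ} (hB : 0 < B) : ∀ o ∈ arcSet d, 0 ≤ (arcPt B o).im := fun _ ho =>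
  circ_im_nonneg (mul_pos hB (bracket_pos _)).le ⟨ho.1.le, ho.2⟩

theorem GevOn.bound_words {Ω : Type} {μ ν m₂ m : ℝ} {T : Set (Ω × XV d)} {wt : Ω × XV d → ℝ}
    {F : Ω → XV d → ℂ} (h : GevOn μ ν m₂ m T wt F) (hw : ∀ q ∈ T, 1 ≤ wt q)
    (L : List (Fin (d + 1))) : ∃ C : ℝ, 0 ≤ C ∧ ∃ N : ℕ, ∀ q ∈ T, ContDiffAt ℝ ∞ (F q.1) q.2 →
      ‖dList (L.map unitVec) (fun x => F q.1 (x, q.2.2)) q.2.1‖ ≤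
        C * bracket q.2.1 ^ N * wt q ^ m := by
  obtain ⟨C, hC, D, hD, hb⟩ := h
  obtain ⟨N, hN⟩ := exists_nat_ge m₂
  set β : Fin (d + 1) → ℕ := fun i => L.count i
  refine ⟨C * D ^ (mlen (0 : Fin d → ℕ) + mlen β) * (mfac (0 : Fin d → ℕ) : ℝ) ^ μ *
    (mfac β : ℝ) ^ ν, by positivity, N, fun q hq hs => ?_⟩
  have h1 : (fun x => F q.1 (x, q.2.2)) = fun x =>
      F q.1 (ContinuousLinearMap.inl ℝ (E (d + 1)) (E d) x + (0, q.2.2)) := by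
    ext x; simp
  have hq2 : ContinuousLinearMap.inl ℝ (E (d + 1)) (E d) q.2.1 + (0, q.2.2) = q.2 := by
    ext <;> simp
  have h2 : ((L.map unitVec).map (ContinuousLinearMap.inl ℝ (E (d + 1)) (E d))).Perm
      (wordV β 0) := by
    rw [wordV, word_zero, List.append_nil, List.map_map]
    exact word_count_perm _ L
  rw [h1, dList_comp_affine _ _ _ (by rw [hq2]; exact contDiffAt_infty.1 hs _), hq2,
    dList_perm h2 (contDiffAt_infty.1 hs _)]
  refine (hb q hq β 0).trans ?_
  have hx : bracket q.2.1 ^ (m₂ - mlen β) ≤ bracket q.2.1 ^ N := by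
    rw [← Real.rpow_natCast]
    exact Real.rpow_le_rpow_of_exponent_le (one_le_bracket _)
      (by linarith [(Nat.cast_nonneg (mlen β) : (0 : ℝ) ≤ mlen β)])
  have hm : m - mlen (0 : Fin d → ℕ) = m := by simp [mlen]
  have hw0 : 0 < wt q := one_pos.trans_le (hw q hq)
  rw [hm]
  calc _ ≤ C * D ^ (mlen (0 : Fin d → ℕ) + mlen β) * (mfac (0 : Fin d → ℕ) : ℝ) ^ μ *
        (mfac β : ℝ) ^ ν * wt q ^ m * bracket q.2.1 ^ N := by gcongr
    _ = _ := by ring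

theorem rpow_le_natPow (m : ℝ) : ∃ P : ℕ, ∀ w : ℝ, 1 ≤ w → w ^ m ≤ w ^ P := by
  obtain ⟨P, hP⟩ := exists_nat_ge m
  refine ⟨P, fun w hw => ?_⟩
  rw [← Real.rpow_natCast]
  exact Real.rpow_le_rpow_of_exponent_le hw hP

variable {μ ν m m₂ B : ℝ} {M : ℕ} {a : E (d + 1) × E (d + 1) → ℂ} {b : E (d + 1) × E d × ℂ → ℂ}

/-- Here `|s| < B⟨ξ'⟩`, so all powers of `1 + |s|`, as well as the artificial factor `(1 +
s²)^(-1)`, cost only powers of `⟨ξ'⟩`. Any number `q` of derivatives is available. -/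
theorem BdryData.inFamily (hB : 0 < B) (h : BdryData μ ν m m₂ B M a b) (q : ℕ) :
    OscFamily q (inSet d B) linePt (lineFun a) where
  smooth o _ := by
    have : ContDiff ℝ ∞ (lineFam a o.2) :=
      contDiff_iff_contDiffAt.2 fun p => h.line_smooth o.2 p
    exact this.comp (contDiff_id.prodMk contDiff_const)
  meas x := by
    have : Continuous fun o : E d × ℝ => a (x, glue o.1 o.2) :=
      h.smooth.continuous.comp (continuous_const.prodMk (continuous_glue (d := d)))
    exact this.aestronglyMeasurable
  bound L := by
    obtain ⟨C, hC, N, hb⟩ := h.bound.bound_words (fun q _ => one_le_bracket _) L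
    obtain ⟨P, hP⟩ := rpow_le_natPow m
    refine ⟨C * (1 + B) ^ |m| * (1 + B) ^ (q + 2), by positivity, N, P + (q + 2),
      fun o ho x => ?_⟩
    have ho' : |o.2| < B * bracket o.1 := ho
    have h1 := hb (o.2, (x, o.1)) trivial (h.line_smooth _ _)
    have hw1 := one_le_bracket o.1
    have hw0 := bracket_pos o.1
    have hX := bracket_pos x
    have hwt : bracket (glue o.1 o.2) ^ m ≤ (1 + B) ^ |m| * bracket o.1 ^ P := by
      have h2 := rpow_sub_le_of_comparable hw0 (bracket_le_bracket_glue o.1 o.2)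
        (K := 1 + B) (by linarith) ((bracket_glue_le _ _).trans (by linarith)) m 0
      rw [Nat.cast_zero, sub_zero] at h2
      exact h2.trans (mul_le_mul_of_nonneg_left (hP _ hw1) (by positivity))
    have hs1 : 1 + |o.2| ≤ (1 + B) * bracket o.1 := by linarith
    have hs2 : 1 + o.2 ^ 2 ≤ ((1 + B) * bracket o.1) ^ 2 := by
      rw [← sq_abs]
      nlinarith [abs_nonneg o.2]
    have hs3 : 1 ≤ ((1 + B) * bracket o.1) ^ 2 * (1 + o.2 ^ 2)⁻¹ := by
      rw [← div_eq_mul_inv, one_le_div (by positivity)]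
      exact hs2
    have hn : ‖linePt o‖ = |o.2| := by simp [linePt]
    rw [hn]
    change ‖dList (L.map unitVec) (lineFun a o) x‖ ≤ C * bracket x ^ N * bracket (glue o.1 o.2) ^ m
      at h1
    calc _ ≤ C * bracket x ^ N * ((1 + B) ^ |m| * bracket o.1 ^ P) *
          ((1 + B) * bracket o.1) ^ q * (((1 + B) * bracket o.1) ^ 2 * (1 + o.2 ^ 2)⁻¹) := by
          refine le_trans ?_ (le_mul_of_one_le_right (by positivity) hs3)
          gcongr
          exact h1.trans (by gcongr)
      _ = _ := by rw [mul_pow, mul_pow, pow_add, pow_add (bracket o.1), pow_add (bracket o.1)]; ring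

/-- This is the only piece that limits the number of derivatives. The decay `⟨ξ⟩^(m-M)` has to pay
for `(1 + |s|)^q` and for the integrable factor `(1 + s²)^(-1)`. -/
theorem BdryData.outFamily (hB : 0 < B) (h : BdryData μ ν m m₂ B M a b) {q : ℕ}
    (hM : m - M ≤ -2 - q) :
    OscFamily q (outSet d B) linePt (lineFun fun p => a p - realRestrict b p) := by
  have hBs : ∀ o ∈ outSet d B, B ≤ |o.2| := fun o ho =>
    (le_mul_of_one_le_right hB.le (one_le_bracket _)).trans ho
  have hsm : ∀ o ∈ outSet d B, ∀ p : XV d,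
      ContDiffAt ℝ ∞ (lineFam (fun p => a p - realRestrict b p) o.2) p := fun o ho p =>
    contDiffAt_lineFam (h.smooth.contDiffAt.sub (h.real_smooth _ _ _ (hBs o ho)))
  refine ⟨fun o ho => ?_, fun x => ?_, fun L => ?_⟩
  · have : ContDiff ℝ ∞ (lineFam (fun p => a p - realRestrict b p) o.2) :=
      contDiff_iff_contDiffAt.2 (hsm o ho)
    exact this.comp (contDiff_id.prodMk contDiff_const)
  · refine ContinuousOn.aestronglyMeasurable (fun o ho => ?_) (measurableSet_outSet B)
    have hc : ContinuousAt (fun p => a p - realRestrict b p) (x, glue o.1 o.2) :=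
      (h.smooth.contDiffAt.sub (h.real_smooth _ _ _ (hBs o ho))).continuousAt
    have hg : Continuous fun o : E d × ℝ => (x, glue o.1 o.2) :=
      continuous_const.prodMk (continuous_glue (d := d))
    exact (ContinuousAt.comp (f := fun o : E d × ℝ => (x, glue o.1 o.2)) hc
      hg.continuousAt).continuousWithinAt
  · obtain ⟨C, hC, N, hb⟩ := h.rem_bound.bound_words (fun q _ => one_le_bracket _) L
    refine ⟨C * 2 ^ q, by positivity, N, 0, fun o ho x => ?_⟩
    have h1 := hb (o.2, (x, o.1)) (hBs o ho) (hsm o ho _)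
    change ‖dList (L.map unitVec) (lineFun _ o) x‖ ≤
      C * bracket x ^ N * bracket (glue o.1 o.2) ^ (m - M) at h1
    set y := bracket (glue o.1 o.2) with hy
    have hy1 : 1 ≤ y := one_le_bracket _
    have hy0 : 0 < y := by linarith
    have hX := bracket_pos x
    have hn : ‖linePt o‖ = |o.2| := by simp [linePt]
    have hs : 1 + |o.2| ≤ 2 * y := by linarith [abs_le_bracket_glue o.1 o.2]
    have he : y ^ (m - M) ≤ y ^ (-2 - q : ℝ) := Real.rpow_le_rpow_of_exponent_le hy1 hM
    have he2 : y ^ (-2 - q : ℝ) * y ^ q = y ^ (-2 : ℝ) := by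
      rw [← Real.rpow_natCast y q, ← Real.rpow_add hy0]
      congr 1
      ring
    rw [hn, pow_zero, one_mul]
    calc _ ≤ C * bracket x ^ N * y ^ (-2 - q : ℝ) * (2 * y) ^ q := by
          gcongr
          exact h1.trans (by gcongr)
      _ = C * 2 ^ q * bracket x ^ N * y ^ (-2 : ℝ) := by rw [← he2, mul_pow]; ring
      _ ≤ _ := by
          gcongr
          exact bracket_rpow_le o.1 le_rfl o.2

theorem BdryData.arcFamily (hB : 0 < B) (h : BdryData μ ν m m₂ B M a b) (q : ℕ) :
    OscFamily q (arcSet d) (arcPt B) (arcFun B b) := by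
  have hsm : ∀ (o : E d × ℝ) (x : E (d + 1)), ContDiffAt ℝ ∞ (compFam b (arcPt B o)) (x, o.1) :=
    fun o x => contDiffAt_compFam (h.circle_smooth _ _ _ (norm_arcPt hB o))
  have hsx : ∀ o : E d × ℝ, ContDiff ℝ ∞ fun x => compFam b (arcPt B o) (x, o.1) := fun o =>
    contDiff_iff_contDiffAt.2 fun x =>
      ContDiffAt.comp (g := compFam b (arcPt B o)) x (hsm o x)
        (contDiff_id.prodMk contDiff_const).contDiffAt
  refine ⟨fun o _ => contDiff_const.mul (hsx o), fun x => ?_, fun L => ?_⟩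
  · refine Continuous.aestronglyMeasurable (continuous_iff_continuousAt.2 fun o => ?_)
    have hc : ContinuousAt b (x, o.1, arcPt B o) :=
      (h.circle_smooth x o.1 _ (norm_arcPt hB o)).continuousAt
    have hg : Continuous fun o : E d × ℝ => ((x, o.1, arcPt B o) : E (d + 1) × E d × ℂ) :=
      continuous_const.prodMk (continuous_fst.prodMk (continuous_arcPt B))
    exact (continuous_const.mul (continuous_arcPt B)).continuousAt.mul
      (ContinuousAt.comp (f := fun o : E d × ℝ => ((x, o.1, arcPt B o) : E (d + 1) × E d × ℂ))
        hc hg.continuousAt)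
  · obtain ⟨C, hC, N, hb⟩ := h.circle_bound.bound_words (fun q _ => one_le_bracket _) L
    obtain ⟨P, hP⟩ := rpow_le_natPow m
    refine ⟨C * B * (1 + B) ^ q * (1 + Real.pi ^ 2), by positivity, N, P + (q + 1),
      fun o ho x => ?_⟩
    have h1 := hb (arcPt B o, (x, o.1)) (norm_arcPt hB o) (hsm o x)
    simp only at h1
    have hw1 := one_le_bracket o.1
    have hw0 := bracket_pos o.1
    have hX := bracket_pos x
    -- The second variable is an angle in `(0, π]`; the decay demanded by `OscFamily` is only a
    -- bounded factor there.
    have hs : 1 ≤ (1 + Real.pi ^ 2) * (1 + o.2 ^ 2)⁻¹ := by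
      rw [← div_eq_mul_inv, one_le_div (by positivity)]
      have := pow_le_pow_left₀ ho.1.le ho.2 2
      linarith
    have e : dList (L.map unitVec) (arcFun B b o) x = Complex.I * arcPt B o *
        dList (L.map unitVec) (fun x => compFam b (arcPt B o) (x, o.1)) x :=
      congrFun (dList_const_mul (Complex.I * arcPt B o) (L.map unitVec)
        (fun x => compFam b (arcPt B o) (x, o.1))) x
    rw [e, norm_mul, norm_mul, Complex.norm_I, one_mul, norm_arcPt hB]
    calc _ ≤ B * bracket o.1 * (C * bracket x ^ N * bracket o.1 ^ P) *
          ((1 + B) * bracket o.1) ^ q * ((1 + Real.pi ^ 2) * (1 + o.2 ^ 2)⁻¹) := by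
          refine le_trans ?_ (le_mul_of_one_le_right (by positivity) hs)
          gcongr
          · exact h1.trans (by gcongr; exact hP _ hw1)
          · linarith
      _ = _ := by rw [mul_pow, pow_add, pow_succ (bracket o.1) q]; ring

/-! ### Slices -/

theorem setIntegral_slices {S : Set (E d × ℝ)} (hS : MeasurableSet S) {F : E d × ℝ → ℂ}
    (hF : IntegrableOn F S) :
    Integrable (fun ξ' => ∫ s in {s | (ξ', s) ∈ S}, F (ξ', s)) ∧
      (∫ o in S, F o = ∫ ξ', ∫ s in {s | (ξ', s) ∈ S}, F (ξ', s)) ∧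
      ∀ᵐ ξ' : E d, IntegrableOn (fun s => F (ξ', s)) {s | (ξ', s) ∈ S} := by
  have h1 : Integrable (S.indicator F) ((volume : Measure (E d)).prod (volume : Measure ℝ)) := by
    rw [← Measure.volume_eq_prod]
    exact (integrable_indicator_iff hS).2 hF
  have h2 : ∀ ξ' : E d, ∫ s, S.indicator F (ξ', s) = ∫ s in {s | (ξ', s) ∈ S}, F (ξ', s) := by
    intro ξ'
    have hm : MeasurableSet {s | (ξ', s) ∈ S} := measurable_prodMk_left hS
    rw [← integral_indicator hm]
    rfl
  refine ⟨?_, ?_, ?_⟩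
  · simpa only [h2] using h1.integral_prod_left
  · rw [← integral_indicator hS, Measure.volume_eq_prod, integral_prod _ h1]
    simp only [h2]
  · filter_upwards [h1.prod_right_ae] with ξ' hξ
    have hm : MeasurableSet {s | (ξ', s) ∈ S} := measurable_prodMk_left hS
    exact (integrable_indicator_iff hm).1 hξ

theorem integral_add_three {Ω : Type*} [MeasurableSpace Ω] {ρ : Measure Ω} {f g h : Ω → ℂ}
    (hf : Integrable f ρ) (hg : Integrable g ρ) (hh : Integrable h ρ) :
    (∫ x, f x ∂ρ) + (∫ x, g x ∂ρ) + ∫ x, h x ∂ρ = ∫ x, (f x + g x + h x) ∂ρ := by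
  rw [← integral_add hf hg]
  exact (integral_add (hf.add hg) hh).symm

theorem phase_glue_zero (ξ' x' : E d) (z : ℂ) :
    Complex.exp (Complex.I * phase ξ' z (glue x' 0)) = expI x' ξ' := by
  rw [phase_apply, tang_glue, glue_last, Complex.ofReal_zero, zero_mul, add_zero, expI]

/-- At `x_n = 0` the phase no longer contains `z`, so `e^{ix'·ξ'}` comes out of the inner integral.
By Fubini that integral is the contour integral defining the boundary symbol. -/
theorem BdryData.oscInt_boundary (hB : 0 < B) (h : BdryData μ ν m m₂ B M a b) (hM : m - M ≤ -2)
    (v : 𝓢(E d, ℂ)) (x' : E d) :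
    oscInt (inSet d B) linePt v (lineFun a) (glue x' 0) +
      oscInt (arcSet d) (arcPt B) v (arcFun B b) (glue x' 0) +
      oscInt (outSet d B) linePt v (lineFun fun p => a p - realRestrict b p) (glue x' 0) =
    ∫ ξ', expI x' ξ' * bdrySym B a b (x', ξ') * v ξ' := by
  have hx : (0 : ℝ) ≤ glue x' 0 (Fin.last d) := by simp
  obtain ⟨i1, e1, _⟩ := setIntegral_slices (measurableSet_inSet B)
    ((h.inFamily hB 0).integrableOn (measurableSet_inSet B) continuous_linePt
      (fun o _ => linePt_im o) v hx)
  obtain ⟨i2, e2, _⟩ := setIntegral_slices measurableSet_arcSet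
    ((h.arcFamily hB 0).integrableOn measurableSet_arcSet (continuous_arcPt B)
      (arcPt_im hB) v hx)
  obtain ⟨i3, e3, _⟩ := setIntegral_slices (measurableSet_outSet B)
    ((h.outFamily hB (q := 0) (by simpa using hM)).integrableOn (measurableSet_outSet B)
      continuous_linePt (fun o _ => linePt_im o) v hx)
  rw [oscInt, oscInt, oscInt, e1, e2, e3, integral_add_three i1 i2 i3]
  refine integral_congr_ae (ae_of_all _ fun ξ' => ?_)
  simp only [phase_glue_zero, integral_const_mul]
  have s1 : {s | (ξ', s) ∈ inSet d B} = (outer (B * bracket ξ'))ᶜ := by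
    ext s; simp [inSet, outer]
  have s2 : {s | (ξ', s) ∈ arcSet d} = Set.Ioc 0 Real.pi := rfl
  have s3 : {s | (ξ', s) ∈ outSet d B} = outer (B * bracket ξ') := rfl
  rw [s1, s2, s3, bdrySym, bdryForm, arcInt, intervalIntegral.integral_of_le Real.pi_pos.le]
  have a1 : ∀ θ : ℝ, arcFun B b (ξ', θ) (glue x' 0) = compFam b (circ (B * bracket ξ') θ)
      (bdryMap d (x', ξ')) * (Complex.I * circ (B * bracket ξ') θ) := fun θ => mul_comm _ _
  simp only [a1]
  change v ξ' * (expI x' ξ' * ∫ s in (outer (B * bracket ξ'))ᶜ, lineFam a s (bdryMap d (x', ξ'))) +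
    v ξ' * (expI x' ξ' * _) + v ξ' * (expI x' ξ' * ∫ s in outer (B * bracket ξ'),
      lineFam (fun p => a p - realRestrict b p) s (bdryMap d (x', ξ'))) = _
  ring

end Pieces

/-! ### Regularization -/

section Regularization

/-- The regularizing factor `(1 - iεz)^(-N)`, holomorphic in the upper half-plane. -/
def chi (N : ℕ) (ε : ℝ) (z : ℂ) : ℂ := ((1 - Complex.I * ε * z) ^ N)⁻¹

theorem one_le_norm_chi_base {ε : ℝ} (hε : 0 < ε) {z : ℂ} (hz : 0 ≤ z.im) :
    1 ≤ ‖1 - Complex.I * ε * z‖ := by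
  have h1 : (1 - Complex.I * ε * z).re = 1 + ε * z.im := by simp
  have h2 := Complex.re_le_norm (1 - Complex.I * ε * z)
  rw [h1] at h2
  nlinarith [mul_nonneg hε.le hz]

theorem mul_norm_le_norm_chi_base {ε : ℝ} (hε : 0 < ε) {z : ℂ} (hz : 0 ≤ z.im) :
    ε * ‖z‖ ≤ ‖1 - Complex.I * ε * z‖ := by
  refine le_of_sq_le_sq ?_ (norm_nonneg _)
  rw [mul_pow, Complex.sq_norm, Complex.sq_norm, Complex.normSq_apply, Complex.normSq_apply]
  simp
  nlinarith [mul_nonneg hε.le hz]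

theorem chi_base_ne_zero {ε : ℝ} (hε : 0 < ε) {z : ℂ} (hz : 0 ≤ z.im) :
    1 - Complex.I * ε * z ≠ 0 :=
  norm_pos_iff.1 (one_pos.trans_le (one_le_norm_chi_base hε hz))

theorem norm_chi_le_one (N : ℕ) {ε : ℝ} (hε : 0 < ε) {z : ℂ} (hz : 0 ≤ z.im) :
    ‖chi N ε z‖ ≤ 1 := by
  rw [chi, norm_inv, norm_pow]
  exact inv_le_one_of_one_le₀ (one_le_pow₀ (one_le_norm_chi_base hε hz))

theorem norm_chi_le {N : ℕ} {ε : ℝ} (hε : 0 < ε) {z : ℂ} (hz : 0 ≤ z.im) (hz0 : z ≠ 0) :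
    ‖chi N ε z‖ ≤ ((ε * ‖z‖) ^ N)⁻¹ := by
  rw [chi, norm_inv, norm_pow]
  have : 0 < ε * ‖z‖ := mul_pos hε (norm_pos_iff.2 hz0)
  gcongr
  exact mul_norm_le_norm_chi_base hε hz

theorem norm_chi_real_le (p : ℕ) {ε : ℝ} (hε : 0 < ε) (hε1 : ε ≤ 1) (s : ℝ) :
    ‖chi (2 * p) ε s‖ ≤ (ε ^ 2)⁻¹ ^ p * (1 + s ^ 2)⁻¹ ^ p := by
  rw [chi, norm_inv, norm_pow, pow_mul, ← mul_pow, ← mul_inv, inv_pow]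
  have h : ε ^ 2 * (1 + s ^ 2) ≤ ‖1 - Complex.I * ε * s‖ ^ 2 := by
    rw [Complex.sq_norm, Complex.normSq_apply]
    simp
    nlinarith
  gcongr

theorem differentiableAt_chi (N : ℕ) {ε : ℝ} (hε : 0 < ε) {z : ℂ} (hz : 0 ≤ z.im) :
    DifferentiableAt ℂ (chi N ε) z := by
  refine DifferentiableAt.inv (by fun_prop) (pow_ne_zero _ (chi_base_ne_zero hε hz))

theorem measurable_chi (N : ℕ) (ε : ℝ) : Measurable (chi N ε) := by
  unfold chi; fun_prop

theorem tendsto_chi (N : ℕ) (z : ℂ) : Tendsto (fun ε : ℝ => chi N ε z) (𝓝[>] 0) (𝓝 1) := by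
  have h : ContinuousAt (fun ε : ℝ => chi N ε z) 0 := by
    refine ContinuousAt.inv₀ (by fun_prop) (by simp)
  have h0 : chi N ((0 : ℝ)) z = 1 := by simp [chi]
  have := h.tendsto.mono_left (nhdsWithin_le_nhds (s := Set.Ioi 0))
  simpa [h0] using this

variable {d : ℕ} {q : ℕ} {S : Set (E d × ℝ)} {c : E d × ℝ → ℂ} {f : E d × ℝ → E (d + 1) → ℂ}

theorem OscFamily.chi_mul (hc : Continuous c) (hIm : ∀ o ∈ S, 0 ≤ (c o).im)
    (h : OscFamily q S c f) (N : ℕ) {ε : ℝ} (hε : 0 < ε) :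
    OscFamily q S c fun o x => chi N ε (c o) * f o x where
  smooth o ho := contDiff_const.mul (h.smooth o ho)
  meas x := (((measurable_chi N ε).comp hc.measurable).aestronglyMeasurable).mul (h.meas x)
  bound L := by
    obtain ⟨C, hC, K, P, hb⟩ := h.bound L
    refine ⟨C, hC, K, P, fun o ho x => le_trans ?_ (hb o ho x)⟩
    rw [dList_const_mul, norm_mul]
    refine mul_le_mul_of_nonneg_right ?_ (by positivity)
    exact mul_le_of_le_one_left (norm_nonneg _) (norm_chi_le_one N hε (hIm o ho))

/-- The regularizing factor has modulus at most one on the contours used, so a single dominating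
function serves all `ε > 0`. The resulting bound is uniform in `ε` and polynomial in `x`, as needed
for integration against `φ`. -/
theorem OscFamily.tendsto_chi (hS : MeasurableSet S) (hc : Continuous c)
    (hIm : ∀ o ∈ S, 0 ≤ (c o).im) (h : OscFamily q S c f) (v : 𝓢(E d, ℂ)) (N : ℕ) :
    ∃ K : ℕ, ∃ C : ℝ, ∀ x : E (d + 1), 0 ≤ x (Fin.last d) →
      (∀ ε : ℝ, 0 < ε → ‖oscInt S c v (fun o x => chi N ε (c o) * f o x) x‖ ≤
        C * bracket x ^ K) ∧
      Tendsto (fun ε : ℝ => oscInt S c v (fun o x => chi N ε (c o) * f o x) x) (𝓝[>] 0)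
        (𝓝 (oscInt S c v f x)) := by
  obtain ⟨G, hG, hG0, K, hb⟩ := h.exists_bound hIm v
  have hb' : ∀ ε : ℝ, 0 < ε → ∀ o ∈ S, ∀ x : E (d + 1), 0 ≤ x (Fin.last d) →
      ‖v o.1 * (Complex.exp (Complex.I * phase o.1 (c o) x) * (chi N ε (c o) * f o x))‖ ≤
        bracket x ^ K * G o := by
    intro ε hε o ho x hx
    refine le_trans ?_ (hb o ho x hx)
    rw [mul_left_comm (Complex.exp _), mul_left_comm (v o.1), norm_mul]
    exact mul_le_of_le_one_left (norm_nonneg _) (norm_chi_le_one N hε (hIm o ho))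
  refine ⟨K, ∫ o in S, G o, fun x hx => ⟨fun ε hε => ?_, ?_⟩⟩
  · rw [mul_comm, ← integral_const_mul]
    exact norm_integral_le_of_norm_le (hG.integrableOn.const_mul _)
      ((ae_restrict_iff' hS).2 (ae_of_all _ fun o ho => hb' ε hε o ho x hx))
  · refine tendsto_integral_filter_of_dominated_convergence (fun o => bracket x ^ K * G o)
      ?_ ?_ (hG.integrableOn.const_mul _) (ae_of_all _ fun o => ?_)
    · filter_upwards [self_mem_nhdsWithin] with ε hε
      exact (h.chi_mul hc hIm N hε).aestronglyMeasurable hc v x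
    · filter_upwards [self_mem_nhdsWithin] with ε hε
      exact (ae_restrict_iff' hS).2 (ae_of_all _ fun o ho => hb' ε hε o ho x hx)
    · have := ((SGBoundary.tendsto_chi N (c o)).mul_const (f o x)).const_mul
        (Complex.exp (Complex.I * phase o.1 (c o) x))
      simpa using this.const_mul (v o.1)

end Regularization

/-! ### The distribution as a function in the half-space -/

section HalfSpace

variable {d : ℕ}

/-- The integrand of `W_ε`, see `regInt`. -/
def regTerm (N : ℕ) (ε : ℝ) (v : 𝓢(E d, ℂ)) (a : E (d + 1) × E (d + 1) → ℂ) (x : E (d + 1))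
    (o : E d × ℝ) : ℂ :=
  v o.1 * (Complex.exp (Complex.I * phase o.1 (linePt o) x) *
    (chi N ε (linePt o) * lineFun a o x))

/-- The function `W_ε(x) = ∫ e^{ix·ξ} (1 - iεξ_n)^(-N) a(x, ξ) v(ξ') dξ`. -/
def regInt (N : ℕ) (ε : ℝ) (v : 𝓢(E d, ℂ)) (a : E (d + 1) × E (d + 1) → ℂ) (x : E (d + 1)) : ℂ :=
  ∫ o, regTerm N ε v a x o

/-- The representation of `x ↦ ∫ e^{ix·ξ} a(x, ξ) v(ξ') dξ` in the half-space by contour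
integrals. -/
def halfSpaceFun (B : ℝ) (v : 𝓢(E d, ℂ)) (a : E (d + 1) × E (d + 1) → ℂ)
    (b : E (d + 1) × E d × ℂ → ℂ) (x : E (d + 1)) : ℂ :=
  oscInt (inSet d B) linePt v (lineFun a) x + oscInt (arcSet d) (arcPt B) v (arcFun B b) x +
    oscInt (outSet d B) linePt v (lineFun fun p => a p - realRestrict b p) x

theorem exp_phase_linePt (o : E d × ℝ) (x : E (d + 1)) :
    Complex.exp (Complex.I * phase o.1 (linePt o) x) = expI x (glue o.1 o.2) := by
  rw [phase_apply, expI_glue, tang_glue, glue_last, expI, ← Complex.exp_add, linePt]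
  congr 1
  push_cast
  ring

variable {p : ℕ} {a : E (d + 1) × E (d + 1) → ℂ} {b : E (d + 1) × E d × ℂ → ℂ}

/-- The exponent `2(p + 1)` gives decay `(1 + s²)^(-(p+1))` on the real line, which outweighs the
growth `(1 + s²)^p` of the amplitude and leaves an integrable factor. The constant depends on `ε`.
-/
theorem Amp.regTerm_bound (ha : Amp p a) (v : 𝓢(E d, ℂ)) {ε : ℝ} (hε : 0 < ε) (hε1 : ε ≤ 1) :
    ∃ C : ℝ, 0 ≤ C ∧ ∃ N : ℕ, ∀ o x, ‖regTerm (2 * (p + 1)) ε v a x o‖ ≤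
      C * (‖v o.1‖ * (bracket o.1 ^ (2 * p) * (1 + o.2 ^ 2)⁻¹)) * (1 + ‖x‖ ^ 2) ^ N := by
  obtain ⟨C, hC, N, h⟩ := ha.exists_bound
  refine ⟨C * (ε ^ 2)⁻¹ ^ (p + 1), by positivity, N, fun o x => ?_⟩
  have hgl : (1 + ‖glue o.1 o.2‖ ^ 2) ^ p ≤ bracket o.1 ^ (2 * p) * (1 + o.2 ^ 2) ^ p := by
    rw [pow_mul, ← mul_pow, bracket_sq, norm_glue_sq]
    refine pow_le_pow_left₀ (by positivity) ?_ p
    nlinarith [sq_nonneg (‖o.1‖ * o.2)]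
  have h1 := h (x, glue o.1 o.2)
  have h2 := norm_chi_real_le (p + 1) hε hε1 o.2
  rw [regTerm, exp_phase_linePt, norm_mul, norm_mul, norm_mul, norm_expI, one_mul]
  have hb := bracket_pos o.1
  have hs : (1 + o.2 ^ 2)⁻¹ ^ (p + 1) * (1 + o.2 ^ 2) ^ p = (1 + o.2 ^ 2)⁻¹ := by
    rw [pow_succ, mul_right_comm, ← mul_pow, inv_mul_cancel₀ (by positivity), one_pow, one_mul]
  calc _ ≤ ‖v o.1‖ * ((ε ^ 2)⁻¹ ^ (p + 1) * (1 + o.2 ^ 2)⁻¹ ^ (p + 1) *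
        (C * (1 + ‖x‖ ^ 2) ^ N * (bracket o.1 ^ (2 * p) * (1 + o.2 ^ 2) ^ p))) := by
        gcongr
        · exact h2
        · exact h1.trans (by gcongr)
    _ = C * (ε ^ 2)⁻¹ ^ (p + 1) * (‖v o.1‖ * (bracket o.1 ^ (2 * p) *
          ((1 + o.2 ^ 2)⁻¹ ^ (p + 1) * (1 + o.2 ^ 2) ^ p))) * (1 + ‖x‖ ^ 2) ^ N := by ring
    _ = _ := by rw [hs]

theorem Amp.continuous_regTerm (ha : Amp p a) (v : 𝓢(E d, ℂ)) (N : ℕ) {ε : ℝ} (hε : 0 < ε) :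
    Continuous fun w : (E d × ℝ) × E (d + 1) => regTerm N ε v a w.2 w.1 := by
  have h1 : Continuous fun w : (E d × ℝ) × E (d + 1) => v w.1.1 :=
    v.continuous.comp (continuous_fst.comp continuous_fst)
  have hg : Continuous fun w : (E d × ℝ) × E (d + 1) => glue w.1.1 w.1.2 :=
    (continuous_glue (d := d)).comp continuous_fst
  have hx : Continuous fun w : (E d × ℝ) × E (d + 1) => (w.2, glue w.1.1 w.1.2) :=
    continuous_snd.prodMk hg
  have h2 := (continuous_expI (n := d + 1)).comp hx
  have h3 : Continuous fun w : (E d × ℝ) × E (d + 1) => chi N ε (linePt w.1) := by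
    refine continuous_iff_continuousAt.2 fun w => ContinuousAt.comp (g := chi N ε)
      (differentiableAt_chi N hε (linePt_im w.1)).continuousAt ?_
    exact (continuous_linePt.comp continuous_fst).continuousAt
  have h4 := ha.smooth.continuous.comp hx
  simp only [regTerm, exp_phase_linePt]
  exact h1.mul (h2.mul (h3.mul h4))

theorem Amp.integrable_regTerm (ha : Amp p a) (v : 𝓢(E d, ℂ)) {ε : ℝ} (hε : 0 < ε) (hε1 : ε ≤ 1)
    (x : E (d + 1)) : Integrable (regTerm (2 * (p + 1)) ε v a x) := by
  obtain ⟨C, hC, N, h⟩ := ha.regTerm_bound v hε hε1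
  have hi := ((integrable_schwartz_mul_inv v (2 * p)).const_mul C).mul_const ((1 + ‖x‖ ^ 2) ^ N)
  refine hi.mono' ?_ (ae_of_all _ fun o => h o x)
  have hx : Continuous fun o : E d × ℝ => (o, x) := continuous_id.prodMk continuous_const
  exact ((ha.continuous_regTerm v _ hε).comp hx).aestronglyMeasurable

/-- With the regularizing factor the double integral converges absolutely, so Fubini interchanges
`x` and `ξ` and exhibits the regularized pairing as integration of a function against `φ`. -/
theorem Amp.integral_reg (ha : Amp p a) (v : 𝓢(E d, ℂ)) (φ : 𝓢(E (d + 1), ℂ)) {ε : ℝ}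
    (hε : 0 < ε) (hε1 : ε ≤ 1) :
    Integrable (fun x => regInt (2 * (p + 1)) ε v a x * φ x) ∧
    ∫ ξ, v (tang ξ) * (chi (2 * (p + 1)) ε (ξ (Fin.last d)) * ampInt a φ ξ) =
      ∫ x, regInt (2 * (p + 1)) ε v a x * φ x := by
  obtain ⟨C, hC, N, h⟩ := ha.regTerm_bound v hε hε1
  have hi : Integrable (fun w : (E d × ℝ) × E (d + 1) =>
      regTerm (2 * (p + 1)) ε v a w.2 w.1 * φ w.2) (volume.prod volume) := by
    refine (((integrable_schwartz_mul_inv v (2 * p)).const_mul C).mul_prod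
      (integrable_bracket_mul N φ)).mono' ?_ (ae_of_all _ fun w => ?_)
    · exact ((ha.continuous_regTerm v _ hε).mul
        (φ.continuous.comp continuous_snd)).aestronglyMeasurable
    · rw [norm_mul, ← mul_assoc]
      exact mul_le_mul_of_nonneg_right (h w.1 w.2) (norm_nonneg _)
  refine ⟨?_, ?_⟩
  · have := hi.integral_prod_right
    simpa only [integral_mul_const, regInt] using this
  · rw [integral_glue]
    have e1 : ∀ o : E d × ℝ, v (tang (glue o.1 o.2)) * (chi (2 * (p + 1)) ε
        (glue o.1 o.2 (Fin.last d)) * ampInt a φ (glue o.1 o.2)) =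
        ∫ x, regTerm (2 * (p + 1)) ε v a x o * φ x := by
      intro o
      rw [tang_glue, glue_last, ampInt, ← integral_const_mul, ← integral_const_mul]
      refine integral_congr_ae (ae_of_all _ fun x => ?_)
      simp only [regTerm, exp_phase_linePt]
      simp only [lineFun, lineFam, linePt]
      ring
    simp only [e1]
    rw [integral_integral_swap hi]
    simp only [integral_mul_const, regInt]

theorem Amp.tendsto_reg (φ : 𝓢(E (d + 1), ℂ)) {v : 𝓢(E d, ℂ)}
    (hi : Integrable fun ξ => v (tang ξ) * ampInt a φ ξ) (N : ℕ) :
    Tendsto (fun ε : ℝ => ∫ ξ, v (tang ξ) * (chi N ε (ξ (Fin.last d)) * ampInt a φ ξ)) (𝓝[>] 0)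
      (𝓝 (∫ ξ, v (tang ξ) * ampInt a φ ξ)) := by
  have hc : Measurable fun ξ : E (d + 1) => ((ξ (Fin.last d) : ℝ) : ℂ) := by
    have : Continuous fun ξ : E (d + 1) => ((ξ (Fin.last d) : ℝ) : ℂ) := by fun_prop
    exact this.measurable
  have e : ∀ (ε : ℝ) (ξ : E (d + 1)), v (tang ξ) * (chi N ε (ξ (Fin.last d)) * ampInt a φ ξ) =
      chi N ε (ξ (Fin.last d)) * (v (tang ξ) * ampInt a φ ξ) := fun ε ξ => by ring
  simp only [e]
  refine tendsto_integral_filter_of_dominated_convergence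
    (fun ξ => ‖v (tang ξ) * ampInt a φ ξ‖) ?_ ?_ hi.norm (ae_of_all _ fun ξ => ?_)
  · exact Eventually.of_forall fun ε =>
      (((measurable_chi N ε).comp hc).aestronglyMeasurable).mul hi.aestronglyMeasurable
  · filter_upwards [self_mem_nhdsWithin] with ε hε
    refine ae_of_all _ fun ξ => ?_
    rw [norm_mul]
    exact mul_le_of_le_one_left (norm_nonneg _) (norm_chi_le_one N hε (by simp))
  · simpa using (tendsto_chi N (ξ (Fin.last d) : ℂ)).mul_const (v (tang ξ) * ampInt a φ ξ)

variable {μ ν m m₂ B : ℝ} {M K : ℕ}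

/-- In the closed upper half-plane the exponential is bounded, `b` grows like `|z|^K`, and the
regularizing factor decays like `|z|^(-N)`. With `N ≥ K + 2` the integrand is `O(|z|^(-2))`, and the
contour can be closed. -/
theorem regularized_contour (hB : 0 < B) {x : E (d + 1)} (hx : 0 ≤ x (Fin.last d)) (ξ' : E d)
    (hol : ∀ z : ℂ, B * bracket ξ' ≤ ‖z‖ → DifferentiableAt ℂ (fun z => b (x, ξ', z)) z)
    (hg : (fun z => b (x, ξ', z)) =O[Bornology.cobounded ℂ] fun z => z ^ K) {N : ℕ}
    (hN : K + 2 ≤ N) {ε : ℝ} (hε : 0 < ε) (v : ℂ)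
    (hi : IntegrableOn (fun s : ℝ => v * (Complex.exp (Complex.I * phase ξ' s x) *
      (chi N ε s * compFam b s (x, ξ')))) (outer (B * bracket ξ'))) :
    ∫ s in outer (B * bracket ξ'), v * (Complex.exp (Complex.I * phase ξ' s x) *
      (chi N ε s * compFam b s (x, ξ'))) =
    arcInt (fun z => v * (Complex.exp (Complex.I * phase ξ' z x) *
      (chi N ε z * compFam b z (x, ξ')))) (B * bracket ξ') := by
  obtain ⟨C, hC⟩ := hg.bound
  obtain ⟨ρ, -, hρ⟩ := (Filter.hasBasis_cobounded_norm (E := ℂ)).eventually_iff.1 hC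
  refine integral_outer_eq_arcInt
    (g := fun z => v * (Complex.exp (Complex.I * phase ξ' z x) * (chi N ε z * compFam b z (x, ξ'))))
    (mul_pos hB (bracket_pos _)) (fun z hz him => ?_) hi
    (C := ‖v‖ * ((ε ^ N)⁻¹ * |C|)) (ρ := max ρ 1) (fun z hz him => ?_)
  · have h1 : DifferentiableAt ℂ (fun z => Complex.exp (Complex.I * phase ξ' z x)) z := by
      simp only [phase_apply]
      fun_prop
    exact (h1.mul ((differentiableAt_chi N hε him).mul (hol z hz))).const_mul v
  · have hz1 : 1 ≤ ‖z‖ := (le_max_right _ _).trans hz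
    have hz0 : z ≠ 0 := norm_pos_iff.1 (by linarith)
    have h1 := hρ (x := z) ((le_max_left _ _).trans hz)
    have h2 := norm_chi_le (N := N) hε him hz0
    rw [norm_pow] at h1
    rw [norm_mul, norm_mul, norm_mul, mul_div_assoc]
    refine mul_le_mul_of_nonneg_left ?_ (norm_nonneg _)
    calc _ ≤ 1 * (((ε * ‖z‖) ^ N)⁻¹ * (|C| * ‖z‖ ^ K)) := by
          gcongr
          · exact norm_exp_phase_le ξ' him hx
          · exact h1.trans (by gcongr; exact le_abs_self C)
      _ = (ε ^ N)⁻¹ * |C| * (‖z‖ ^ K / ‖z‖ ^ N) := by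
          rw [mul_pow, mul_inv]; ring
      _ ≤ (ε ^ N)⁻¹ * |C| * (1 / ‖z‖ ^ 2) := by
          refine mul_le_mul_of_nonneg_left ?_ (by positivity)
          rw [div_le_div_iff₀ (by positivity) (by positivity), one_mul, ← pow_add]
          exact pow_le_pow_right₀ hz1 hN
      _ = _ := by rw [mul_one_div]

/-- On the outer set the regularized integrand is split into the part with `b` and the remainder.
The part with `b` is replaced, for almost every `ξ'`, by the integral over the arc. -/
theorem BdryData.regInt_eq (hB : 0 < B) (h : BdryData μ ν m m₂ B M a b) (hM : m - M ≤ -2)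
    (ha : Amp p a) (hK : K ≤ 2 * p)
    (hol : ∀ (x : E (d + 1)) (ξ' : E d) (z : ℂ), B * bracket ξ' ≤ ‖z‖ →
      DifferentiableAt ℂ (fun z => b (x, ξ', z)) z)
    (hg : ∀ (x : E (d + 1)) (ξ' : E d),
      (fun z => b (x, ξ', z)) =O[Bornology.cobounded ℂ] fun z => z ^ K)
    (v : 𝓢(E d, ℂ)) {x : E (d + 1)} (hx : 0 ≤ x (Fin.last d)) {ε : ℝ} (hε : 0 < ε) (hε1 : ε ≤ 1) :
    regInt (2 * (p + 1)) ε v a x =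
      oscInt (inSet d B) linePt v (fun o x => chi (2 * (p + 1)) ε (linePt o) * lineFun a o x) x +
      oscInt (arcSet d) (arcPt B) v
        (fun o x => chi (2 * (p + 1)) ε (arcPt B o) * arcFun B b o x) x +
      oscInt (outSet d B) linePt v (fun o x => chi (2 * (p + 1)) ε (linePt o) *
        lineFun (fun p => a p - realRestrict b p) o x) x := by
  set N := 2 * (p + 1) with hNdef
  have hFa := ha.integrable_regTerm v hε hε1 x
  have hFr := ((h.outFamily hB (q := 0) (by simpa using hM)).chi_mul continuous_linePt
    (fun o _ => linePt_im o) N hε).integrableOn (measurableSet_outSet B) continuous_linePt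
      (fun o _ => linePt_im o) v hx
  have hFarc := ((h.arcFamily hB 0).chi_mul (continuous_arcPt B) (arcPt_im hB) N hε).integrableOn
    measurableSet_arcSet (continuous_arcPt B) (arcPt_im hB) v hx
  set Fb : E d × ℝ → ℂ := fun o => v o.1 * (Complex.exp (Complex.I * phase o.1 (linePt o) x) *
    (chi N ε (linePt o) * compFam b (linePt o) (x, o.1))) with hFb
  have hdiff : ∀ o : E d × ℝ, regTerm N ε v a x o = Fb o + v o.1 *
      (Complex.exp (Complex.I * phase o.1 (linePt o) x) * (chi N ε (linePt o) *
        lineFun (fun p => a p - realRestrict b p) o x)) := by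
    intro o
    have e : lineFun (fun p => a p - realRestrict b p) o x =
        lineFun a o x - compFam b (linePt o) (x, o.1) := by
      rw [linePt, ← lineFam_realRestrict]
      rfl
    rw [e, regTerm, hFb]
    ring
  -- Integrability of the part with `b` comes from that of the other two terms, so no estimate of
  -- `b` on the real line is needed here.
  have hFbi : IntegrableOn Fb (outSet d B) := by
    refine (hFa.integrableOn.sub hFr).congr (ae_of_all _ fun o => ?_)
    exact sub_eq_of_eq_add (hdiff o)
  have hcompl : (inSet d B)ᶜ = outSet d B := by
    ext o; simp [inSet, outSet]
  have e1 : regInt N ε v a x = (∫ o in inSet d B, regTerm N ε v a x o) +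
      ((∫ o in outSet d B, Fb o) + ∫ o in outSet d B, v o.1 *
        (Complex.exp (Complex.I * phase o.1 (linePt o) x) * (chi N ε (linePt o) *
          lineFun (fun p => a p - realRestrict b p) o x))) := by
    rw [regInt, ← integral_add_compl (measurableSet_inSet B) hFa, hcompl, ← integral_add hFbi hFr]
    congr 1
    exact integral_congr_ae (ae_of_all _ hdiff)
  obtain ⟨-, s1, ae1⟩ := setIntegral_slices (measurableSet_outSet B) hFbi
  obtain ⟨-, s2, -⟩ := setIntegral_slices measurableSet_arcSet hFarc
  have e2 : ∫ o in outSet d B, Fb o = oscInt (arcSet d) (arcPt B) v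
      (fun o x => chi N ε (arcPt B o) * arcFun B b o x) x := by
    rw [s1, oscInt, s2]
    refine integral_congr_ae ?_
    filter_upwards [ae1] with ξ' hξ'
    have := regularized_contour hB hx ξ' (hol x ξ') (hg x ξ') (N := N) (by omega) hε (v ξ') hξ'
    rw [arcInt, intervalIntegral.integral_of_le Real.pi_pos.le] at this
    refine this.trans (integral_congr_ae (ae_of_all _ fun θ => ?_))
    simp only [arcFun, arcPt]
    ring
  rw [e1, e2, oscInt, oscInt, oscInt]
  simp only [regTerm]
  ring

theorem BdryData.tendsto_regInt (hB : 0 < B) (h : BdryData μ ν m m₂ B M a b) (hM : m - M ≤ -2)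
    (ha : Amp p a) (hK : K ≤ 2 * p)
    (hol : ∀ (x : E (d + 1)) (ξ' : E d) (z : ℂ), B * bracket ξ' ≤ ‖z‖ →
      DifferentiableAt ℂ (fun z => b (x, ξ', z)) z)
    (hg : ∀ (x : E (d + 1)) (ξ' : E d),
      (fun z => b (x, ξ', z)) =O[Bornology.cobounded ℂ] fun z => z ^ K)
    (v : 𝓢(E d, ℂ)) : ∃ C : ℝ, 0 ≤ C ∧ ∃ L : ℕ, ∀ x : E (d + 1), 0 ≤ x (Fin.last d) →
      (∀ ε : ℝ, 0 < ε → ε ≤ 1 → ‖regInt (2 * (p + 1)) ε v a x‖ ≤ C * (1 + ‖x‖ ^ 2) ^ L) ∧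
      Tendsto (fun ε : ℝ => regInt (2 * (p + 1)) ε v a x) (𝓝[>] 0)
        (𝓝 (halfSpaceFun B v a b x)) := by
  obtain ⟨K₁, C₁, h₁⟩ := (h.inFamily hB 0).tendsto_chi (measurableSet_inSet B) continuous_linePt
    (fun o _ => linePt_im o) v (2 * (p + 1))
  obtain ⟨K₂, C₂, h₂⟩ := (h.arcFamily hB 0).tendsto_chi measurableSet_arcSet (continuous_arcPt B)
    (arcPt_im hB) v (2 * (p + 1))
  obtain ⟨K₃, C₃, h₃⟩ := (h.outFamily hB (q := 0) (by simpa using hM)).tendsto_chi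
    (measurableSet_outSet B) continuous_linePt (fun o _ => linePt_im o) v (2 * (p + 1))
  refine ⟨|C₁| + |C₂| + |C₃|, by positivity, K₁ + K₂ + K₃, fun x hx => ⟨fun ε hε hε1 => ?_, ?_⟩⟩
  · have hb : ∀ (C : ℝ) (k : ℕ), k ≤ K₁ + K₂ + K₃ →
        C * bracket x ^ k ≤ |C| * (1 + ‖x‖ ^ 2) ^ (K₁ + K₂ + K₃) := by
      intro C k hk
      have h1 : bracket x ^ k ≤ (1 + ‖x‖ ^ 2) ^ (K₁ + K₂ + K₃) := by
        have := bracket_rpow_le_pow (x := x) (e := k) (N := K₁ + K₂ + K₃) (by exact_mod_cast hk)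
        rwa [Real.rpow_natCast] at this
      have := bracket_pos x
      exact mul_le_mul (le_abs_self C) h1 (by positivity) (abs_nonneg C)
    rw [h.regInt_eq hB hM ha hK hol hg v hx hε hε1, add_mul, add_mul]
    refine norm_add₃_le.trans (add_le_add (add_le_add ?_ ?_) ?_)
    · exact ((h₁ x hx).1 ε hε).trans (hb _ _ (by omega))
    · exact ((h₂ x hx).1 ε hε).trans (hb _ _ (by omega))
    · exact ((h₃ x hx).1 ε hε).trans (hb _ _ (by omega))
  · refine (((h₁ x hx).2.add (h₂ x hx).2).add (h₃ x hx).2).congr' ?_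
    filter_upwards [Ioc_mem_nhdsGT one_pos] with ε hε
    exact (h.regInt_eq hB hM ha hK hol hg v hx hε.1 hε.2).symm

/-- Both sides are limits, as `ε → 0`, of the same regularized pairing. On the function side the
uniform polynomial bound holds only for `x_n ≥ 0`, and the support of `φ` confines the integral to
that region. -/
theorem BdryData.integral_halfSpaceFun (hB : 0 < B) (h : BdryData μ ν m m₂ B M a b)
    (hM : m - M ≤ -2) (ha : Amp p a) (hK : K ≤ 2 * p)
    (hol : ∀ (x : E (d + 1)) (ξ' : E d) (z : ℂ), B * bracket ξ' ≤ ‖z‖ →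
      DifferentiableAt ℂ (fun z => b (x, ξ', z)) z)
    (hg : ∀ (x : E (d + 1)) (ξ' : E d),
      (fun z => b (x, ξ', z)) =O[Bornology.cobounded ℂ] fun z => z ^ K)
    (v : 𝓢(E d, ℂ)) {φ : 𝓢(E (d + 1), ℂ)} (hφ : tsupport φ ⊆ upperHalf d)
    (hi : Integrable fun ξ => v (tang ξ) * ampInt a φ ξ) :
    ∫ ξ, v (tang ξ) * ampInt a φ ξ = ∫ x, halfSpaceFun B v a b x * φ x := by
  obtain ⟨C, hC, L, hb⟩ := h.tendsto_regInt hB hM ha hK hol hg v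
  refine tendsto_nhds_unique (Amp.tendsto_reg φ hi (2 * (p + 1))) ?_
  have hlim : Tendsto (fun ε : ℝ => ∫ x, regInt (2 * (p + 1)) ε v a x * φ x) (𝓝[>] 0)
      (𝓝 (∫ x, halfSpaceFun B v a b x * φ x)) := by
    have h0 : ∀ x, x ∉ upperHalf d → φ x = 0 := fun x hx =>
      image_eq_zero_of_notMem_tsupport fun hx' => hx (hφ hx')
    refine tendsto_integral_filter_of_dominated_convergence
      (fun x => C * ((1 + ‖x‖ ^ 2) ^ L * ‖φ x‖)) ?_ ?_ ((integrable_bracket_mul L φ).const_mul C)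
      (ae_of_all _ fun x => ?_)
    · filter_upwards [Ioc_mem_nhdsGT one_pos] with ε hε
      exact (ha.integral_reg v φ hε.1 hε.2).1.aestronglyMeasurable
    · filter_upwards [Ioc_mem_nhdsGT one_pos] with ε hε
      refine ae_of_all _ fun x => ?_
      by_cases hx : x ∈ upperHalf d
      · rw [norm_mul, ← mul_assoc]
        exact mul_le_mul_of_nonneg_right ((hb x (le_of_lt hx)).1 ε hε.1 hε.2) (norm_nonneg _)
      · simp [h0 x hx]
    · by_cases hx : x ∈ upperHalf d
      · exact (hb x (le_of_lt hx)).2.mul_const _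
      · simp [h0 x hx]
  refine hlim.congr' ?_
  filter_upwards [Ioc_mem_nhdsGT one_pos] with ε hε
  exact (ha.integral_reg v φ hε.1 hε.2).2.symm

end HalfSpace

/-! ### Boundary values -/

section BoundaryValues

variable {d : ℕ}

theorem dDir_mulA {a : E (d + 1) × E (d + 1) → ℂ} (v : E (d + 1) × E (d + 1))
    (ha : Differentiable ℝ a) : dDir v (mulA a) =
      fun p => mulA (dDir v a) p + Complex.I * ((v.2 (Fin.last d) : ℝ) : ℂ) * a p := by
  ext p
  have h : HasFDerivAt (mulA a) _ p := ((Complex.ofRealCLM.comp ((EuclideanSpace.proj (Fin.last d)).comp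
    (ContinuousLinearMap.snd ℝ (E (d + 1)) (E (d + 1))))).hasFDerivAt.const_mul Complex.I).mul
      (ha p).hasFDerivAt
  rw [dDir, h.fderiv]
  simp [mulA, dDir]
  ring

/-- The commutator of a derivative with multiplication by `iξ_n` is multiplication by a constant.
Induction on the word, peeling off the innermost derivative, reduces to the bound for `iξ_n` times
an amplitude. -/
theorem Amp.mulA {p : ℕ} {a : E (d + 1) × E (d + 1) → ℂ} (ha : Amp p a) : Amp (p + 1) (mulA a) where
  smooth := contDiff_iff_contDiffAt.2 fun _ => contDiffAt_mulA ha.smooth.contDiffAt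
  bound L := by
    induction L using List.reverseRecOn generalizing a with
    | nil =>
      obtain ⟨C, hC, N, h⟩ := ha.bound []
      refine ⟨C, hC, N, fun q => ?_⟩
      have h1 : |q.2 (Fin.last d)| ≤ 1 + ‖q.2‖ ^ 2 := by
        have : |q.2 (Fin.last d)| ≤ ‖q.2‖ := by
          simpa using PiLp.norm_apply_le q.2 (Fin.last d)
        nlinarith [norm_nonneg q.2, sq_nonneg (‖q.2‖ - 1)]
      have h2 := h q
      simp only [List.map_nil, dList_nil] at h2 ⊢
      rw [SGBoundary.mulA, norm_mul, norm_mul, Complex.norm_I, one_mul, Complex.norm_real,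
        Real.norm_eq_abs, mul_comm]
      refine (mul_le_mul h2 h1 (abs_nonneg _) (by positivity)).trans_eq ?_
      ring
    | append_singleton L i ih =>
      obtain ⟨C, hC, N, h⟩ := ih (ha.deriv i)
      obtain ⟨C', hC', N', h'⟩ := ha.bound L
      set c : ℂ := Complex.I * (((bdryBasis (d + 1) i).2 (Fin.last d) : ℝ) : ℂ) with hc
      refine ⟨C + ‖c‖ * C', by positivity, N + N', fun q => ?_⟩
      have hx : (1 : ℝ) ≤ 1 + ‖q.1‖ ^ 2 := by nlinarith [sq_nonneg ‖q.1‖]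
      have hξ : (1 : ℝ) ≤ 1 + ‖q.2‖ ^ 2 := by nlinarith [sq_nonneg ‖q.2‖]
      have hsm : ContDiffAt ℝ ∞ (SGBoundary.mulA (dDir (bdryBasis (d + 1) i) a)) q :=
        contDiffAt_mulA (ha.deriv i).smooth.contDiffAt
      rw [List.map_append, dList_append, List.map_singleton, dList_cons, dList_nil,
        dDir_mulA _ (ha.smooth.differentiable (by simp)),
        dList_add _ (contDiffAt_infty.1 hsm _)
          (contDiffAt_infty.1 (contDiffAt_const.mul ha.smooth.contDiffAt) _), dList_const_mul,
        add_mul, add_mul]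
      refine (norm_add_le _ _).trans (add_le_add ((h q).trans ?_) ?_)
      · gcongr
        omega
      · rw [norm_mul, mul_assoc, mul_assoc]
        refine mul_le_mul_of_nonneg_left ((h' q).trans ?_) (norm_nonneg c)
        rw [mul_assoc]
        gcongr
        · omega
        · omega

theorem Amp.mulA_iterate {p : ℕ} {a : E (d + 1) × E (d + 1) → ℂ} (ha : Amp p a) (j : ℕ) :
    Amp (p + j) (SGBoundary.mulA^[j] a) := by
  induction j with
  | zero => exact ha
  | succ j ih => rw [Function.iterate_succ_apply']; exact ih.mulA

theorem mulB_iterate (j : ℕ) (b : E (d + 1) × E d × ℂ → ℂ) (q : E (d + 1) × E d × ℂ) :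
    mulB^[j] b q = (Complex.I * q.2.2) ^ j * b q := by
  induction j with
  | zero => simp
  | succ j ih => rw [Function.iterate_succ_apply', mulB, ih, pow_succ']; ring

theorem tw_slice (c : ℂ) {F : XV d → ℂ} {ξ' : E d} {x : E (d + 1)}
    (hF : DifferentiableAt ℝ F (x, ξ')) :
    tw (unitVec (Fin.last d)) c (fun x => F (x, ξ')) x = tw (enV d) c F (x, ξ') := by
  have h : (fun x => F (x, ξ')) =
      fun x => F (ContinuousLinearMap.inl ℝ (E (d + 1)) (E d) x + (0, ξ')) := by
    ext x; simp
  rw [tw, tw, h, dDir_comp_affine _ _ _ (by simpa using hF)]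
  simp [enV]

theorem tw_const_mul {V : Type} [NormedAddCommGroup V] [NormedSpace ℝ V] (v : V) (c K : ℂ)
    (f : V → ℂ) : tw v c (fun p => K * f p) = fun p => K * tw v c f p := by
  ext p
  simp only [tw, dDir_const_mul]
  ring

variable {μ ν m m₂ B : ℝ} {M : ℕ} {a : E (d + 1) × E (d + 1) → ℂ} {b : E (d + 1) × E d × ℂ → ℂ}

theorem BdryData.tw_lineFun (h : BdryData μ ν m m₂ B M a b) (o : E d × ℝ) :
    SGBoundary.tw (unitVec (Fin.last d)) (linePt o) (lineFun a o) = lineFun (twA a) o := by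
  ext x
  have hs := (h.line_smooth o.2 (x, o.1)).differentiableAt (by simp)
  refine (tw_slice (linePt o) hs).trans ?_
  rw [lineFun, lineFam_twA (h.smooth.differentiable (by simp)), linePt]

theorem BdryData.tw_lineFun_rem (h : BdryData μ ν m m₂ B M a b) {o : E d × ℝ} (ho : B ≤ |o.2|) :
    SGBoundary.tw (unitVec (Fin.last d)) (linePt o) (lineFun (fun p => a p - realRestrict b p) o) =
      lineFun (fun p => twA a p - realRestrict (twB b) p) o := by
  ext x
  have hs : ContDiffAt ℝ ∞ (lineFam (fun p => a p - realRestrict b p) o.2) (x, o.1) :=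
    contDiffAt_lineFam (h.smooth.contDiffAt.sub (h.real_smooth _ _ _ ho))
  refine (tw_slice (linePt o) (hs.differentiableAt (by simp))).trans ?_
  rw [lineFun, ← h.tw_lineFam_rem ho, linePt]

theorem BdryData.tw_arcFun (hB : 0 < B) (h : BdryData μ ν m m₂ B M a b) (o : E d × ℝ) :
    SGBoundary.tw (unitVec (Fin.last d)) (arcPt B o) (arcFun B b o) = arcFun B (twB b) o := by
  ext x
  have hs : ContDiffAt ℝ ∞ (compFam b (arcPt B o)) (x, o.1) :=
    contDiffAt_compFam (h.circle_smooth _ _ _ (norm_arcPt hB o))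
  have e := tw_slice (arcPt B o) (hs.differentiableAt (by simp))
  change SGBoundary.tw _ _ (fun x => Complex.I * arcPt B o * compFam b (arcPt B o) (x, o.1)) x = _
  rw [tw_const_mul]
  simp only [e, arcFun, compFam_twB]

theorem oscInt_congr {S : Set (E d × ℝ)} (hS : MeasurableSet S) {c : E d × ℝ → ℂ} (v : 𝓢(E d, ℂ))
    {f g : E d × ℝ → E (d + 1) → ℂ} (h : ∀ o ∈ S, f o = g o) : oscInt S c v f = oscInt S c v g := by
  ext x
  exact setIntegral_congr_fun hS fun o ho => by simp only [h o ho]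

theorem twList_replicate {S : Set (E d × ℝ)} {c : E d × ℝ → ℂ} {f : ℕ → E d × ℝ → E (d + 1) → ℂ}
    (h : ∀ k, ∀ o ∈ S, tw (unitVec (Fin.last d)) (c o) (f k o) = f (k + 1) o) (k : ℕ) :
    ∀ o ∈ S, twList (phase o.1 (c o)) ((List.replicate k (Fin.last d)).map unitVec) (f 0 o) =
      f k o := by
  intro o ho
  induction k with
  | zero => rfl
  | succ k ih =>
    rw [← h k o ho, ← ih, List.replicate_succ, List.map_cons]
    change tw _ (phase o.1 (c o) (unitVec (Fin.last d))) _ = _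
    rw [phase_unitVec_last]
    rfl

/-- In the normal direction the phase has derivative `z`, so `∂_{x_n}` acts on each of the three
amplitudes as `∂_{x_n} + iz`. The three results are the pieces belonging to the twisted symbol and
the twisted approximation. -/
theorem BdryData.halfSpaceFun_derivatives (hB : 0 < B) (hν : 0 ≤ ν)
    (h : BdryData μ ν m m₂ B M a b) {q : ℕ} (hM : m - M ≤ -2 - q) (v : 𝓢(E d, ℂ)) :
    ContDiffOn ℝ (q : ℕ∞) (halfSpaceFun B v a b) (upperHalf d) ∧
    ∀ x ∈ upperHalf d, (dDir (unitVec (Fin.last d)))^[q] (halfSpaceFun B v a b) x =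
      halfSpaceFun B v (twA^[q] a) (twB^[q] b) x := by
  obtain ⟨s1, e1⟩ := (h.inFamily hB q).derivatives (measurableSet_inSet B) continuous_linePt
    (fun o _ => linePt_im o) v
  obtain ⟨s2, e2⟩ := (h.arcFamily hB q).derivatives measurableSet_arcSet (continuous_arcPt B)
    (arcPt_im hB) v
  obtain ⟨s3, e3⟩ := (h.outFamily hB hM).derivatives (measurableSet_outSet B) continuous_linePt
    (fun o _ => linePt_im o) v
  have hk : ∀ k : ℕ, BdryData μ ν (m + k) m₂ B M (twA^[k] a) (twB^[k] b) := fun k => by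
    simpa using h.iterate hB hν k 0
  have t1 := twList_replicate (S := inSet d B) (c := linePt)
    (f := fun k => lineFun (twA^[k] a)) (fun k o _ => by
      simp only [Function.iterate_succ_apply']; exact (hk k).tw_lineFun o) q
  have t2 := twList_replicate (S := arcSet d) (c := arcPt B)
    (f := fun k => arcFun B (twB^[k] b)) (fun k o _ => by
      simp only [Function.iterate_succ_apply']; exact (hk k).tw_arcFun hB o) q
  have t3 := twList_replicate (S := outSet d B) (c := linePt)
    (f := fun k => lineFun fun p => (twA^[k] a) p - realRestrict (twB^[k] b) p) (fun k o ho => by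
      simp only [Function.iterate_succ_apply']
      exact (hk k).tw_lineFun_rem ((le_mul_of_one_le_right hB.le (one_le_bracket _)).trans ho)) q
  refine ⟨(s1.add s2).add s3, fun x hx => ?_⟩
  have hU : upperHalf d ∈ 𝓝 x := isOpen_upperHalf.mem_nhds hx
  set L := List.replicate q (Fin.last d) with hL
  have hlen : L.length = q := List.length_replicate
  have hl : (L.map unitVec).length = q := by rw [List.length_map, hlen]
  have hrep : L.map unitVec = List.replicate q (unitVec (Fin.last d)) := List.map_replicate
  have c1 := s1.contDiffAt hU
  have c2 := s2.contDiffAt hU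
  have c3 := s3.contDiffAt hU
  rw [← hl] at c1 c2 c3
  rw [← dList_replicate, ← hrep]
  change dList _ (fun x => (oscInt _ _ v _ x + oscInt _ _ v _ x) + oscInt _ _ v _ x) x = _
  rw [dList_add _ (c1.add c2) c3, dList_add _ c1 c2, e1 L hlen.le x hx, e2 L hlen.le x hx,
    e3 L hlen.le x hx]
  exact congrArg₂ (· + ·) (congrArg₂ (· + ·)
    (congrFun (oscInt_congr (measurableSet_inSet B) v t1) x)
    (congrFun (oscInt_congr measurableSet_arcSet v t2) x))
    (congrFun (oscInt_congr (measurableSet_outSet B) v t3) x)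

theorem BdryData.tendsto_halfSpaceFun (hB : 0 < B) (h : BdryData μ ν m m₂ B M a b)
    (hM : m - M ≤ -2) (v : 𝓢(E d, ℂ)) (x' : E d) :
    Tendsto (fun t : ℝ => halfSpaceFun B v a b (glue x' t)) (𝓝[>] 0)
      (𝓝 (∫ ξ', expI x' ξ' * bdrySym B a b (x', ξ') * v ξ')) := by
  rw [← h.oscInt_boundary hB hM v x']
  exact (((h.inFamily hB 0).tendsto_boundary (measurableSet_inSet B) continuous_linePt
    (fun o _ => linePt_im o) v x').add ((h.arcFamily hB 0).tendsto_boundary measurableSet_arcSet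
    (continuous_arcPt B) (arcPt_im hB) v x')).add
    ((h.outFamily hB (q := 0) (by simpa using hM)).tendsto_boundary (measurableSet_outSet B)
      continuous_linePt (fun o _ => linePt_im o) v x')

theorem fourierConst_succ (d : ℕ) :
    fourierConst (d + 1) = fourierConst d * ((2 * Real.pi : ℝ) : ℂ)⁻¹ := by
  rw [fourierConst, fourierConst, pow_succ, mul_inv]
  push_cast
  ring

/-- One length `M₀` of the expansion defines the symbol and the function in the half-space. Other
lengths serve only to prove that this function is smooth. -/
theorem exists_boundary_symbol (hμ : 1 < μ) (hν : 1 < ν) {m₁ : ℤ} (ha : IsSGSymbol μ ν m₁ m₂ a)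
    (hA : AssumptionA μ ν m₁ m₂ a) (k j : ℕ) :
    ∃ akj : E d × E d → ℂ, IsSGSymbol μ ν ((m₁ : ℝ) + j + k + 1) m₂ akj ∧
      ∀ u : 𝓢(E d, ℂ), ∃ T : 𝓢'(E (d + 1), ℂ),
        IsOpOfDistribution a (layerDeriv u j) T ∧ HasBoundaryLimit k T (op akj u) := by
  have hν0 : 0 ≤ ν := by linarith
  obtain ⟨B, hB, r, hr, hrB, hsp⟩ := exists_splitting hμ ha hA
  choose b hb using hsp
  have hbd : ∀ M, BdryData μ ν (m₁ + j) m₂ B M (mulA^[j] a) (mulB^[j] (b M)) := fun M => by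
    simpa using ((hb M).bdryData hrB ha).iterate hB hν0 0 j
  have hm₁ : (m₁ : ℝ) ≤ m₁.toNat := by exact_mod_cast Int.self_le_toNat m₁
  have hamp := (ha.amp hm₁).mulA_iterate j
  have hK : m₁.toNat + j ≤ 2 * (m₁.toNat + j) := by omega
  have hol : ∀ M, ∀ (x : E (d + 1)) (ξ' : E d) (z : ℂ), B * bracket ξ' ≤ ‖z‖ →
      DifferentiableAt ℂ (fun z => (mulB^[j] (b M)) (x, ξ', z)) z := fun M x ξ' z hz => by
    simp only [mulB_iterate]
    refine ((differentiableAt_id.const_mul Complex.I).pow j).mul ((hb M).holomorphic x ξ' z ?_)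
    nlinarith [bracket_pos ξ']
  have hg : ∀ M, ∀ (x : E (d + 1)) (ξ' : E d), (fun z => (mulB^[j] (b M)) (x, ξ', z))
      =O[Bornology.cobounded ℂ] fun z => z ^ (m₁.toNat + j) := fun M x ξ' => by
    simp only [mulB_iterate]
    have h1 : (fun z : ℂ => (Complex.I * z) ^ j) =O[Bornology.cobounded ℂ] fun z => z ^ j :=
      Asymptotics.isBigO_of_le _ fun z => by simp
    refine (h1.mul ((hb M).growth x ξ')).congr_right fun z => ?_
    rw [pow_add, mul_comm]
  -- After `j` factors `iξ_n` and `k` normal derivatives the remainder has order `m₁ + j + k - M₀`,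
  -- which must be at most `-2` for integrability in `ξ_n`.
  obtain ⟨M₀, hM₀⟩ := exists_nat_ge ((m₁ : ℝ) + j + k + 2)
  have hMk : (m₁ : ℝ) + j - M₀ ≤ -2 - k := by linarith
  have hM0 : (m₁ : ℝ) + j - M₀ ≤ -2 := by linarith [(Nat.cast_nonneg k : (0 : ℝ) ≤ k)]
  have hbdk : BdryData μ ν (m₁ + j + k) m₂ B M₀ (twA^[k] (mulA^[j] a)) (twB^[k] (mulB^[j] (b M₀))) :=
    ((hb M₀).bdryData hrB ha).iterate hB hν0 k j
  have hMk' : (m₁ : ℝ) + j + k - M₀ ≤ -2 := by linarith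
  -- The factor `(-i)^k` turns `∂_{x_n}^k` into `D_{x_n}^k`, and `(2π)^(-1)` is the part of the
  -- Fourier constant that belongs to the integration in `ξ_n`.
  set σ : ℂ := (-Complex.I) ^ k * ((2 * Real.pi : ℝ) : ℂ)⁻¹ with hσ
  refine ⟨fun p => σ * bdrySym B (twA^[k] (mulA^[j] a)) (twB^[k] (mulB^[j] (b M₀))) p,
    (hbdk.isSGSymbol hB hMk').const_mul σ, fun u => ?_⟩
  have hamp0 := ha.amp hm₁
  refine ⟨opLayer hamp0 u j, isOpOfDistribution_opLayer hamp0 u j, ?_⟩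
  set v := hatSchwartz u with hv
  set W : ℕ → E (d + 1) → ℂ := fun M => halfSpaceFun B v (mulA^[j] a) (mulB^[j] (b M)) with hW
  -- The regularized integrals involve `a` but not its approximation, so for any admissible `M`
  -- their limit is the same function.
  have hindep : ∀ M : ℕ, (m₁ : ℝ) + j - M ≤ -2 → ∀ x ∈ upperHalf d, W M₀ x = W M x := by
    intro M hM x hx
    obtain ⟨_, -, _, h₀⟩ := (hbd M₀).tendsto_regInt hB hM0 hamp hK (hol M₀) (hg M₀) v
    obtain ⟨_, -, _, h₁⟩ := (hbd M).tendsto_regInt hB hM hamp hK (hol M) (hg M) v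
    exact tendsto_nhds_unique (h₀ x (le_of_lt hx)).2 (h₁ x (le_of_lt hx)).2
  refine ⟨fun x => fourierConst (d + 1) * W M₀ x, ?_, fun φ _ hφ => ?_, fun x' => ?_⟩
  · refine contDiffOn_const.mul (contDiffOn_infty.2 fun n => ?_)
    -- For each order of differentiability `n` the function is rewritten with an expansion long
    -- enough to allow `n` derivatives.
    obtain ⟨M, hM⟩ := exists_nat_ge ((m₁ : ℝ) + j + n + 2)
    have hMn : (m₁ : ℝ) + j - M ≤ -2 - n := by linarith
    exact ((hbd M).halfSpaceFun_derivatives hB hν0 hMn v).1.congr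
      (hindep M (by linarith [(Nat.cast_nonneg n : (0 : ℝ) ≤ n)]))
  · obtain ⟨hi, e⟩ := opLayer_apply hamp0 u j φ
    simp only [← hatSchwartz_apply] at hi e
    rw [e, (hbd M₀).integral_halfSpaceFun hB hM0 hamp hK (hol M₀) (hg M₀) v hφ hi,
      ← integral_const_mul]
    simp only [mul_assoc, hW]
  · have hlim := (hbdk.tendsto_halfSpaceFun hB hMk' v x').const_mul
      ((-Complex.I) ^ k * fourierConst (d + 1))
    have he : op (fun p => σ * bdrySym B (twA^[k] (mulA^[j] a)) (twB^[k] (mulB^[j] (b M₀))) p) u x' =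
        (-Complex.I) ^ k * fourierConst (d + 1) * ∫ ξ', expI x' ξ' *
          bdrySym B (twA^[k] (mulA^[j] a)) (twB^[k] (mulB^[j] (b M₀))) (x', ξ') * v ξ' := by
      have e : ∀ ξ', expI x' ξ' * (σ * bdrySym B (twA^[k] (mulA^[j] a))
          (twB^[k] (mulB^[j] (b M₀))) (x', ξ')) * hat u ξ' = σ * (expI x' ξ' *
          bdrySym B (twA^[k] (mulA^[j] a)) (twB^[k] (mulB^[j] (b M₀))) (x', ξ') * v ξ') := by
        intro ξ'
        rw [hv, hatSchwartz_apply]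
        ring
      rw [op]
      simp only [e, integral_const_mul]
      rw [fourierConst_succ, hσ]
      ring
    rw [he]
    refine hlim.congr' ?_
    filter_upwards [self_mem_nhdsWithin] with t ht
    have hx : glue x' t ∈ upperHalf d := by simpa [upperHalf] using ht
    rw [← ((hbd M₀).halfSpaceFun_derivatives hB hν0 hMk v).2 _ hx, ← dList_replicate,
      ← dList_replicate, dList_const_mul, mul_assoc]

end BoundaryValues

end SGBoundary

end

theorem mainTheorem8 (d : ℕ) (μ ν : ℝ) (hμ : 1 < μ) (hν : 1 < ν) (m₁ : ℤ) (m₂ : ℝ)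
    (a : E (d + 1) × E (d + 1) → ℂ) (ha : IsSGSymbol μ ν (m₁ : ℝ) m₂ a)
    (hA : AssumptionA μ ν m₁ m₂ a) (k j : ℕ) :
    ∃ akj : E d × E d → ℂ, IsSGSymbol μ ν ((m₁ : ℝ) + j + k + 1) m₂ akj ∧
      ∀ u : 𝓢(E d, ℂ), ∃ T : 𝓢'(E (d + 1), ℂ),
        IsOpOfDistribution a (layerDeriv u j) T ∧ HasBoundaryLimit k T (op akj u) := by
  exact exists_boundary_symbol hμ hν ha hA k j
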